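/- Let $\nu\ge 1/4$, $|\theta|\le\min(1,2\sqrt\nu-1)$, $\tau\in\mathbb R$, $n\ge 2$, and let $X_1,\dots,X_n$ be independent random variables, each having the strictly stable law with characteristic function $$\hat g(k;\nu,\theta,\tau)=\exp\Big\{-\exp\Big\{\nu^{-1/2}\big(\log|k|+\tau-i\tfrac{\pi}{2}\theta\,\operatorname{sign}k\big)+\mathbf C\,(\nu^{-1/2}-1)\Big\}\Big\}\quad(k\ne0),\qquad \hat g(0)=1,$$ where $\mathbf C$ is Euler's constant (so that $\nu=\alpha^{-2}$ for the characteristic exponent $\alpha$). Put $U_j=\operatorname{sign}X_j$, $V_j=\log|X_j|$, and for a sample $Y=(Y_1,\dots,Y_n)$ let $A_Y=\frac1n\sum_{j}Y_j$ and $B_Y^2=\frac1{n-1}\sum_{j}(Y_j-A_Y)^2$. Define the estimators $$\tilde\theta=A_U,\qquad \hat\nu=\frac{6}{\pi^2}B_V^2-\frac32B_U^2+1,\qquad \tilde\nu=\max\Big(\hat\nu,\frac{(1+|\tilde\theta|)^2}{4}\Big).$$ With $\zeta$ the Riemann zeta function, write $$D=\frac{\pi^2}{4}(1-\theta^2)+\frac{\pi^2}{6}(\nu-1),\quad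 q_4=\frac{1-\theta^4}{8}+\frac{\nu^2-1}{15},\quad q_6=\frac{1-\theta^6}{32}+\frac{\nu^3-1}{63},\quad q_8=\frac{17(1-\theta^8)}{128}+\frac{\nu^4-1}{15},$$ $$z_3=\zeta(3)(\nu^{3/2}-1),\qquad z_5=\zeta(5)(\nu^{5/2}-1),$$ $$\begin{aligned}P_1={}&16(15\theta^2-71\theta^4+26\theta^6-45\theta^8)+\tfrac{12}{n-1}(5-96\theta^2+302\theta^4-356\theta^6+155\theta^8)\\&+\tfrac{4}{(n-1)^2}(-33+436\theta^2-1238\theta^4+1300\theta^6-465\theta^8)+\tfrac{16}{(n-1)^3}(5-52\theta^2+134\theta^4-132\theta^6+45\theta^8),\end{aligned}$$ $$\begin{aligned}P_2={}&4\{18D^4+39D^2\pi^4q_4+96z_3^2D+8\pi^8q_4^2+48\pi^6q_6D+384z_3z_5+2\pi^8q_8\}\\&+\tfrac{12}{n-1}\{15D^4+25D^2\pi^4q_4+16\pi^6q_6D+32z_3^2D+2\pi^8q_4^2\}\\&+\tfrac{12}{(n-1)^2}\{-32z_3^2D-128z_3z_5+12D^2\pi^4q_4+13D^4\}+\tfrac{8}{(n-1)^3}\{\pi^8q_4^2+6D^4-48z_3^2D\},\end{aligned}$$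 $$P_3=3\sqrt[4]{3}\,\sqrt{\theta^2(1-\theta^2)}+\frac{6\sqrt[4]{3}}{\pi^2}\sqrt{\pi^4q_4+3D^2},$$ $$P_3'=n^{1/4}\Big(P_3+\frac32\Big(\frac{|P_1|}{n}\Big)^{1/4}+\frac{6}{\pi^2}\Big(\frac{|P_2|}{n}\Big)^{1/4}\Big)^4-n^{1/4}P_3^4 .$$ Then $(\tilde\nu-\nu)^4$ is integrable and $$\mathbb E(\tilde\nu-\nu)^4\le\frac{P_3^4}{n^2}+\frac{P_3'}{n^{9/4}} .$$ -/

import Mathlib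

open MeasureTheory ProbabilityTheory

namespace StableEst

noncomputable section

/-- The admissible parameters `(ν, θ)` of a strictly stable law in the parametrization
`ν = α⁻²`; the third parameter `τ` ranges over all reals. -/
def Admissible (ν θ : ℝ) : Prop :=
  1 / 4 ≤ ν ∧ |θ| ≤ min 1 (2 * Real.sqrt ν - 1)

/-- The characteristic function of the strictly stable law with parameters `ν, θ, τ`,
`exp(-exp(ν^(-1/2) (log |k| + τ - i (π/2) θ sign k) + C (ν^(-1/2) - 1)))`, where `C` is
Euler's constant. The point `k = 0`, where `log |k| = -∞`, gets the limit value `1`. -/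
def strictlyStableCharFun (ν θ τ k : ℝ) : ℂ :=
  if k = 0 then 1
  else
    Complex.exp (-Complex.exp
      (((ν ^ (-(1 / 2) : ℝ) : ℝ) : ℂ) *
          ((Real.log |k| : ℂ) + (τ : ℂ) - Complex.I * (((Real.pi / 2) * θ * Real.sign k : ℝ) : ℂ))
        + ((Real.eulerMascheroniConstant * (ν ^ (-(1 / 2) : ℝ) - 1) : ℝ) : ℂ)))

/-- The measure `μ` is the strictly stable law with parameters `ν, θ, τ`. -/
def IsStrictlyStableLaw (μ : Measure ℝ) (ν θ τ : ℝ) : Prop :=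
  ∀ k : ℝ, charFun μ k = strictlyStableCharFun ν θ τ k

/-- The sample mean `A`. -/
def sampleMean {n : ℕ} (x : Fin n → ℝ) : ℝ :=
  (1 / (n : ℝ)) * ∑ j, x j

/-- The sample variance `B²`, with the factor `1 / (n - 1)`. -/
def sampleVar {n : ℕ} (x : Fin n → ℝ) : ℝ :=
  (1 / ((n : ℝ) - 1)) * ∑ j, (x j - sampleMean x) ^ 2

/-- The signs `U_j` of a sample. -/
def signs {n : ℕ} (x : Fin n → ℝ) : Fin n → ℝ := fun j => Real.sign (x j)

/-- The logarithms `V_j` of the absolute values of a sample. -/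
def logs {n : ℕ} (x : Fin n → ℝ) : Fin n → ℝ := fun j => Real.log |x j|

/-- The estimator `θ̃`. -/
def thetaTilde {n : ℕ} (x : Fin n → ℝ) : ℝ := sampleMean (signs x)

/-- The preliminary estimator `ν̂`. -/
def nuHat {n : ℕ} (x : Fin n → ℝ) : ℝ :=
  6 / Real.pi ^ 2 * sampleVar (logs x) - 3 / 2 * sampleVar (signs x) + 1

/-- The estimator `ν̃`. -/
def nuTilde {n : ℕ} (x : Fin n → ℝ) : ℝ :=
  max (nuHat x) ((1 + |thetaTilde x|) ^ 2 / 4)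

/-- The value `ζ(s)` of the Riemann zeta function at a natural number `s ≥ 2`, as a real. -/
def zetaR (s : ℕ) : ℝ := (riemannZeta (s : ℂ)).re

/-- The quantity `DV`. -/
def DV (ν θ : ℝ) : ℝ :=
  Real.pi ^ 2 / 4 * (1 - θ ^ 2) + Real.pi ^ 2 / 6 * (ν - 1)

/-- The fourth cumulant of `log |X|` is `π ^ 4 * q4 ν θ`. -/
def q4 (ν θ : ℝ) : ℝ := (1 - θ ^ 4) / 8 + (ν ^ 2 - 1) / 15

/-- The combination that occurs as `π ^ 6 * q6 ν θ` in the sixth moment of `log |X|`. -/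
def q6 (ν θ : ℝ) : ℝ := (1 - θ ^ 6) / 32 + (ν ^ 3 - 1) / 63

/-- The combination that occurs as `π ^ 8 * q8 ν θ` in the eighth moment of `log |X|`. -/
def q8 (ν θ : ℝ) : ℝ := 17 * (1 - θ ^ 8) / 128 + (ν ^ 4 - 1) / 15

/-- `ζ(3) (ν^(3/2) - 1)`. -/
def z3 (ν : ℝ) : ℝ := zetaR 3 * (ν ^ (3 / 2 : ℝ) - 1)

/-- `ζ(5) (ν^(5/2) - 1)`. -/
def z5 (ν : ℝ) : ℝ := zetaR 5 * (ν ^ (5 / 2 : ℝ) - 1)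

/-- The quantity `P₁`. -/
def P1 (n : ℕ) (θ : ℝ) : ℝ :=
  16 * (15 * θ ^ 2 - 71 * θ ^ 4 + 26 * θ ^ 6 - 45 * θ ^ 8)
    + 12 / ((n : ℝ) - 1) * (5 - 96 * θ ^ 2 + 302 * θ ^ 4 - 356 * θ ^ 6 + 155 * θ ^ 8)
    + 4 / ((n : ℝ) - 1) ^ 2 *
        (-33 + 436 * θ ^ 2 - 1238 * θ ^ 4 + 1300 * θ ^ 6 - 465 * θ ^ 8)
    + 16 / ((n : ℝ) - 1) ^ 3 * (5 - 52 * θ ^ 2 + 134 * θ ^ 4 - 132 * θ ^ 6 + 45 * θ ^ 8)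

/-- The quantity `P₂`. -/
def P2 (n : ℕ) (ν θ : ℝ) : ℝ :=
  4 * (18 * DV ν θ ^ 4 + 39 * DV ν θ ^ 2 * Real.pi ^ 4 * q4 ν θ + 96 * z3 ν ^ 2 * DV ν θ
      + 8 * Real.pi ^ 8 * q4 ν θ ^ 2 + 48 * Real.pi ^ 6 * q6 ν θ * DV ν θ
      + 384 * z3 ν * z5 ν + 2 * Real.pi ^ 8 * q8 ν θ)
    + 12 / ((n : ℝ) - 1) *
        (15 * DV ν θ ^ 4 + 25 * DV ν θ ^ 2 * Real.pi ^ 4 * q4 ν θ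
          + 16 * Real.pi ^ 6 * q6 ν θ * DV ν θ + 32 * z3 ν ^ 2 * DV ν θ
          + 2 * Real.pi ^ 8 * q4 ν θ ^ 2)
    + 12 / ((n : ℝ) - 1) ^ 2 *
        (-32 * z3 ν ^ 2 * DV ν θ - 128 * z3 ν * z5 ν
          + 12 * DV ν θ ^ 2 * Real.pi ^ 4 * q4 ν θ + 13 * DV ν θ ^ 4)
    + 8 / ((n : ℝ) - 1) ^ 3 *
        (Real.pi ^ 8 * q4 ν θ ^ 2 + 6 * DV ν θ ^ 4 - 48 * z3 ν ^ 2 * DV ν θ)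

/-- The quantity `P₃`. -/
def P3 (ν θ : ℝ) : ℝ :=
  3 * (3 : ℝ) ^ (1 / 4 : ℝ) * Real.sqrt (θ ^ 2 * (1 - θ ^ 2))
    + 6 * (3 : ℝ) ^ (1 / 4 : ℝ) / Real.pi ^ 2 *
        Real.sqrt (Real.pi ^ 4 * q4 ν θ + 3 * DV ν θ ^ 2)

/-- The quantity `P₃'`. -/
def P3' (n : ℕ) (ν θ : ℝ) : ℝ :=
  (n : ℝ) ^ (1 / 4 : ℝ) *
      (P3 ν θ + 3 / 2 * (|P1 n θ| / n) ^ (1 / 4 : ℝ)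
        + 6 / Real.pi ^ 2 * (|P2 n ν θ| / n) ^ (1 / 4 : ℝ)) ^ 4
    - (n : ℝ) ^ (1 / 4 : ℝ) * P3 ν θ ^ 4

end

end StableEst

/-! For `0 < s < min(1, α)`, integrating `(1 - e^{ikX}) k^{-1-s}` over `k > 0` evaluates `E
(-iX)^s`, hence `E|X|^s` and `E sign(X)|X|^s`, through Gamma and trigonometric functions
(`IsStrictlyStableLaw.moments`). As `s` decreases to 0 this gives `X ≠ 0` almost surely and `E U =
θ`. Moreover `log E|X|^s` is analytic at 0, and the expansion of `log Γ(1 - s)` in zeta values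
yields the cumulants of `V`: `τ`, `D`, `2 z3`, `π⁴ q4`, `24 z5` and so on
(`IsStrictlyStableLaw.log_moments`).

The fourth central moment of a sample variance is a universal expression in cumulants
(`integral_sampleVar_sub_pow_four`). For `V` its correction term is exactly `P2`, with leading term
`3(π⁴ q4 + 2D²)²`; for `U` the exact correction term is `quarticSign`, which differs from `P1`.
Since `ν̂ - ν = (6/π²)(B_V² - D) - (3/2)(B_U² - (1 - θ²))`, Minkowski's inequality in `L⁴` controls
`ν̂`. The claimed bound is `rootBound ^ 4 / n²`, so what is left is to compare fourth roots, and to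
pay for replacing `quarticSign` by `P1` and for the truncation. As `(1 + |θ|)²/4 ≤ ν`, the
truncation can do harm only by overshooting `ν`.

If `θ² ≥ 9/25`, the overshoot is at most the sign error plus `(3/2)(1 - θ̃²)/(n - 1)`, because
`B_U²` is a function of `θ̃`; and `-P1` is at least 8 times the sum of `quarticSign` and the cost of
this extra term (`exists_roots_of_le_sq`).

If `θ² ≤ 9/25`, the overshoot is at most a multiple of `|θ̃ - θ|` and adds at most `2/n²` to the
fourth moment. This is paid by the surplus of `3D²` in `P3` over the true `2D²`, while the root of
`quarticSign` is absorbed by the terms coming from `V`, which are bounded below there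
(`exists_roots_of_sq_le`). -/

namespace StableEst

/-! ### Mixed moments of power sums of a centred sample, in order of the degree `2a + b`. -/

/-- The moment `𝔼 S₂ ^ a S₁ ^ b` of the power sums `S₁ = ∑ Yᵢ`, `S₂ = ∑ Yᵢ ^ 2` of `n` independent
copies of a variable with moments `m`, given by the recursion on `n`. -/
noncomputable def powerSumMoment (m : ℕ → ℝ) : ℕ → ℕ → ℕ → ℝ
  | 0, a, b => if a = 0 ∧ b = 0 then 1 else 0
  | n + 1, a, b => ∑ i ∈ Finset.range (a + 1), ∑ j ∈ Finset.range (b + 1),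
      (a.choose i : ℝ) * (b.choose j : ℝ) * powerSumMoment m n i j * m (2 * (a - i) + (b - j))

/-- In this and the following formulas, the factor `n(n-1)⋯(n-r+1)` stands for the terms with `r`
distinct indices. Since `m 1 = 0`, every index carries degree at least 2, so at most four indices
occur up to degree 8. -/
lemma powerSumMoment_0_0 (m : ℕ → ℝ) (h0 : m 0 = 1) (_ : m 1 = 0) (n : ℕ) :
    powerSumMoment m n 0 0 = 1 := by
  induction n with
  | zero => simp [powerSumMoment]
  | succ n ih => simp [powerSumMoment, ih, h0]

lemma powerSumMoment_0_1 (m : ℕ → ℝ) (h0 : m 0 = 1) (h1 : m 1 = 0) (n : ℕ) :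
    powerSumMoment m n 0 1 = 0 := by
  induction n with
  | zero => simp [powerSumMoment]
  | succ n ih =>
    simp only [powerSumMoment, Finset.sum_range_succ, Finset.sum_range_zero, ih, h0, h1,
      powerSumMoment_0_0 m h0 h1]
    simp [Nat.choose]

lemma powerSumMoment_0_2 (m : ℕ → ℝ) (h0 : m 0 = 1) (h1 : m 1 = 0) (n : ℕ) :
    powerSumMoment m n 0 2 = (n : ℝ) * m 2 := by
  induction n with
  | zero => simp [powerSumMoment]
  | succ n ih =>
    simp only [powerSumMoment, Finset.sum_range_succ, Finset.sum_range_zero, ih, h0, h1,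
      powerSumMoment_0_0 m h0 h1, powerSumMoment_0_1 m h0 h1]
    simp [Nat.choose]
    ring

lemma powerSumMoment_1_0 (m : ℕ → ℝ) (h0 : m 0 = 1) (h1 : m 1 = 0) (n : ℕ) :
    powerSumMoment m n 1 0 = (n : ℝ) * m 2 := by
  induction n with
  | zero => simp [powerSumMoment]
  | succ n ih =>
    simp only [powerSumMoment, Finset.sum_range_succ, Finset.sum_range_zero, ih, h0,
      powerSumMoment_0_0 m h0 h1]
    simp [Nat.choose]
    ring

lemma powerSumMoment_0_3 (m : ℕ → ℝ) (h0 : m 0 = 1) (h1 : m 1 = 0) (n : ℕ) :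
    powerSumMoment m n 0 3 = (n : ℝ) * m 3 := by
  induction n with
  | zero => simp [powerSumMoment]
  | succ n ih =>
    simp only [powerSumMoment, Finset.sum_range_succ, Finset.sum_range_zero, ih, h0, h1,
      powerSumMoment_0_0 m h0 h1, powerSumMoment_0_1 m h0 h1, powerSumMoment_0_2 m h0 h1]
    simp [Nat.choose]
    ring

lemma powerSumMoment_1_1 (m : ℕ → ℝ) (h0 : m 0 = 1) (h1 : m 1 = 0) (n : ℕ) :
    powerSumMoment m n 1 1 = (n : ℝ) * m 3 := by
  induction n with
  | zero => simp [powerSumMoment]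
  | succ n ih =>
    simp only [powerSumMoment, Finset.sum_range_succ, Finset.sum_range_zero, ih, h0, h1,
      powerSumMoment_0_0 m h0 h1, powerSumMoment_0_1 m h0 h1, powerSumMoment_1_0 m h0 h1]
    simp [Nat.choose]
    ring

lemma powerSumMoment_0_4 (m : ℕ → ℝ) (h0 : m 0 = 1) (h1 : m 1 = 0) (n : ℕ) :
    powerSumMoment m n 0 4 = (n : ℝ) * m 4 + (n : ℝ) * (n - 1) * 3 * m 2 ^ 2 := by
  induction n with
  | zero => simp [powerSumMoment]
  | succ n ih =>
    simp only [powerSumMoment, Finset.sum_range_succ, Finset.sum_range_zero, ih, h0, h1,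
      powerSumMoment_0_0 m h0 h1, powerSumMoment_0_1 m h0 h1, powerSumMoment_0_2 m h0 h1,
      powerSumMoment_0_3 m h0 h1]
    simp [Nat.choose]
    ring

lemma powerSumMoment_1_2 (m : ℕ → ℝ) (h0 : m 0 = 1) (h1 : m 1 = 0) (n : ℕ) :
    powerSumMoment m n 1 2 = (n : ℝ) * m 4 + (n : ℝ) * (n - 1) * m 2 ^ 2 := by
  induction n with
  | zero => simp [powerSumMoment]
  | succ n ih =>
    simp only [powerSumMoment, Finset.sum_range_succ, Finset.sum_range_zero, ih, h0, h1,
      powerSumMoment_0_0 m h0 h1, powerSumMoment_0_1 m h0 h1, powerSumMoment_0_2 m h0 h1,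
      powerSumMoment_1_0 m h0 h1, powerSumMoment_1_1 m h0 h1]
    simp [Nat.choose]
    ring

lemma powerSumMoment_2_0 (m : ℕ → ℝ) (h0 : m 0 = 1) (h1 : m 1 = 0) (n : ℕ) :
    powerSumMoment m n 2 0 = (n : ℝ) * m 4 + (n : ℝ) * (n - 1) * m 2 ^ 2 := by
  induction n with
  | zero => simp [powerSumMoment]
  | succ n ih =>
    simp only [powerSumMoment, Finset.sum_range_succ, Finset.sum_range_zero, ih, h0,
      powerSumMoment_0_0 m h0 h1, powerSumMoment_1_0 m h0 h1]
    simp [Nat.choose]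
    ring

lemma powerSumMoment_0_5 (m : ℕ → ℝ) (h0 : m 0 = 1) (h1 : m 1 = 0) (n : ℕ) :
    powerSumMoment m n 0 5 = (n : ℝ) * m 5 + (n : ℝ) * (n - 1) * 10 * m 2 * m 3 := by
  induction n with
  | zero => simp [powerSumMoment]
  | succ n ih =>
    simp only [powerSumMoment, Finset.sum_range_succ, Finset.sum_range_zero, ih, h0, h1,
      powerSumMoment_0_0 m h0 h1, powerSumMoment_0_1 m h0 h1, powerSumMoment_0_2 m h0 h1,
      powerSumMoment_0_3 m h0 h1, powerSumMoment_0_4 m h0 h1]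
    simp [Nat.choose]
    ring

lemma powerSumMoment_1_3 (m : ℕ → ℝ) (h0 : m 0 = 1) (h1 : m 1 = 0) (n : ℕ) :
    powerSumMoment m n 1 3 = (n : ℝ) * m 5 + (n : ℝ) * (n - 1) * 4 * m 2 * m 3 := by
  induction n with
  | zero => simp [powerSumMoment]
  | succ n ih =>
    simp only [powerSumMoment, Finset.sum_range_succ, Finset.sum_range_zero, ih, h0, h1,
      powerSumMoment_0_0 m h0 h1, powerSumMoment_0_1 m h0 h1, powerSumMoment_0_2 m h0 h1,
      powerSumMoment_0_3 m h0 h1, powerSumMoment_1_0 m h0 h1, powerSumMoment_1_1 m h0 h1,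
      powerSumMoment_1_2 m h0 h1]
    simp [Nat.choose]
    ring

lemma powerSumMoment_2_1 (m : ℕ → ℝ) (h0 : m 0 = 1) (h1 : m 1 = 0) (n : ℕ) :
    powerSumMoment m n 2 1 = (n : ℝ) * m 5 + (n : ℝ) * (n - 1) * 2 * m 2 * m 3 := by
  induction n with
  | zero => simp [powerSumMoment]
  | succ n ih =>
    simp only [powerSumMoment, Finset.sum_range_succ, Finset.sum_range_zero, ih, h0, h1,
      powerSumMoment_0_0 m h0 h1, powerSumMoment_0_1 m h0 h1, powerSumMoment_1_0 m h0 h1,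
      powerSumMoment_1_1 m h0 h1, powerSumMoment_2_0 m h0 h1]
    simp [Nat.choose]
    ring

lemma powerSumMoment_0_6 (m : ℕ → ℝ) (h0 : m 0 = 1) (h1 : m 1 = 0) (n : ℕ) :
    powerSumMoment m n 0 6 = (n : ℝ) * m 6 + (n : ℝ) * (n - 1) * (15 * m 2 * m 4 + 10 * m 3 ^ 2)
      + (n : ℝ) * (n - 1) * (n - 2) * 15 * m 2 ^ 3 := by
  induction n with
  | zero => simp [powerSumMoment]
  | succ n ih =>
    simp only [powerSumMoment, Finset.sum_range_succ, Finset.sum_range_zero, ih, h0, h1,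
      powerSumMoment_0_0 m h0 h1, powerSumMoment_0_1 m h0 h1, powerSumMoment_0_2 m h0 h1,
      powerSumMoment_0_3 m h0 h1, powerSumMoment_0_4 m h0 h1, powerSumMoment_0_5 m h0 h1]
    simp [Nat.choose]
    ring

lemma powerSumMoment_1_4 (m : ℕ → ℝ) (h0 : m 0 = 1) (h1 : m 1 = 0) (n : ℕ) :
    powerSumMoment m n 1 4 = (n : ℝ) * m 6 + (n : ℝ) * (n - 1) * (7 * m 2 * m 4 + 4 * m 3 ^ 2)
      + (n : ℝ) * (n - 1) * (n - 2) * 3 * m 2 ^ 3 := by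
  induction n with
  | zero => simp [powerSumMoment]
  | succ n ih =>
    simp only [powerSumMoment, Finset.sum_range_succ, Finset.sum_range_zero, ih, h0, h1,
      powerSumMoment_0_0 m h0 h1, powerSumMoment_0_1 m h0 h1, powerSumMoment_0_2 m h0 h1,
      powerSumMoment_0_3 m h0 h1, powerSumMoment_0_4 m h0 h1, powerSumMoment_1_0 m h0 h1,
      powerSumMoment_1_1 m h0 h1, powerSumMoment_1_2 m h0 h1, powerSumMoment_1_3 m h0 h1]
    simp [Nat.choose]
    ring

lemma powerSumMoment_2_2 (m : ℕ → ℝ) (h0 : m 0 = 1) (h1 : m 1 = 0) (n : ℕ) :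
    powerSumMoment m n 2 2 = (n : ℝ) * m 6 + (n : ℝ) * (n - 1) * (3 * m 2 * m 4 + 2 * m 3 ^ 2)
      + (n : ℝ) * (n - 1) * (n - 2) * m 2 ^ 3 := by
  induction n with
  | zero => simp [powerSumMoment]
  | succ n ih =>
    simp only [powerSumMoment, Finset.sum_range_succ, Finset.sum_range_zero, ih, h0, h1,
      powerSumMoment_0_0 m h0 h1, powerSumMoment_0_1 m h0 h1, powerSumMoment_0_2 m h0 h1,
      powerSumMoment_1_0 m h0 h1, powerSumMoment_1_1 m h0 h1, powerSumMoment_1_2 m h0 h1,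
      powerSumMoment_2_0 m h0 h1, powerSumMoment_2_1 m h0 h1]
    simp [Nat.choose]
    ring

lemma powerSumMoment_3_0 (m : ℕ → ℝ) (h0 : m 0 = 1) (h1 : m 1 = 0) (n : ℕ) :
    powerSumMoment m n 3 0 = (n : ℝ) * m 6 + (n : ℝ) * (n - 1) * 3 * m 2 * m 4
      + (n : ℝ) * (n - 1) * (n - 2) * m 2 ^ 3 := by
  induction n with
  | zero => simp [powerSumMoment]
  | succ n ih =>
    simp only [powerSumMoment, Finset.sum_range_succ, Finset.sum_range_zero, ih, h0,
      powerSumMoment_0_0 m h0 h1, powerSumMoment_1_0 m h0 h1, powerSumMoment_2_0 m h0 h1]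
    simp [Nat.choose]
    ring

lemma powerSumMoment_0_7 (m : ℕ → ℝ) (h0 : m 0 = 1) (h1 : m 1 = 0) (n : ℕ) :
    powerSumMoment m n 0 7 = (n : ℝ) * m 7 + (n : ℝ) * (n - 1) * (21 * m 2 * m 5
      + 35 * m 3 * m 4) + (n : ℝ) * (n - 1) * (n - 2) * 105 * m 2 ^ 2 * m 3 := by
  induction n with
  | zero => simp [powerSumMoment]
  | succ n ih =>
    simp only [powerSumMoment, Finset.sum_range_succ, Finset.sum_range_zero, ih, h0, h1,
      powerSumMoment_0_0 m h0 h1, powerSumMoment_0_1 m h0 h1, powerSumMoment_0_2 m h0 h1,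
      powerSumMoment_0_3 m h0 h1, powerSumMoment_0_4 m h0 h1, powerSumMoment_0_5 m h0 h1,
      powerSumMoment_0_6 m h0 h1]
    simp [Nat.choose]
    ring

lemma powerSumMoment_1_5 (m : ℕ → ℝ) (h0 : m 0 = 1) (h1 : m 1 = 0) (n : ℕ) :
    powerSumMoment m n 1 5 = (n : ℝ) * m 7 + (n : ℝ) * (n - 1) * (11 * m 2 * m 5
      + 15 * m 3 * m 4) + (n : ℝ) * (n - 1) * (n - 2) * 25 * m 2 ^ 2 * m 3 := by
  induction n with
  | zero => simp [powerSumMoment]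
  | succ n ih =>
    simp only [powerSumMoment, Finset.sum_range_succ, Finset.sum_range_zero, ih, h0, h1,
      powerSumMoment_0_0 m h0 h1, powerSumMoment_0_1 m h0 h1, powerSumMoment_0_2 m h0 h1,
      powerSumMoment_0_3 m h0 h1, powerSumMoment_0_4 m h0 h1, powerSumMoment_0_5 m h0 h1,
      powerSumMoment_1_0 m h0 h1, powerSumMoment_1_1 m h0 h1, powerSumMoment_1_2 m h0 h1,
      powerSumMoment_1_3 m h0 h1, powerSumMoment_1_4 m h0 h1]
    simp [Nat.choose]
    ring

lemma powerSumMoment_2_3 (m : ℕ → ℝ) (h0 : m 0 = 1) (h1 : m 1 = 0) (n : ℕ) :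
    powerSumMoment m n 2 3 = (n : ℝ) * m 7 + (n : ℝ) * (n - 1) * (5 * m 2 * m 5 + 7 * m 3 * m 4)
      + (n : ℝ) * (n - 1) * (n - 2) * 7 * m 2 ^ 2 * m 3 := by
  induction n with
  | zero => simp [powerSumMoment]
  | succ n ih =>
    simp only [powerSumMoment, Finset.sum_range_succ, Finset.sum_range_zero, ih, h0, h1,
      powerSumMoment_0_0 m h0 h1, powerSumMoment_0_1 m h0 h1, powerSumMoment_0_2 m h0 h1,
      powerSumMoment_0_3 m h0 h1, powerSumMoment_1_0 m h0 h1, powerSumMoment_1_1 m h0 h1,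
      powerSumMoment_1_2 m h0 h1, powerSumMoment_1_3 m h0 h1, powerSumMoment_2_0 m h0 h1,
      powerSumMoment_2_1 m h0 h1, powerSumMoment_2_2 m h0 h1]
    simp [Nat.choose]
    ring

lemma powerSumMoment_3_1 (m : ℕ → ℝ) (h0 : m 0 = 1) (h1 : m 1 = 0) (n : ℕ) :
    powerSumMoment m n 3 1 = (n : ℝ) * m 7 + (n : ℝ) * (n - 1) * (3 * m 2 * m 5 + 3 * m 3 * m 4)
      + (n : ℝ) * (n - 1) * (n - 2) * 3 * m 2 ^ 2 * m 3 := by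
  induction n with
  | zero => simp [powerSumMoment]
  | succ n ih =>
    simp only [powerSumMoment, Finset.sum_range_succ, Finset.sum_range_zero, ih, h0, h1,
      powerSumMoment_0_0 m h0 h1, powerSumMoment_0_1 m h0 h1, powerSumMoment_1_0 m h0 h1,
      powerSumMoment_1_1 m h0 h1, powerSumMoment_2_0 m h0 h1, powerSumMoment_2_1 m h0 h1,
      powerSumMoment_3_0 m h0 h1]
    simp [Nat.choose]
    ring

lemma powerSumMoment_0_8 (m : ℕ → ℝ) (h0 : m 0 = 1) (h1 : m 1 = 0) (n : ℕ) :
    powerSumMoment m n 0 8 = (n : ℝ) * m 8 + (n : ℝ) * (n - 1) * (28 * m 2 * m 6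
      + 56 * m 3 * m 5 + 35 * m 4 ^ 2) + (n : ℝ) * (n - 1) * (n - 2) * (210 * m 2 ^ 2 * m 4
      + 280 * m 2 * m 3 ^ 2) + (n : ℝ) * (n - 1) * (n - 2) * (n - 3) * 105 * m 2 ^ 4 := by
  induction n with
  | zero => simp [powerSumMoment]
  | succ n ih =>
    simp only [powerSumMoment, Finset.sum_range_succ, Finset.sum_range_zero, ih, h0, h1,
      powerSumMoment_0_0 m h0 h1, powerSumMoment_0_1 m h0 h1, powerSumMoment_0_2 m h0 h1,
      powerSumMoment_0_3 m h0 h1, powerSumMoment_0_4 m h0 h1, powerSumMoment_0_5 m h0 h1,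
      powerSumMoment_0_6 m h0 h1, powerSumMoment_0_7 m h0 h1]
    simp [Nat.choose]
    ring

lemma powerSumMoment_1_6 (m : ℕ → ℝ) (h0 : m 0 = 1) (h1 : m 1 = 0) (n : ℕ) :
    powerSumMoment m n 1 6 = (n : ℝ) * m 8 + (n : ℝ) * (n - 1) * (16 * m 2 * m 6
      + 26 * m 3 * m 5 + 15 * m 4 ^ 2) + (n : ℝ) * (n - 1) * (n - 2) * (60 * m 2 ^ 2 * m 4
      + 70 * m 2 * m 3 ^ 2) + (n : ℝ) * (n - 1) * (n - 2) * (n - 3) * 15 * m 2 ^ 4 := by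
  induction n with
  | zero => simp [powerSumMoment]
  | succ n ih =>
    simp only [powerSumMoment, Finset.sum_range_succ, Finset.sum_range_zero, ih, h0, h1,
      powerSumMoment_0_0 m h0 h1, powerSumMoment_0_1 m h0 h1, powerSumMoment_0_2 m h0 h1,
      powerSumMoment_0_3 m h0 h1, powerSumMoment_0_4 m h0 h1, powerSumMoment_0_5 m h0 h1,
      powerSumMoment_0_6 m h0 h1, powerSumMoment_1_0 m h0 h1, powerSumMoment_1_1 m h0 h1,
      powerSumMoment_1_2 m h0 h1, powerSumMoment_1_3 m h0 h1, powerSumMoment_1_4 m h0 h1,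
      powerSumMoment_1_5 m h0 h1]
    simp [Nat.choose]
    ring

lemma powerSumMoment_2_4 (m : ℕ → ℝ) (h0 : m 0 = 1) (h1 : m 1 = 0) (n : ℕ) :
    powerSumMoment m n 2 4 = (n : ℝ) * m 8 + (n : ℝ) * (n - 1) * (8 * m 2 * m 6 + 12 * m 3 * m 5
      + 7 * m 4 ^ 2) + (n : ℝ) * (n - 1) * (n - 2) * (16 * m 2 ^ 2 * m 4 + 20 * m 2 * m 3 ^ 2)
      + (n : ℝ) * (n - 1) * (n - 2) * (n - 3) * 3 * m 2 ^ 4 := by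
  induction n with
  | zero => simp [powerSumMoment]
  | succ n ih =>
    simp only [powerSumMoment, Finset.sum_range_succ, Finset.sum_range_zero, ih, h0, h1,
      powerSumMoment_0_0 m h0 h1, powerSumMoment_0_1 m h0 h1, powerSumMoment_0_2 m h0 h1,
      powerSumMoment_0_3 m h0 h1, powerSumMoment_0_4 m h0 h1, powerSumMoment_1_0 m h0 h1,
      powerSumMoment_1_1 m h0 h1, powerSumMoment_1_2 m h0 h1, powerSumMoment_1_3 m h0 h1,
      powerSumMoment_1_4 m h0 h1, powerSumMoment_2_0 m h0 h1, powerSumMoment_2_1 m h0 h1,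
      powerSumMoment_2_2 m h0 h1, powerSumMoment_2_3 m h0 h1]
    simp [Nat.choose]
    ring

lemma powerSumMoment_3_2 (m : ℕ → ℝ) (h0 : m 0 = 1) (h1 : m 1 = 0) (n : ℕ) :
    powerSumMoment m n 3 2 = (n : ℝ) * m 8 + (n : ℝ) * (n - 1) * (4 * m 2 * m 6 + 6 * m 3 * m 5
      + 3 * m 4 ^ 2) + (n : ℝ) * (n - 1) * (n - 2) * (6 * m 2 ^ 2 * m 4 + 6 * m 2 * m 3 ^ 2)
      + (n : ℝ) * (n - 1) * (n - 2) * (n - 3) * m 2 ^ 4 := by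
  induction n with
  | zero => simp [powerSumMoment]
  | succ n ih =>
    simp only [powerSumMoment, Finset.sum_range_succ, Finset.sum_range_zero, ih, h0, h1,
      powerSumMoment_0_0 m h0 h1, powerSumMoment_0_1 m h0 h1, powerSumMoment_0_2 m h0 h1,
      powerSumMoment_1_0 m h0 h1, powerSumMoment_1_1 m h0 h1, powerSumMoment_1_2 m h0 h1,
      powerSumMoment_2_0 m h0 h1, powerSumMoment_2_1 m h0 h1, powerSumMoment_2_2 m h0 h1,
      powerSumMoment_3_0 m h0 h1, powerSumMoment_3_1 m h0 h1]
    simp [Nat.choose]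
    ring

lemma powerSumMoment_4_0 (m : ℕ → ℝ) (h0 : m 0 = 1) (h1 : m 1 = 0) (n : ℕ) :
    powerSumMoment m n 4 0 = (n : ℝ) * m 8 + (n : ℝ) * (n - 1) * (4 * m 2 * m 6 + 3 * m 4 ^ 2)
      + (n : ℝ) * (n - 1) * (n - 2) * 6 * m 2 ^ 2 * m 4
      + (n : ℝ) * (n - 1) * (n - 2) * (n - 3) * m 2 ^ 4 := by
  induction n with
  | zero => simp [powerSumMoment]
  | succ n ih =>
    simp only [powerSumMoment, Finset.sum_range_succ, Finset.sum_range_zero, ih, h0,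
      powerSumMoment_0_0 m h0 h1, powerSumMoment_1_0 m h0 h1, powerSumMoment_2_0 m h0 h1,
      powerSumMoment_3_0 m h0 h1]
    simp [Nat.choose]
    ring

end StableEst

/-! ### The fourth central moment of the sample variance. -/

namespace StableEst

lemma integrable_powerSum_and_integral {Ω ι : Type*} [MeasurableSpace Ω] {P : Measure Ω}
    [IsProbabilityMeasure P] {Y : ι → Ω → ℝ} (hY : ∀ i, Measurable (Y i)) (hind : iIndepFun Y P)
    (m : ℕ → ℝ) (hint : ∀ i, ∀ k ≤ 8, Integrable (fun ω => Y i ω ^ k) P)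
    (hm : ∀ i, ∀ k ≤ 8, ∫ ω, Y i ω ^ k ∂P = m k) (s : Finset ι) (a b : ℕ) (hab : 2 * a + b ≤ 8) :
    Integrable (fun ω => (∑ i ∈ s, Y i ω ^ 2) ^ a * (∑ i ∈ s, Y i ω) ^ b) P ∧
      ∫ ω, (∑ i ∈ s, Y i ω ^ 2) ^ a * (∑ i ∈ s, Y i ω) ^ b ∂P = powerSumMoment m s.card a b := by
  classical
  induction s using Finset.induction_on generalizing a b with
  | empty =>
    simp only [Finset.sum_empty, Finset.card_empty, powerSumMoment]
    refine ⟨integrable_const _, ?_⟩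
    rcases a with _ | a <;> rcases b with _ | b <;> simp
  | insert i s hi ih =>
    set f : ι → Ω → ℝ × ℝ := fun i ω => (Y i ω, Y i ω ^ 2) with hf
    have hfm : ∀ i, Measurable (f i) := fun i => (hY i).prodMk ((hY i).pow_const 2)
    have hfi : iIndepFun f P :=
      hind.comp (fun _ x => (x, x ^ 2)) (fun _ => measurable_id.prodMk (measurable_id.pow_const 2))
    -- Both power sums must be jointly independent of the new variable, so the pairs `(Y, Y²)` are
    -- summed as vectors.
    have hI : IndepFun (∑ j ∈ s, f j) (f i) P := hfi.indepFun_finsetSum_of_notMem hfm hi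
    have hI' : IndepFun (fun ω => (∑ j ∈ s, Y j ω, ∑ j ∈ s, Y j ω ^ 2)) (f i) P := by
      convert hI using 1
      funext ω
      simp [hf, Prod.ext_iff, Finset.sum_apply, Prod.fst_sum, Prod.snd_sum]
    have hprod : ∀ p q : ℕ, IndepFun (fun ω => (∑ j ∈ s, Y j ω ^ 2) ^ p * (∑ j ∈ s, Y j ω) ^ q)
        (fun ω => Y i ω ^ (2 * (a - p) + (b - q))) P := by
      intro p q
      exact hI'.comp (φ := fun x : ℝ × ℝ => x.2 ^ p * x.1 ^ q)
        (ψ := fun x : ℝ × ℝ => x.1 ^ (2 * (a - p) + (b - q))) (by fun_prop) (by fun_prop)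
    have hexp : (fun ω => (∑ j ∈ insert i s, Y j ω ^ 2) ^ a * (∑ j ∈ insert i s, Y j ω) ^ b)
        = fun ω => ∑ p ∈ Finset.range (a + 1), ∑ q ∈ Finset.range (b + 1),
          ((a.choose p : ℝ) * (b.choose q : ℝ)) *
            (((∑ j ∈ s, Y j ω ^ 2) ^ p * (∑ j ∈ s, Y j ω) ^ q) *
              Y i ω ^ (2 * (a - p) + (b - q))) := by
      funext ω
      rw [Finset.sum_insert hi, Finset.sum_insert hi, add_comm (Y i ω ^ 2), add_comm (Y i ω),
        add_pow, add_pow, Finset.sum_mul_sum]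
      refine Finset.sum_congr rfl fun p _ => Finset.sum_congr rfl fun q _ => ?_
      rw [pow_add, pow_mul]
      ring
    have hterm : ∀ p ∈ Finset.range (a + 1), ∀ q ∈ Finset.range (b + 1),
        Integrable (fun ω => ((a.choose p : ℝ) * (b.choose q : ℝ)) *
            (((∑ j ∈ s, Y j ω ^ 2) ^ p * (∑ j ∈ s, Y j ω) ^ q) *
              Y i ω ^ (2 * (a - p) + (b - q)))) P ∧
        ∫ ω, ((a.choose p : ℝ) * (b.choose q : ℝ)) *
            (((∑ j ∈ s, Y j ω ^ 2) ^ p * (∑ j ∈ s, Y j ω) ^ q) *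
              Y i ω ^ (2 * (a - p) + (b - q))) ∂P
          = (a.choose p : ℝ) * (b.choose q : ℝ) * powerSumMoment m s.card p q
              * m (2 * (a - p) + (b - q)) := by
      intro p hp q hq
      rw [Finset.mem_range] at hp hq
      obtain ⟨h1, h2⟩ := ih p q (by omega)
      have h3 := hint i (2 * (a - p) + (b - q)) (by omega)
      refine ⟨((hprod p q).integrable_mul h1 h3).const_mul _, ?_⟩
      rw [integral_const_mul, (hprod p q).integral_fun_mul_eq_mul_integral
        h1.aestronglyMeasurable h3.aestronglyMeasurable, h2, hm i _ (by omega)]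
      ring
    rw [hexp]
    refine ⟨integrable_finsetSum _ fun p hp => integrable_finsetSum _ fun q hq =>
      (hterm p hp q hq).1, ?_⟩
    rw [integral_finsetSum _ fun p hp => integrable_finsetSum _ fun q hq => (hterm p hp q hq).1,
      Finset.card_insert_of_notMem hi, powerSumMoment]
    refine Finset.sum_congr rfl fun p hp => ?_
    rw [integral_finsetSum _ fun q hq => (hterm p hp q hq).1]
    exact Finset.sum_congr rfl fun q hq => (hterm p hp q hq).2

/-- The sample variance is translation invariant, so it may be expanded around the true mean `c`,
where `m 1 = 0`. -/
lemma sampleVar_eq_powerSums {n : ℕ} (hn : 2 ≤ n) (x : Fin n → ℝ) (c : ℝ) :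
    sampleVar x = (n * ∑ j, (x j - c) ^ 2 - (∑ j, (x j - c)) ^ 2) / (n * (n - 1)) := by
  have hn0 : (n : ℝ) ≠ 0 := by positivity
  have hn1 : (n : ℝ) - 1 ≠ 0 := by
    have : (2 : ℝ) ≤ n := by exact_mod_cast hn
    linarith
  have h : ∀ d : ℝ, ∑ j, (x j - d) ^ 2 = ∑ j, x j ^ 2 - 2 * d * ∑ j, x j + n * d ^ 2 := by
    intro d
    simp only [sub_sq, Finset.sum_add_distrib, Finset.sum_sub_distrib, Finset.mul_sum]
    simp only [Finset.sum_const, Finset.card_univ, Fintype.card_fin, nsmul_eq_mul]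
    congr 2
    exact Finset.sum_congr rfl fun j _ => by ring
  rw [sampleVar, h, h, sampleMean, Finset.sum_sub_distrib]
  simp only [Finset.sum_const, Finset.card_univ, Fintype.card_fin, nsmul_eq_mul]
  field_simp
  ring

/-- The fourth central moment of the sample variance, in terms of cumulants. -/
theorem integral_sampleVar_sub_pow_four {Ω : Type*} [MeasurableSpace Ω] {P : Measure Ω}
    [IsProbabilityMeasure P] {n : ℕ} (hn : 2 ≤ n) {Y : Fin n → Ω → ℝ}
    (hY : ∀ i, Measurable (Y i)) (hind : iIndepFun Y P) (c : ℝ) (m : ℕ → ℝ)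
    (hint : ∀ i, ∀ k ≤ 8, Integrable (fun ω => (Y i ω - c) ^ k) P)
    (hm : ∀ i, ∀ k ≤ 8, ∫ ω, (Y i ω - c) ^ k ∂P = m k) {D κ₃ κ₄ κ₅ κ₆ κ₈ : ℝ}
    (h1 : m 1 = 0) (h2 : m 2 = D) (h3 : m 3 = κ₃) (h4 : m 4 = κ₄ + 3 * D ^ 2)
    (h5 : m 5 = κ₅ + 10 * κ₃ * D) (h6 : m 6 = κ₆ + 15 * κ₄ * D + 10 * κ₃ ^ 2 + 15 * D ^ 3)
    (h8 : m 8 = κ₈ + 28 * κ₆ * D + 56 * κ₅ * κ₃ + 35 * κ₄ ^ 2 + 210 * κ₄ * D ^ 2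
      + 280 * κ₃ ^ 2 * D + 105 * D ^ 4) :
    Integrable (fun ω => (sampleVar (fun i => Y i ω) - D) ^ 4) P ∧
      ∫ ω, (sampleVar (fun i => Y i ω) - D) ^ 4 ∂P =
        3 * (κ₄ + 2 * D ^ 2) ^ 2 / (n : ℝ) ^ 2 +
        (72 * D ^ 4 + 156 * D ^ 2 * κ₄ + 96 * κ₃ ^ 2 * D + 32 * κ₄ ^ 2 + 24 * κ₆ * D
            + 32 * κ₃ * κ₅ + κ₈
          + (180 * D ^ 4 + 300 * D ^ 2 * κ₄ + 24 * κ₆ * D + 96 * κ₃ ^ 2 * D + 24 * κ₄ ^ 2)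
              / ((n : ℝ) - 1)
          + (156 * D ^ 4 + 144 * D ^ 2 * κ₄ - 96 * κ₃ ^ 2 * D - 32 * κ₃ * κ₅) / ((n : ℝ) - 1) ^ 2
          + (48 * D ^ 4 + 8 * κ₄ ^ 2 - 96 * κ₃ ^ 2 * D) / ((n : ℝ) - 1) ^ 3) / (n : ℝ) ^ 3 := by
  have hn0 : (n : ℝ) ≠ 0 := by positivity
  have hn1 : (n : ℝ) - 1 ≠ 0 := by
    have : (2 : ℝ) ≤ n := by exact_mod_cast hn
    linarith
  have h0 : m 0 = 1 := by
    rw [← hm ⟨0, by omega⟩ 0 (by norm_num)]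
    simp
  have key := fun a b hab => integrable_powerSum_and_integral
    (Y := fun i ω => Y i ω - c) (fun i => (hY i).sub_const c)
    (hind.comp (fun _ x => x - c) (fun _ => measurable_id.sub_const c)) m hint hm
    Finset.univ a b hab
  simp only [Finset.card_univ, Fintype.card_fin] at key
  set S2 : Ω → ℝ := fun ω => ∑ i, (Y i ω - c) ^ 2 with hS2
  set S1 : Ω → ℝ := fun ω => ∑ i, (Y i ω - c) with hS1
  -- Trinomial expansion of `(n S2 - S1² - D n(n-1))⁴`; the degree `2a + 2b` of each term is at most
  -- 8.
  have hfun : (fun ω => (sampleVar (fun i => Y i ω) - D) ^ 4) = fun ω =>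
      ∑ a ∈ Finset.range 5, ∑ b ∈ Finset.range (5 - a),
        (((n : ℝ) ^ 4 * (n - 1) ^ 4)⁻¹ * (Nat.choose 4 a * Nat.choose (4 - a) b * (n : ℝ) ^ a
          * (-1) ^ b * (-(D * (n * (n - 1)))) ^ (4 - a - b))) * (S2 ω ^ a * S1 ω ^ (2 * b)) := by
    funext ω
    rw [sampleVar_eq_powerSums hn _ c]
    change ((n * S2 ω - S1 ω ^ 2) / (n * (n - 1)) - D) ^ 4 = _
    simp only [Finset.sum_range_succ, Finset.sum_range_zero]
    simp [Nat.choose]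
    field_simp
    ring
  have hi : ∀ a ∈ Finset.range 5, ∀ b ∈ Finset.range (5 - a),
      Integrable (fun ω => (((n : ℝ) ^ 4 * (n - 1) ^ 4)⁻¹ * (Nat.choose 4 a * Nat.choose (4 - a) b
        * (n : ℝ) ^ a * (-1) ^ b * (-(D * (n * (n - 1)))) ^ (4 - a - b)))
          * (S2 ω ^ a * S1 ω ^ (2 * b))) P := by
    intro a ha b hb
    rw [Finset.mem_range] at ha hb
    exact (key a (2 * b) (by omega)).1.const_mul _
  rw [hfun]
  refine ⟨integrable_finsetSum _ fun a ha => integrable_finsetSum _ fun b hb => hi a ha b hb, ?_⟩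
  rw [integral_finsetSum _ fun a ha => integrable_finsetSum _ fun b hb => hi a ha b hb]
  have hval : ∀ a ∈ Finset.range 5, ∫ ω, ∑ b ∈ Finset.range (5 - a),
        (((n : ℝ) ^ 4 * (n - 1) ^ 4)⁻¹ * (Nat.choose 4 a * Nat.choose (4 - a) b * (n : ℝ) ^ a
          * (-1) ^ b * (-(D * (n * (n - 1)))) ^ (4 - a - b))) * (S2 ω ^ a * S1 ω ^ (2 * b)) ∂P
      = ∑ b ∈ Finset.range (5 - a), (((n : ℝ) ^ 4 * (n - 1) ^ 4)⁻¹ * (Nat.choose 4 a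
          * Nat.choose (4 - a) b * (n : ℝ) ^ a * (-1) ^ b
          * (-(D * (n * (n - 1)))) ^ (4 - a - b))) * powerSumMoment m n a (2 * b) := by
    intro a ha
    rw [integral_finsetSum _ fun b hb => hi a ha b hb]
    refine Finset.sum_congr rfl fun b hb => ?_
    rw [Finset.mem_range] at ha hb
    rw [integral_const_mul, (key a (2 * b) (by omega)).2]
  rw [Finset.sum_congr rfl hval]
  simp only [Finset.sum_range_succ, Finset.sum_range_zero]
  simp only [Nat.reduceSub, Nat.reduceMul,
    powerSumMoment_0_0 m h0 h1, powerSumMoment_0_2 m h0 h1, powerSumMoment_0_4 m h0 h1,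
    powerSumMoment_0_6 m h0 h1, powerSumMoment_0_8 m h0 h1, powerSumMoment_1_0 m h0 h1,
    powerSumMoment_1_2 m h0 h1, powerSumMoment_1_4 m h0 h1, powerSumMoment_1_6 m h0 h1,
    powerSumMoment_2_0 m h0 h1, powerSumMoment_2_2 m h0 h1, powerSumMoment_2_4 m h0 h1,
    powerSumMoment_3_0 m h0 h1, powerSumMoment_3_2 m h0 h1, powerSumMoment_4_0 m h0 h1,
    h2, h3, h4, h5, h6, h8]
  simp [Nat.choose]
  generalize (n : ℝ) = x at *
  field_simp
  ring

end StableEst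

/-! ### The Mellin-type integral of `1 - e^{-wu}`. -/

namespace StableEst

open Set Filter Topology

lemma norm_one_sub_exp_neg_le_two {z : ℂ} (hz : 0 ≤ z.re) : ‖1 - Complex.exp (-z)‖ ≤ 2 := by
  refine (norm_sub_le _ _).trans ?_
  rw [norm_one, Complex.norm_exp, Complex.neg_re]
  linarith [Real.exp_le_one_iff.mpr (neg_nonpos.mpr hz)]

lemma norm_one_sub_exp_neg_le_two_mul {z : ℂ} (hz : 0 ≤ z.re) :
    ‖1 - Complex.exp (-z)‖ ≤ 2 * ‖z‖ := by
  rcases le_total ‖z‖ 1 with h | h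
  · rw [norm_sub_rev, ← norm_neg z]
    exact Complex.norm_exp_sub_one_le (by rwa [norm_neg])
  · linarith [norm_one_sub_exp_neg_le_two hz]

/-- The common majorant of all the integrands: `s < 1` is needed at 0 and `s > 0` at infinity. -/
lemma integrableOn_min_one_mul_rpow {s : ℝ} (h0 : 0 < s) (h1 : s < 1) :
    IntegrableOn (fun u : ℝ => min 1 u * u ^ (-1 - s)) (Ioi 0) := by
  rw [← Ioc_union_Ioi_eq_Ioi zero_le_one]
  refine IntegrableOn.union ?_ ?_
  · have h : IntegrableOn (fun u : ℝ => u ^ (-s)) (Ioc 0 1) :=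
      (intervalIntegrable_iff_integrableOn_Ioc_of_le zero_le_one).mp
        (intervalIntegral.intervalIntegrable_rpow' (by linarith))
    refine h.congr_fun (fun u hu => ?_) measurableSet_Ioc
    simp only [min_eq_right hu.2]
    nth_rewrite 2 [← Real.rpow_one u]
    rw [← Real.rpow_add hu.1]
    ring_nf
  · have h : IntegrableOn (fun u : ℝ => u ^ (-1 - s)) (Ioi 1) :=
      integrableOn_Ioi_rpow_of_lt (by linarith) zero_lt_one
    refine h.congr_fun (fun u hu => ?_) measurableSet_Ioi
    simp [min_eq_left (le_of_lt (mem_Ioi.mp hu))]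

lemma norm_one_sub_exp_mul_rpow_le {s c : ℝ} {w : ℂ} (hw : 0 ≤ w.re) (hc : ‖w‖ ≤ c) {u : ℝ}
    (hu : 0 < u) : ‖(1 - Complex.exp (-(w * u))) * ((u ^ (-1 - s) : ℝ) : ℂ)‖
      ≤ 2 * (1 + c) * (min 1 u * u ^ (-1 - s)) := by
  have hp : 0 ≤ u ^ (-1 - s) := by positivity
  have hre : 0 ≤ (w * u).re := by simpa using mul_nonneg hw hu.le
  have hc0 : 0 ≤ c := (norm_nonneg w).trans hc
  rw [norm_mul, Complex.norm_real, Real.norm_of_nonneg hp, ← mul_assoc]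
  refine mul_le_mul_of_nonneg_right ?_ hp
  rcases le_total u 1 with h | h
  · rw [min_eq_right h]
    refine (norm_one_sub_exp_neg_le_two_mul hre).trans ?_
    rw [norm_mul, Complex.norm_real, Real.norm_of_nonneg hu.le]
    nlinarith
  · rw [min_eq_left h]
    refine (norm_one_sub_exp_neg_le_two hre).trans ?_
    linarith

lemma measurable_one_sub_exp_mul_rpow (s : ℝ) (w : ℂ) :
    Measurable (fun u : ℝ => (1 - Complex.exp (-(w * u))) * ((u ^ (-1 - s) : ℝ) : ℂ)) := by
  fun_prop

lemma integrableOn_one_sub_exp_mul_rpow {s : ℝ} (h0 : 0 < s) (h1 : s < 1) {w : ℂ}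
    (hw : 0 ≤ w.re) :
    IntegrableOn (fun u : ℝ => (1 - Complex.exp (-(w * u))) * ((u ^ (-1 - s) : ℝ) : ℂ)) (Ioi 0) := by
  refine Integrable.mono' ((integrableOn_min_one_mul_rpow h0 h1).const_mul (2 * (1 + ‖w‖)))
    (measurable_one_sub_exp_mul_rpow s w).aestronglyMeasurable ?_
  exact (ae_restrict_iff' measurableSet_Ioi).mpr
    (ae_of_all _ fun u hu => norm_one_sub_exp_mul_rpow_le hw le_rfl hu)

lemma integrableOn_rpow_neg_mul_exp {s r : ℝ} (h1 : s < 1) (hr : 0 < r) :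
    IntegrableOn (fun u : ℝ => u ^ (-s) * Real.exp (-(r * u))) (Ioi 0) := by
  have := integrableOn_rpow_mul_exp_neg_mul_rpow (s := -s) (p := 1) (by linarith) one_pos hr
  simpa using this

/-- Integration by parts against `-u^{-s}/s` leaves a Gamma integral; `1 - e^{-ru} ≤ min(1, ru)`
kills both boundary terms. -/
lemma integral_one_sub_exp_mul_rpow_ofReal {s : ℝ} (h0 : 0 < s) (h1 : s < 1) {r : ℝ}
    (hr : 0 < r) :
    ∫ u in Ioi (0 : ℝ), (1 - Real.exp (-(r * u))) * u ^ (-1 - s)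
      = r ^ s * (Real.Gamma (1 - s) / s) := by
  have hbd : ∀ u : ℝ, 0 < u → |(1 - Real.exp (-(r * u)))| ≤ min 1 (r * u) := by
    intro u hu
    have h2 : Real.exp (-(r * u)) ≤ 1 := Real.exp_le_one_iff.mpr (by nlinarith)
    rw [abs_of_nonneg (by linarith)]
    refine le_min (by linarith [Real.exp_pos (-(r * u))]) ?_
    linarith [Real.add_one_le_exp (-(r * u))]
  have hI := integrableOn_one_sub_exp_mul_rpow h0 h1 (w := (r : ℂ)) (by simpa using hr.le)
  have hI' : IntegrableOn (fun u : ℝ => (1 - Real.exp (-(r * u))) * u ^ (-1 - s)) (Ioi 0) := by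
    refine (integrable_norm_iff (by fun_prop)).mp (hI.norm.congr (ae_of_all _ fun u => ?_))
    simp only [norm_mul, Complex.norm_real]
    congr 1
    rw [← Complex.norm_real]
    push_cast
    rfl
  have hE := integrableOn_rpow_neg_mul_exp h1 hr
  have key := integral_Ioi_mul_deriv_eq_deriv_mul (a := (0 : ℝ)) (a' := (0 : ℝ)) (b' := (0 : ℝ))
    (u := fun u => 1 - Real.exp (-(r * u))) (u' := fun u => r * Real.exp (-(r * u)))
    (v := fun u : ℝ => -u ^ (-s) / s) (v' := fun u => u ^ (-1 - s)) ?_ ?_ hI' ?_ ?_ ?_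
  · rw [key]
    have : ∀ u : ℝ, r * Real.exp (-(r * u)) * (-u ^ (-s) / s)
        = -(r / s) * (u ^ ((1 - s) - 1) * Real.exp (-(r * u))) := by
      intro u
      rw [show 1 - s - 1 = -s by ring]
      ring
    simp_rw [this]
    rw [integral_const_mul, Real.integral_rpow_mul_exp_neg_mul_Ioi (by linarith) hr,
      one_div, Real.inv_rpow hr.le, ← Real.rpow_neg hr.le, neg_sub, Real.rpow_sub hr, Real.rpow_one]
    field_simp
    ring
  · intro u _
    have h := ((hasDerivAt_id u).const_mul r).neg.exp.const_sub 1
    refine h.congr_deriv ?_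
    simp only [Pi.neg_apply, id]
    ring
  · intro u hu
    have h := ((Real.hasDerivAt_rpow_const (p := -s) (Or.inl (ne_of_gt hu))).neg.div_const s)
    refine h.congr_deriv ?_
    rw [show -s - 1 = -1 - s by ring]
    field_simp
  · refine (hE.const_mul (-(r / s))).congr (ae_of_all _ fun u => ?_)
    simp only [Pi.mul_apply]
    ring
  · have hlim : Tendsto (fun u : ℝ => r / s * u ^ (1 - s)) (𝓝[>] 0) (𝓝 0) := by
      have : Tendsto (fun u : ℝ => r / s * u ^ (1 - s)) (𝓝 0) (𝓝 (r / s * (0 : ℝ) ^ (1 - s))) :=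
        ((Real.continuousAt_rpow_const _ _ (Or.inr (by linarith))).const_mul _).tendsto
      rw [Real.zero_rpow (by linarith), mul_zero] at this
      exact this.mono_left nhdsWithin_le_nhds
    refine squeeze_zero_norm' ?_ hlim
    filter_upwards [self_mem_nhdsWithin] with u hu
    rw [mem_Ioi] at hu
    have hb := (hbd u hu).trans (min_le_right _ _)
    have hp : (0 : ℝ) < u ^ (-s) := by positivity
    simp only [Pi.mul_apply, norm_mul, norm_div, norm_neg, Real.norm_eq_abs]
    rw [abs_of_pos hp, abs_of_pos h0, show (1 : ℝ) - s = 1 + -s by ring, Real.rpow_add hu,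
      Real.rpow_one]
    calc |1 - Real.exp (-(r * u))| * (u ^ (-s) / s) ≤ (r * u) * (u ^ (-s) / s) := by gcongr
      _ = _ := by ring
  · have hlim : Tendsto (fun u : ℝ => u ^ (-s) / s) atTop (𝓝 0) := by
      simpa using (tendsto_rpow_neg_atTop h0).div_const s
    refine squeeze_zero_norm' ?_ hlim
    filter_upwards [eventually_gt_atTop 0] with u hu
    have hb := (hbd u hu).trans (min_le_left _ _)
    have hp : (0 : ℝ) < u ^ (-s) := by positivity
    simp only [Pi.mul_apply, norm_mul, norm_div, norm_neg, Real.norm_eq_abs]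
    rw [abs_of_pos hp, abs_of_pos h0]
    calc |1 - Real.exp (-(r * u))| * (u ^ (-s) / s) ≤ 1 * (u ^ (-s) / s) := by gcongr
      _ = _ := by ring

/-- Both sides are holomorphic in `w` on the open right half plane and agree on the positive reals,
so the identity theorem applies. -/
lemma integral_one_sub_exp_mul_rpow_of_re_pos {s : ℝ} (h0 : 0 < s) (h1 : s < 1) {w : ℂ}
    (hw : 0 < w.re) :
    ∫ u in Ioi (0 : ℝ), (1 - Complex.exp (-(w * u))) * ((u ^ (-1 - s) : ℝ) : ℂ)
      = w ^ (s : ℂ) * ((Real.Gamma (1 - s) / s : ℝ) : ℂ) := by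
  set U : Set ℂ := {w | 0 < w.re} with hU
  have hUo : IsOpen U := isOpen_lt continuous_const Complex.continuous_re
  have hUc : IsPreconnected U := (convex_halfSpace_re_gt 0).isPreconnected
  set F : ℂ → ℂ := fun w =>
    ∫ u in Ioi (0 : ℝ), (1 - Complex.exp (-(w * u))) * ((u ^ (-1 - s) : ℝ) : ℂ) with hF
  have hdiff : DifferentiableOn ℂ F U := by
    intro w hw
    have hw' : 0 < w.re := hw
    -- On this ball the real part stays above `ε`, so one integrable function dominates all the
    -- derivatives.
    set ε := w.re / 2 with hε
    have hmem : ∀ x ∈ Metric.ball w ε, ε < x.re := by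
      intro x hx
      have := (Complex.abs_re_le_norm (x - w)).trans_lt (mem_ball_iff_norm.mp hx)
      rw [Complex.sub_re] at this
      have := (abs_lt.mp this).1
      linarith
    have h := hasDerivAt_integral_of_dominated_loc_of_deriv_le (𝕜 := ℂ)
      (μ := volume.restrict (Ioi (0 : ℝ)))
      (F := fun w (u : ℝ) => (1 - Complex.exp (-(w * u))) * ((u ^ (-1 - s) : ℝ) : ℂ))
      (F' := fun w (u : ℝ) => (u * Complex.exp (-(w * u))) * ((u ^ (-1 - s) : ℝ) : ℂ))
      (x₀ := w) (s := Metric.ball w ε)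
      (bound := fun u : ℝ => u ^ (-s) * Real.exp (-(ε * u)))
      (Metric.ball_mem_nhds w (by positivity))
      (Eventually.of_forall fun x => (measurable_one_sub_exp_mul_rpow s x).aestronglyMeasurable)
      (integrableOn_one_sub_exp_mul_rpow h0 h1 hw'.le) (by fun_prop) ?_
      (integrableOn_rpow_neg_mul_exp h1 (by positivity)) ?_
    · exact h.2.differentiableAt.differentiableWithinAt
    · refine (ae_restrict_iff' measurableSet_Ioi).mpr (ae_of_all _ fun u hu x hx => ?_)
      rw [mem_Ioi] at hu
      rw [norm_mul, norm_mul, Complex.norm_real, Complex.norm_real, Real.norm_of_nonneg hu.le,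
        Real.norm_of_nonneg (by positivity : 0 ≤ u ^ (-1 - s)), Complex.norm_exp]
      have h2 : (-(x * (u : ℂ))).re = -(x.re * u) := by simp
      rw [h2]
      have h3 : u ^ (-s) = u * u ^ (-1 - s) := by
        nth_rewrite 2 [← Real.rpow_one u]
        rw [← Real.rpow_add hu]
        ring_nf
      rw [h3, mul_assoc, mul_assoc, mul_comm (Real.exp _)]
      gcongr
      exact (hmem x hx).le
    · refine (ae_restrict_iff' measurableSet_Ioi).mpr (ae_of_all _ fun u hu x hx => ?_)
      have h := (((hasDerivAt_id x).mul_const (u : ℂ)).neg.cexp.const_sub 1).mul_const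
        ((u ^ (-1 - s) : ℝ) : ℂ)
      refine h.congr_deriv ?_
      simp only [Pi.neg_apply, id]
      ring
  have hG : DifferentiableOn ℂ
      (fun w : ℂ => w ^ (s : ℂ) * ((Real.Gamma (1 - s) / s : ℝ) : ℂ)) U := by
    intro w hw
    exact ((differentiableAt_id.cpow_const (Or.inl hw)).mul_const _).differentiableWithinAt
  refine (hdiff.analyticOnNhd hUo).eqOn_of_preconnected_of_frequently_eq (hG.analyticOnNhd hUo) hUc
    (z₀ := 1) (by simp [hU]) ?_ hw
  have hseq : Tendsto (fun n : ℕ => ((1 + 1 / ((n : ℝ) + 1) : ℝ) : ℂ)) atTop (𝓝[≠] 1) := by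
    refine tendsto_nhdsWithin_iff.mpr ⟨?_, Eventually.of_forall fun n => ?_⟩
    · have := (tendsto_one_div_add_atTop_nhds_zero_nat (𝕜 := ℝ)).const_add 1
      rw [add_zero] at this
      exact_mod_cast (Complex.continuous_ofReal.tendsto 1).comp this
    · have : (0 : ℝ) < 1 / ((n : ℝ) + 1) := by positivity
      simp only [mem_compl_iff, mem_singleton_iff]
      rw [← Complex.ofReal_one, Complex.ofReal_inj]
      linarith
  refine hseq.frequently (Frequently.of_forall fun n => ?_)
  have hr : (0 : ℝ) < 1 + 1 / ((n : ℝ) + 1) := by positivity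
  generalize 1 + 1 / ((n : ℝ) + 1) = r at hr
  have h := integral_one_sub_exp_mul_rpow_ofReal h0 h1 hr
  simp only [hF]
  rw [← Complex.ofReal_cpow hr.le, ← Complex.ofReal_mul, ← h, ← integral_complex_ofReal]
  push_cast
  rfl

/-- The Mellin-type integral `∫₀^∞ (1 - e^{-wu}) u^{-1-s} du` in the closed right half plane. -/
lemma integral_one_sub_exp_mul_rpow {s : ℝ} (h0 : 0 < s) (h1 : s < 1) {w : ℂ}
    (hw : 0 ≤ w.re) :
    ∫ u in Ioi (0 : ℝ), (1 - Complex.exp (-(w * u))) * ((u ^ (-1 - s) : ℝ) : ℂ)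
      = w ^ (s : ℂ) * ((Real.Gamma (1 - s) / s : ℝ) : ℂ) := by
  -- The point 0 lies on the branch cut but both sides vanish there. Every other `w` of the closed
  -- half plane is in the slit plane, where the power is continuous, and is approached from the
  -- right.
  rcases eq_or_ne w 0 with rfl | hw0
  · simp [h0.ne']
  have hsl : w ∈ Complex.slitPlane := by
    rcases hw.eq_or_lt with h | h
    · exact Or.inr fun h' => hw0 (Complex.ext h.symm h')
    · exact Or.inl h
  have hε : Tendsto (fun n : ℕ => w + ((1 / ((n : ℝ) + 1) : ℝ) : ℂ)) atTop (𝓝 w) := by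
    have := (Complex.continuous_ofReal.tendsto 0).comp
      (tendsto_one_div_add_atTop_nhds_zero_nat (𝕜 := ℝ))
    simpa using this.const_add w
  have hpos : ∀ n : ℕ, (0 : ℝ) < 1 / ((n : ℝ) + 1) := fun n => by positivity
  have hle : ∀ n : ℕ, 1 / ((n : ℝ) + 1) ≤ 1 := fun n => by
    rw [div_le_one (by positivity)]
    linarith [(Nat.cast_nonneg n : (0 : ℝ) ≤ n)]
  have hL := tendsto_integral_of_dominated_convergence
    (μ := volume.restrict (Ioi (0 : ℝ)))
    (F := fun (n : ℕ) (u : ℝ) =>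
      (1 - Complex.exp (-((w + ((1 / ((n : ℝ) + 1) : ℝ) : ℂ)) * u))) * ((u ^ (-1 - s) : ℝ) : ℂ))
    (f := fun u : ℝ => (1 - Complex.exp (-(w * u))) * ((u ^ (-1 - s) : ℝ) : ℂ))
    (fun u => 2 * (1 + (‖w‖ + 1)) * (min 1 u * u ^ (-1 - s)))
    (fun n => (measurable_one_sub_exp_mul_rpow s _).aestronglyMeasurable)
    ((integrableOn_min_one_mul_rpow h0 h1).const_mul _) ?_ ?_
  · refine tendsto_nhds_unique hL ?_
    have : ∀ n : ℕ, ∫ u in Ioi (0 : ℝ),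
        (1 - Complex.exp (-((w + ((1 / ((n : ℝ) + 1) : ℝ) : ℂ)) * u))) * ((u ^ (-1 - s) : ℝ) : ℂ)
        = (w + ((1 / ((n : ℝ) + 1) : ℝ) : ℂ)) ^ (s : ℂ) * ((Real.Gamma (1 - s) / s : ℝ) : ℂ) :=
      fun n => integral_one_sub_exp_mul_rpow_of_re_pos h0 h1
        (by rw [Complex.add_re, Complex.ofReal_re]; linarith [hpos n])
    simp_rw [this]
    exact ((continuousAt_cpow_const hsl).tendsto.comp hε).mul_const _
  · intro n
    refine (ae_restrict_iff' measurableSet_Ioi).mpr (ae_of_all _ fun u hu => ?_)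
    refine norm_one_sub_exp_mul_rpow_le ?_ ?_ hu
    · rw [Complex.add_re, Complex.ofReal_re]
      linarith [hpos n]
    · refine (norm_add_le _ _).trans ?_
      rw [Complex.norm_real, Real.norm_of_nonneg (hpos n).le]
      linarith [hle n]
  · refine ae_of_all _ fun u => ?_
    have : Continuous fun x : ℂ =>
      (1 - Complex.exp (-(x * u))) * ((u ^ (-1 - s) : ℝ) : ℂ) := by fun_prop
    exact (this.tendsto w).comp hε

end StableEst

/-! ### Fractional absolute and signed moments of a strictly stable law. -/

namespace StableEst

open Set Filter Topology

/-- The principal argument of `-ix` is `-(π/2) sign x`. The real part thus carries `|x|^s` and the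
imaginary part `sign(x)|x|^s`. -/
lemma cpow_neg_I_mul {s : ℝ} (hs : 0 < s) (x : ℝ) :
    (-(Complex.I * x)) ^ (s : ℂ) = ((|x| ^ s * Real.cos (Real.pi * s / 2) : ℝ) : ℂ)
      - ((Real.sign x * |x| ^ s * Real.sin (Real.pi * s / 2) : ℝ) : ℂ) * Complex.I := by
  rcases lt_trichotomy x 0 with hx | rfl | hx
  · have h : -(Complex.I * x) = ((-x : ℝ) : ℂ) * Complex.I := by push_cast; ring
    have hx' : 0 < -x := by linarith
    rw [h, Complex.cpow_def_of_ne_zero (by simp [hx.ne]),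
      Complex.log_ofReal_mul hx' Complex.I_ne_zero, Complex.log_I, Real.sign_of_neg hx,
      abs_of_neg hx, Real.rpow_def_of_pos hx', add_mul, Complex.exp_add]
    rw [show (Real.pi / 2 * Complex.I * s : ℂ) = ((Real.pi * s / 2 : ℝ) : ℂ) * Complex.I by
      push_cast; ring, Complex.exp_mul_I]
    push_cast
    ring
  · simp [hs.ne']
  · have h : -(Complex.I * x) = (x : ℂ) * (-Complex.I) := by ring
    rw [h, Complex.cpow_def_of_ne_zero (by simp [hx.ne']),
      Complex.log_ofReal_mul hx (by simp), Complex.log_neg_I, Real.sign_of_pos hx,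
      abs_of_pos hx, Real.rpow_def_of_pos hx, add_mul, Complex.exp_add]
    rw [show (-(Real.pi / 2) * Complex.I * s : ℂ) = ((-(Real.pi * s / 2) : ℝ) : ℂ) * Complex.I by
      push_cast; ring, Complex.exp_mul_I, ← Complex.ofReal_cos, ← Complex.ofReal_sin,
      Real.cos_neg, Real.sin_neg]
    push_cast
    ring

/-- The majorant has a known Mellin integral proportional to `|x|^s`, which is what Fubini requires
in `integral_cpow_neg_I_mul`. -/
lemma norm_one_sub_exp_neg_le_four_mul {z : ℂ} (hz : 0 ≤ z.re) :
    ‖1 - Complex.exp (-z)‖ ≤ 4 * (1 - Real.exp (-‖z‖)) := by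
  have ht := norm_nonneg z
  have h1 : Real.exp (-‖z‖) ≤ (1 + ‖z‖)⁻¹ := by
    rw [Real.exp_neg]
    exact inv_anti₀ (by positivity) (by linarith [Real.add_one_le_exp ‖z‖])
  have h2 : ‖z‖ / (1 + ‖z‖) ≤ 1 - Real.exp (-‖z‖) := by
    have : ‖z‖ / (1 + ‖z‖) = 1 - (1 + ‖z‖)⁻¹ := by field_simp; ring
    linarith
  rcases le_total ‖z‖ 1 with h | h
  · have h3 : ‖z‖ / 2 ≤ ‖z‖ / (1 + ‖z‖) := by gcongr; linarith
    linarith [norm_one_sub_exp_neg_le_two_mul hz]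
  · have h3 : 1 / 2 ≤ ‖z‖ / (1 + ‖z‖) := by
      rw [div_le_div_iff₀ (by norm_num) (by positivity)]
      linarith
    linarith [norm_one_sub_exp_neg_le_two hz]

lemma re_neg_I_mul (x : ℝ) : (-(Complex.I * x)).re = 0 := by simp

section Mellin

variable {μ : Measure ℝ} [IsProbabilityMeasure μ] {α s : ℝ} {w : ℂ}

/-- The substitution `u = k^α` reduces this to the previous integral with exponent `s / α`, which is
below 1 exactly when `s < α`. -/
lemma integrableOn_and_integral_one_sub_exp_rpow (hα : 0 < α) (hw : 0 ≤ w.re) (h0 : 0 < s)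
    (hsα : s < α) :
    IntegrableOn (fun k : ℝ => (1 - Complex.exp (-(w * ((k ^ α : ℝ) : ℂ))))
        * ((k ^ (-1 - s) : ℝ) : ℂ)) (Ioi 0) ∧
      ∫ k in Ioi (0 : ℝ), (1 - Complex.exp (-(w * ((k ^ α : ℝ) : ℂ)))) * ((k ^ (-1 - s) : ℝ) : ℂ)
        = w ^ ((s / α : ℝ) : ℂ) * ((Real.Gamma (1 - s / α) / s : ℝ) : ℂ) := by
  have hs0 : 0 < s / α := by positivity
  have hs1 : s / α < 1 := (div_lt_one hα).mpr hsα
  set g : ℝ → ℂ := fun u => (1 - Complex.exp (-(w * u))) * ((u ^ (-1 - s / α) : ℝ) : ℂ) with hg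
  have hcongr : ∀ k ∈ Ioi (0 : ℝ), k ^ (α - 1) • g (k ^ α)
      = (1 - Complex.exp (-(w * ((k ^ α : ℝ) : ℂ)))) * ((k ^ (-1 - s) : ℝ) : ℂ) := by
    intro k hk
    rw [mem_Ioi] at hk
    have h1 : k ^ (-1 - s) = k ^ (α - 1) * (k ^ α) ^ (-1 - s / α) := by
      rw [← Real.rpow_mul hk.le, ← Real.rpow_add hk]
      congr 1
      field_simp
      ring
    rw [hg, h1, Complex.real_smul]
    push_cast
    ring
  have hgi : IntegrableOn g (Ioi 0) := integrableOn_one_sub_exp_mul_rpow hs0 hs1 hw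
  constructor
  · exact ((integrableOn_Ioi_comp_rpow_iff' g hα.ne').mpr hgi).congr_fun hcongr measurableSet_Ioi
  · rw [← setIntegral_congr_fun measurableSet_Ioi hcongr]
    have h := integral_comp_rpow_Ioi_of_pos (g := g) hα
    rw [integral_one_sub_exp_mul_rpow hs0 hs1 hw] at h
    simp_rw [mul_smul] at h
    rw [integral_smul] at h
    have h2 : (α : ℂ) ≠ 0 := by exact_mod_cast hα.ne'
    rw [Complex.real_smul] at h
    refine mul_left_cancel₀ h2 (h.trans ?_)
    push_cast
    field_simp

lemma integral_one_sub_exp_charFun (k r : ℝ) :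
    ∫ x, (1 - Complex.exp (-(-(Complex.I * x) * k))) * (r : ℂ) ∂μ
      = (1 - charFun μ k) * (r : ℂ) := by
  rw [integral_mul_const, charFun_apply_real, integral_sub (integrable_const _)]
  · congr 2
    · simp
    · refine integral_congr_ae (ae_of_all _ fun x => ?_)
      ring_nf
  · refine (integrable_const (1 : ℝ)).mono' (by fun_prop) (ae_of_all _ fun x => ?_)
    rw [Complex.norm_exp]
    simp

lemma integrable_one_sub_exp_charFun (k : ℝ) (r : ℝ) :
    Integrable (fun x : ℝ => (1 - Complex.exp (-(-(Complex.I * x) * k))) * (r : ℂ)) μ := by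
  refine (Integrable.mono' (integrable_const (2 : ℝ)) (by fun_prop)
    (ae_of_all _ fun x => norm_one_sub_exp_neg_le_two ?_)).mul_const _
  simp

/-- Fubini would presuppose this integrability. Tonelli does not: the real part of the kernel is `(1
- cos xk) k^{-1-s} ≥ 0`, and its integral over `k` is a positive multiple of `|x|^s`. -/
lemma integrable_abs_rpow (hα : 0 < α) (hw : 0 ≤ w.re)
    (hφ : ∀ k : ℝ, 0 < k → charFun μ k = Complex.exp (-(w * ((k ^ α : ℝ) : ℂ))))
    (h0 : 0 < s) (h1 : s < 1) (hsα : s < α) :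
    Integrable (fun x : ℝ => |x| ^ s) μ := by
  set c : ℝ := Real.cos (Real.pi * s / 2) * (Real.Gamma (1 - s) / s) with hc
  have hcpos : 0 < c := by
    have := Real.Gamma_pos_of_pos (show 0 < 1 - s by linarith)
    have h2 : 0 < Real.cos (Real.pi * s / 2) := by
      apply Real.cos_pos_of_mem_Ioo
      constructor <;> nlinarith [Real.pi_pos]
    positivity
  set F : ℝ → ℝ → ℂ := fun x k =>
    (1 - Complex.exp (-(-(Complex.I * x) * k))) * ((k ^ (-1 - s) : ℝ) : ℂ) with hF
  have hFm : Measurable (fun p : ℝ × ℝ => F p.1 p.2) := by fun_prop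
  have hFi : ∀ x, IntegrableOn (F x) (Ioi 0) := fun x =>
    integrableOn_one_sub_exp_mul_rpow h0 h1 (re_neg_I_mul x).ge
  have hre : ∀ x k, 0 < k → 0 ≤ (F x k).re := by
    intro x k hk
    have hp : 0 ≤ k ^ (-1 - s) := by positivity
    have h3 : (F x k).re = (1 - Real.cos (x * k)) * k ^ (-1 - s) := by
      rw [hF]
      simp only [Complex.mul_re, Complex.ofReal_re, Complex.ofReal_im, mul_zero, sub_zero,
        Complex.sub_re, Complex.one_re, neg_mul, neg_neg, Complex.exp_re, Complex.mul_im,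
        Complex.I_re, Complex.I_im, zero_mul, one_mul, zero_add]
      simp
    rw [h3]
    exact mul_nonneg (by linarith [Real.cos_le_one (x * k)]) hp
  have hin : ∀ x : ℝ, ∫⁻ k in Ioi (0 : ℝ), ENNReal.ofReal (F x k).re
      = ENNReal.ofReal (|x| ^ s * c) := by
    intro x
    have hFr : IntegrableOn (fun k => (F x k).re) (Ioi 0) := (hFi x).re
    rw [← ofReal_integral_eq_lintegral_ofReal hFr]
    · congr 1
      have h4 := integral_one_sub_exp_mul_rpow h0 h1 (re_neg_I_mul x).ge
      have h5 : ∫ k in Ioi (0 : ℝ), (F x k).re = (∫ k in Ioi (0 : ℝ), F x k).re :=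
        integral_re (hFi x)
      refine h5.trans ?_
      rw [hF]
      dsimp only
      rw [h4, cpow_neg_I_mul h0, hc, Complex.re_mul_ofReal, Complex.sub_re, Complex.ofReal_re,
        Complex.re_ofReal_mul, Complex.I_re]
      ring
    · exact (ae_restrict_iff' measurableSet_Ioi).mpr (ae_of_all _ fun k hk => hre x k hk)
  have hswap : ∫⁻ x, ENNReal.ofReal (|x| ^ s * c) ∂μ
      = ∫⁻ k in Ioi (0 : ℝ), ∫⁻ x, ENNReal.ofReal (F x k).re ∂μ := by
    simp_rw [← hin]
    exact lintegral_lintegral_swap (by fun_prop)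
  have hfin : ∫⁻ x, ENNReal.ofReal (|x| ^ s * c) ∂μ < ⊤ := by
    rw [hswap]
    have h6 := (integrableOn_and_integral_one_sub_exp_rpow hα hw h0 hsα).1.re
    refine lt_of_eq_of_lt ?_ h6.lintegral_lt_top
    refine setLIntegral_congr_fun measurableSet_Ioi fun k hk => ?_
    have hFr : Integrable (fun x => (F x k).re) μ := (integrable_one_sub_exp_charFun k _).re
    rw [← ofReal_integral_eq_lintegral_ofReal hFr
      (ae_of_all _ fun x => hre x k hk)]
    congr 1
    refine (integral_re (integrable_one_sub_exp_charFun k _)).trans ?_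
    rw [integral_one_sub_exp_charFun, hφ k hk]
  have h7 : Integrable (fun x : ℝ => |x| ^ s * c) μ := by
    refine ⟨Measurable.aestronglyMeasurable (by fun_prop), ?_⟩
    rw [hasFiniteIntegral_iff_ofReal (ae_of_all _ fun x => by positivity)]
    exact hfin
  refine (h7.mul_const c⁻¹).congr (ae_of_all _ fun x => ?_)
  field_simp

/-- Integrate `(1 - e^{ixk}) k^{-1-s}` in both orders: over `k` first it gives `(-ix)^s Γ(1-s)/s`,
over `x` first it gives the Mellin integral of `1 - charFun μ k`. -/
lemma integral_cpow_neg_I_mul (hα : 0 < α) (hw : 0 ≤ w.re)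
    (hφ : ∀ k : ℝ, 0 < k → charFun μ k = Complex.exp (-(w * ((k ^ α : ℝ) : ℂ))))
    (h0 : 0 < s) (h1 : s < 1) (hsα : s < α) :
    ∫ x : ℝ, (-(Complex.I * x)) ^ (s : ℂ) ∂μ
      = w ^ ((s / α : ℝ) : ℂ) * ((Real.Gamma (1 - s / α) / Real.Gamma (1 - s) : ℝ) : ℂ) := by
  have habs := integrable_abs_rpow hα hw hφ h0 h1 hsα
  set F : ℝ → ℝ → ℂ := fun x k =>
    (1 - Complex.exp (-(-(Complex.I * x) * k))) * ((k ^ (-1 - s) : ℝ) : ℂ) with hF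
  have hFm : Measurable (Function.uncurry F) := by
    rw [hF]; unfold Function.uncurry; fun_prop
  have hFi : ∀ x, IntegrableOn (F x) (Ioi 0) := fun x =>
    integrableOn_one_sub_exp_mul_rpow h0 h1 (re_neg_I_mul x).ge
  have hprod : Integrable (Function.uncurry F) (μ.prod (volume.restrict (Ioi (0 : ℝ)))) := by
    rw [integrable_prod_iff hFm.aestronglyMeasurable]
    refine ⟨ae_of_all _ hFi, ?_⟩
    refine (habs.const_mul (4 * (Real.Gamma (1 - s) / s))).mono'
      (hFm.norm.aestronglyMeasurable.integral_prod_right' (f := fun p => ‖Function.uncurry F p‖))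
      (ae_of_all _ fun x => ?_)
    rw [Real.norm_of_nonneg (integral_nonneg fun k => norm_nonneg _)]
    rcases eq_or_ne x 0 with rfl | hx
    · simp [hF, h0.ne']
    have hx' : 0 < |x| := abs_pos.mpr hx
    have hint : IntegrableOn
        (fun k : ℝ => 4 * ((1 - Real.exp (-(|x| * k))) * k ^ (-1 - s))) (Ioi 0) := by
      have hJ := (integrableOn_one_sub_exp_mul_rpow h0 h1 (w := ((|x| : ℝ) : ℂ))
        (by simp)).re.const_mul 4
      refine hJ.congr (ae_of_all _ fun k => ?_)
      simp only [RCLike.re_to_complex]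
      norm_cast
    calc ∫ k in Ioi (0 : ℝ), ‖F x k‖
        ≤ ∫ k in Ioi (0 : ℝ), 4 * ((1 - Real.exp (-(|x| * k))) * k ^ (-1 - s)) := by
          refine setIntegral_mono_on (hFi x).norm hint measurableSet_Ioi fun k hk => ?_
          rw [mem_Ioi] at hk
          have hp : 0 ≤ k ^ (-1 - s) := by positivity
          have h2 := norm_one_sub_exp_neg_le_four_mul (z := -(Complex.I * x) * k) (by simp)
          have h3 : ‖-(Complex.I * x) * (k : ℂ)‖ = |x| * k := by
            simp [abs_of_pos hk]
          rw [h3] at h2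
          rw [hF]
          dsimp only
          rw [norm_mul, Complex.norm_real, Real.norm_of_nonneg hp, ← mul_assoc]
          exact mul_le_mul_of_nonneg_right h2 hp
      _ = 4 * (Real.Gamma (1 - s) / s) * |x| ^ s := by
          rw [integral_const_mul, integral_one_sub_exp_mul_rpow_ofReal h0 h1 hx']
          ring
  have hswap := integral_integral_swap hprod
  have hl : ∀ x : ℝ, ∫ k in Ioi (0 : ℝ), F x k
      = (-(Complex.I * x)) ^ (s : ℂ) * ((Real.Gamma (1 - s) / s : ℝ) : ℂ) := fun x =>
    integral_one_sub_exp_mul_rpow h0 h1 (re_neg_I_mul x).ge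
  simp_rw [hl] at hswap
  rw [integral_mul_const] at hswap
  have hr : ∫ k in Ioi (0 : ℝ), ∫ x, F x k ∂μ
      = w ^ ((s / α : ℝ) : ℂ) * ((Real.Gamma (1 - s / α) / s : ℝ) : ℂ) := by
    rw [← (integrableOn_and_integral_one_sub_exp_rpow hα hw h0 hsα).2]
    refine setIntegral_congr_fun measurableSet_Ioi fun k hk => ?_
    rw [← hφ k hk]
    exact integral_one_sub_exp_charFun k _
  rw [hr] at hswap
  have hG : Real.Gamma (1 - s) ≠ 0 := (Real.Gamma_pos_of_pos (by linarith)).ne'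
  have hG' : ((Real.Gamma (1 - s) / s : ℝ) : ℂ) ≠ 0 := by
    exact_mod_cast div_ne_zero hG h0.ne'
  refine mul_right_cancel₀ hG' (hswap.trans ?_)
  rw [mul_assoc, ← Complex.ofReal_mul]
  congr 3
  field_simp

end Mellin

/-- The fractional absolute moments and signed moments of a strictly stable law. -/
lemma IsStrictlyStableLaw.moments {μ : Measure ℝ} [IsProbabilityMeasure μ] {ν θ τ : ℝ}
    (hadm : Admissible ν θ) (hμ : IsStrictlyStableLaw μ ν θ τ) {s : ℝ} (h0 : 0 < s) (h1 : s < 1)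
    (hs : s * √ν < 1) :
    Integrable (fun x : ℝ => |x| ^ s) μ ∧
      (∫ x, |x| ^ s ∂μ) * Real.cos (Real.pi * s / 2) =
        Real.exp (s * (τ + Real.eulerMascheroniConstant * (1 - √ν)))
          * Real.cos (Real.pi * (θ * s) / 2) * (Real.Gamma (1 - s * √ν) / Real.Gamma (1 - s)) ∧
      (∫ x, Real.sign x * |x| ^ s ∂μ) * Real.sin (Real.pi * s / 2) =
        Real.exp (s * (τ + Real.eulerMascheroniConstant * (1 - √ν)))
          * Real.sin (Real.pi * (θ * s) / 2) * (Real.Gamma (1 - s * √ν) / Real.Gamma (1 - s)) := by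
  obtain ⟨hν, hθ⟩ := hadm
  have hν0 : 0 < ν := by linarith
  set β := √ν with hβ
  have hβ0 : 0 < β := Real.sqrt_pos.mpr hν0
  have hαβ : ν ^ (-(1 / 2) : ℝ) = β⁻¹ := by
    rw [Real.rpow_neg hν0.le, hβ, Real.sqrt_eq_rpow]
  set α := β⁻¹ with hα
  have hα0 : 0 < α := by positivity
  have hsα : s < α := by
    rw [hα, lt_inv_comm₀ h0 hβ0, ← one_div, lt_div_iff₀ h0]
    linarith
  have hsa : s / α = s * β := by rw [hα]; field_simp
  set C := Real.eulerMascheroniConstant with hC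
  -- Admissibility enters here: `|θ| ≤ min(1, 2β - 1) ≤ β`. It makes `Re e^z ≥ 0`, so that the
  -- Mellin formula covers `w = e^z`.
  have hθα : |θ * α| ≤ 1 := by
    rw [abs_mul, abs_of_pos hα0, hα, ← div_eq_mul_inv, div_le_one hβ0]
    rcases le_total 1 β with h | h
    · exact (hθ.trans (min_le_left _ _)).trans h
    · exact (hθ.trans (min_le_right _ _)).trans (by linarith)
  obtain ⟨hθα1, hθα2⟩ := abs_le.mp hθα
  set z : ℂ := ((α * τ + C * (α - 1) : ℝ) : ℂ) - ((Real.pi / 2 * (θ * α) : ℝ) : ℂ) * Complex.I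
    with hz
  have hzim : z.im = -(Real.pi / 2 * (θ * α)) := by rw [hz]; simp
  have hzre : z.re = α * τ + C * (α - 1) := by rw [hz]; simp
  have hw : 0 ≤ (Complex.exp z).re := by
    rw [Complex.exp_re, hzim, Real.cos_neg]
    have : 0 ≤ Real.cos (Real.pi / 2 * (θ * α)) := by
      apply Real.cos_nonneg_of_mem_Icc
      constructor <;> nlinarith [Real.pi_pos]
    positivity
  have hφ : ∀ k : ℝ, 0 < k →
      charFun μ k = Complex.exp (-(Complex.exp z * ((k ^ α : ℝ) : ℂ))) := by
    intro k hk
    rw [hμ k, strictlyStableCharFun, if_neg hk.ne', hαβ, abs_of_pos hk, Real.sign_of_pos hk,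
      Real.rpow_def_of_pos hk, Complex.ofReal_exp, ← Complex.exp_add, hz]
    congr 3
    push_cast
    ring
  have key := integral_cpow_neg_I_mul hα0 hw hφ h0 h1 hsα
  have habs := integrable_abs_rpow hα0 hw hφ h0 h1 hsα
  have hcpow : Complex.exp z ^ ((s / α : ℝ) : ℂ)
      = ((Real.exp (s * (τ + C * (1 - β))) : ℝ) : ℂ) *
        (((Real.cos (Real.pi * (θ * s) / 2) : ℝ) : ℂ)
          - ((Real.sin (Real.pi * (θ * s) / 2) : ℝ) : ℂ) * Complex.I) := by
    have e1 : α * β = 1 := by rw [hα]; field_simp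
    have hzs : z * ((s / α : ℝ) : ℂ) = ((s * (τ + C * (1 - β)) : ℝ) : ℂ)
        + ((-(Real.pi * (θ * s) / 2) : ℝ) : ℂ) * Complex.I := by
      rw [hz, hsa]
      apply Complex.ext
      · simp
        linear_combination (s * τ + s * C) * e1
      · simp
        linear_combination (Real.pi * θ * s / 2) * e1
    -- The logarithm of `e^z` is `z` itself, since `|Im z| ≤ π/2`.
    rw [Complex.cpow_def_of_ne_zero (Complex.exp_ne_zero _), Complex.log_exp, hzs,
      Complex.exp_add, Complex.exp_mul_I, ← Complex.ofReal_cos, ← Complex.ofReal_sin,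
      Real.cos_neg, Real.sin_neg]
    · push_cast; ring
    · rw [hzim]; nlinarith [Real.pi_pos]
    · rw [hzim]; nlinarith [Real.pi_pos]
  have hsgn : Integrable (fun x : ℝ => Real.sign x * |x| ^ s) μ := by
    have hm : Measurable Real.sign :=
      Measurable.ite measurableSet_Iio measurable_const
        (Measurable.ite measurableSet_Ioi measurable_const measurable_const)
    refine habs.mono' (by fun_prop) (ae_of_all _ fun x => ?_)
    rw [norm_mul, Real.norm_of_nonneg (by positivity : 0 ≤ |x| ^ s)]
    refine mul_le_of_le_one_left (by positivity) ?_
    rcases Real.sign_apply_eq x with h | h | h <;> simp [h]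
  refine ⟨habs, ?_⟩
  rw [hcpow, hsa] at key
  simp_rw [cpow_neg_I_mul h0] at key
  rw [integral_sub (habs.mul_const _).ofReal ((hsgn.mul_const _).ofReal.mul_const _),
    integral_mul_const, integral_complex_ofReal, integral_complex_ofReal, integral_mul_const,
    integral_mul_const] at key
  have aux : ∀ a b e c d g : ℝ, (a : ℂ) - b * Complex.I = e * (c - d * Complex.I) * g →
      a = e * c * g ∧ b = e * d * g := by
    intro a b e c d g h
    have hr := congrArg Complex.re h
    have hi := congrArg Complex.im h
    simp at hr hi
    exact ⟨hr, by linarith⟩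
  exact aux _ _ _ _ _ _ key

end StableEst

/-! ### Zeta expansions of `log Γ` and `log cos`, and the cumulant generating function. -/

namespace StableEst

open Set Filter Topology

lemma hasSum_zetaR {k : ℕ} (hk : 1 < k) :
    HasSum (fun m : ℕ => (1 : ℝ) / ((m : ℝ) + 1) ^ k) (zetaR k) := by
  have hs : Summable (fun m : ℕ => (1 : ℝ) / (m : ℝ) ^ k) :=
    Real.summable_one_div_nat_pow.mpr hk
  have h1 : zetaR k = ∑' m : ℕ, (1 : ℝ) / (m : ℝ) ^ k := by
    rw [zetaR, zeta_nat_eq_tsum_of_gt_one hk]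
    have : ∑' m : ℕ, (1 : ℂ) / (m : ℂ) ^ k = ((∑' m : ℕ, (1 : ℝ) / (m : ℝ) ^ k : ℝ) : ℂ) := by
      push_cast
      rfl
    rw [this, Complex.ofReal_re]
  have h2 := (hasSum_nat_add_iff' (f := fun m : ℕ => (1 : ℝ) / (m : ℝ) ^ k) 1).mpr hs.hasSum
  rw [← h1] at h2
  rw [Finset.sum_range_one, Nat.cast_zero, zero_pow (by omega), div_zero, sub_zero] at h2
  simpa using h2

lemma zetaR_pos {k : ℕ} (hk : 1 < k) : 0 < zetaR k := by
  have h := hasSum_zetaR hk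
  rw [← h.tsum_eq]
  exact h.summable.tsum_pos (fun m => by positivity) 0 (by simp)

lemma hasSum_neg_log_one_sub_sub {x : ℝ} (hx : |x| < 1) :
    HasSum (fun k : ℕ => x ^ (k + 2) / (k + 2)) (-Real.log (1 - x) - x) := by
  have h := (hasSum_nat_add_iff' 1).mpr (Real.hasSum_pow_div_log_of_abs_lt_one hx)
  simp only [Finset.range_one, Finset.sum_singleton, zero_add, pow_one, Nat.cast_zero,
    div_one] at h
  have e : (fun k : ℕ => x ^ (k + 2) / ((k : ℝ) + 2))
      = fun k : ℕ => x ^ (k + 1 + 1) / (((k + 1 : ℕ) : ℝ) + 1) := by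
    funext k
    push_cast
    rw [add_assoc (k : ℝ), one_add_one_eq_two]
  rw [e]
  exact h

lemma log_factorial_eq_sum (n : ℕ) :
    Real.log (n.factorial : ℝ) = ∑ m ∈ Finset.range n, Real.log ((m : ℝ) + 1) := by
  induction n with
  | zero => simp
  | succ n ih =>
    rw [Finset.sum_range_succ, ← ih, Nat.factorial_succ, Nat.cast_mul, Real.log_mul]
    · push_cast; ring
    · positivity
    · positivity

/-- The Weierstrass product for `Γ (1 - s)`, in logarithmic form. -/
lemma tendsto_sum_neg_log_one_sub_div {s : ℝ} (hs : s < 1) :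
    Tendsto (fun n : ℕ => ∑ m ∈ Finset.range n,
      (-Real.log (1 - s / ((m : ℝ) + 1)) - s / ((m : ℝ) + 1))) atTop
      (𝓝 (Real.log (Real.Gamma (1 - s)) - Real.eulerMascheroniConstant * s)) := by
  have h1 := Real.BohrMollerup.tendsto_log_gamma (x := 1 - s) (by linarith)
  have h2 := Real.tendsto_harmonic_sub_log.const_mul s
  -- The Gauss sequence for `log Γ(1 - s)` has `n + 1` factors while the sum has `n` terms; this
  -- limit removes the last factor, normalised by `n`.
  have h3 : Tendsto (fun n : ℕ => Real.log (1 + (1 - s) / (n : ℝ))) atTop (𝓝 0) := by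
    have : Tendsto (fun n : ℕ => 1 + (1 - s) / (n : ℝ)) atTop (𝓝 1) := by
      simpa using (tendsto_const_div_atTop_nhds_zero_nat (1 - s)).const_add 1
    have h := (Real.continuousAt_log one_ne_zero).tendsto.comp this
    rwa [Real.log_one] at h
  have h4 := (h1.sub h2).add h3
  rw [add_zero, mul_comm s] at h4
  refine h4.congr' ?_
  filter_upwards [eventually_ge_atTop 1] with n hn
  have hn0 : (0 : ℝ) < n := by exact_mod_cast hn
  have hsum : ∑ m ∈ Finset.range n, (-Real.log (1 - s / ((m : ℝ) + 1)) - s / ((m : ℝ) + 1))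
      = ∑ m ∈ Finset.range n, Real.log ((m : ℝ) + 1)
        - ∑ m ∈ Finset.range n, Real.log (1 - s + m) - s * harmonic n := by
    rw [harmonic]
    push_cast
    rw [Finset.mul_sum, ← Finset.sum_sub_distrib, ← Finset.sum_sub_distrib]
    refine Finset.sum_congr rfl fun m _ => ?_
    have hm : (0 : ℝ) < m + 1 := by positivity
    have hm' : 1 - s / ((m : ℝ) + 1) = (1 - s + m) / (m + 1) := by field_simp; ring
    have hms : (0 : ℝ) < 1 - s + m := by
      have : (0 : ℝ) ≤ m := by positivity
      linarith
    rw [hm', Real.log_div hms.ne' hm.ne']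
    ring
  have h5 : 1 + (1 - s) / (n : ℝ) = (1 - s + n) / n := by field_simp; ring
  have h6 : (0 : ℝ) < 1 - s + n := by linarith
  rw [hsum, Real.BohrMollerup.logGammaSeq, Finset.sum_range_succ, log_factorial_eq_sum, h5,
    Real.log_div h6.ne' hn0.ne']
  ring

/-- The double series `(s/(m+1))^{k+2}/(k+2)` is summed in two ways: rows give the Weierstrass
product, columns give zeta values. -/
lemma hasSum_log_Gamma_one_sub {s : ℝ} (hs : |s| < 1) :
    HasSum (fun k : ℕ => zetaR (k + 2) / (k + 2) * s ^ (k + 2))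
      (Real.log (Real.Gamma (1 - s)) - Real.eulerMascheroniConstant * s) := by
  set f : ℕ × ℕ → ℝ := fun p => (s / ((p.1 : ℝ) + 1)) ^ (p.2 + 2) / (p.2 + 2) with hf
  have hsum : Summable f := by
    have h1 : Summable (fun p : ℕ × ℕ => (1 : ℝ) / ((p.1 : ℝ) + 1) ^ 2 * |s| ^ p.2) :=
      (hasSum_zetaR one_lt_two).summable.mul_of_nonneg
        (summable_geometric_of_lt_one (abs_nonneg s) hs) (fun _ => by positivity)
        (fun _ => by positivity)
    refine Summable.of_norm_bounded h1 fun p => ?_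
    have hp : (1 : ℝ) ≤ (p.1 : ℝ) + 1 := by linarith [(Nat.cast_nonneg p.1 : (0 : ℝ) ≤ p.1)]
    have hp0 : (0 : ℝ) < (p.1 : ℝ) + 1 := by linarith
    rw [hf, norm_div, norm_pow, norm_div, Real.norm_eq_abs, Real.norm_of_nonneg hp0.le,
      Real.norm_of_nonneg (by positivity : (0 : ℝ) ≤ (p.2 : ℝ) + 2), div_pow]
    calc |s| ^ (p.2 + 2) / ((p.1 : ℝ) + 1) ^ (p.2 + 2) / ((p.2 : ℝ) + 2)
        ≤ |s| ^ (p.2 + 2) / ((p.1 : ℝ) + 1) ^ (p.2 + 2) :=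
          div_le_self (by positivity) (by linarith [(Nat.cast_nonneg p.2 : (0 : ℝ) ≤ p.2)])
      _ ≤ |s| ^ p.2 / ((p.1 : ℝ) + 1) ^ 2 := by
          refine div_le_div₀ (by positivity) ?_ (by positivity) ?_
          · exact pow_le_pow_of_le_one (abs_nonneg s) hs.le (by omega)
          · exact pow_le_pow_right₀ hp (by omega)
      _ = _ := by ring
  have hrow : ∀ m : ℕ, HasSum (fun k => f (m, k))
      (-Real.log (1 - s / ((m : ℝ) + 1)) - s / ((m : ℝ) + 1)) := by
    intro m
    simp only [hf]
    apply hasSum_neg_log_one_sub_sub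
    have hp0 : (0 : ℝ) < (m : ℝ) + 1 := by positivity
    rw [abs_div, abs_of_pos hp0, div_lt_one hp0]
    linarith [(Nat.cast_nonneg m : (0 : ℝ) ≤ m)]
  have hcol : ∀ k : ℕ, HasSum (fun m => f (m, k)) (zetaR (k + 2) / (k + 2) * s ^ (k + 2)) := by
    intro k
    have := (hasSum_zetaR (k := k + 2) (by omega)).mul_right (s ^ (k + 2) / (k + 2))
    have e : (fun m => f (m, k)) = fun m : ℕ =>
        1 / ((m : ℝ) + 1) ^ (k + 2) * (s ^ (k + 2) / (k + 2)) := by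
      funext m
      simp only [hf, div_pow]
      ring
    rw [e, div_mul_eq_mul_div, ← mul_div_assoc']
    exact this
  have hT := (hsum.hasSum.prod_fiberwise hrow).tendsto_sum_nat
  have hval := tendsto_nhds_unique hT (tendsto_sum_neg_log_one_sub_div (lt_of_abs_lt hs))
  rw [← hval]
  have hsw : HasSum (f ∘ Prod.swap) (∑' p, f p) :=
    (Equiv.prodComm ℕ ℕ).hasSum_iff.mpr hsum.hasSum
  exact hsw.prod_fiberwise hcol

/-- Write `cos(πx/2) = sin(πx) / (2 sin(πx/2))` and use the reflection formula twice. All factors of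
the moment formula are then Gamma values, which have one common expansion. -/
lemma cos_eq_Gamma_div {x : ℝ} (hx : |x| < 1) :
    Real.cos (Real.pi * x / 2) = Real.Gamma (1 - x / 2) * Real.Gamma (1 + x / 2)
      / (Real.Gamma (1 - x) * Real.Gamma (1 + x)) := by
  rcases eq_or_ne x 0 with rfl | h0
  · simp
  obtain ⟨h1, h2⟩ := abs_lt.mp hx
  have hrefl : ∀ y : ℝ, y ≠ 0 → Real.Gamma (1 - y) * Real.Gamma (1 + y)
      = y * (Real.pi / Real.sin (Real.pi * y)) := by
    intro y hy
    rw [add_comm 1 y, Real.Gamma_add_one hy, ← Real.Gamma_mul_Gamma_one_sub]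
    ring
  have hsin : ∀ y : ℝ, y ≠ 0 → |y| < 1 → Real.sin (Real.pi * y) ≠ 0 := by
    intro y hy hy1 h
    obtain ⟨h3, h4⟩ := abs_lt.mp hy1
    rw [Real.sin_eq_zero_iff_of_lt_of_lt (by nlinarith [Real.pi_pos])
      (by nlinarith [Real.pi_pos])] at h
    exact (mul_ne_zero Real.pi_ne_zero hy) h
  have hx2 : x / 2 ≠ 0 := by positivity
  rw [hrefl x h0, hrefl (x / 2) hx2]
  have hs1 := hsin x h0 hx
  have hs2 := hsin (x / 2) hx2 (by rw [abs_div, abs_two]; linarith)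
  have hd : Real.sin (Real.pi * x) = 2 * Real.sin (Real.pi * (x / 2)) * Real.cos (Real.pi * x / 2) := by
    rw [show Real.pi * x = 2 * (Real.pi * (x / 2)) by ring, Real.sin_two_mul]
    ring_nf
  have hpi := Real.pi_ne_zero
  rw [hd] at hs1 ⊢
  have hc := right_ne_zero_of_mul hs1
  generalize Real.sin (Real.pi * (x / 2)) = A at *
  generalize Real.cos (Real.pi * x / 2) = B at *
  field_simp

lemma log_cos_eq {x : ℝ} (hx : |x| < 1) :
    Real.log (Real.cos (Real.pi * x / 2)) = Real.log (Real.Gamma (1 - x / 2))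
      + Real.log (Real.Gamma (1 - -x / 2)) - Real.log (Real.Gamma (1 - x))
      - Real.log (Real.Gamma (1 - -x)) := by
  obtain ⟨h1, h2⟩ := abs_lt.mp hx
  have p1 := (Real.Gamma_pos_of_pos (show 0 < 1 - x / 2 by linarith)).ne'
  have p2 := (Real.Gamma_pos_of_pos (show 0 < 1 + x / 2 by linarith)).ne'
  have p3 := (Real.Gamma_pos_of_pos (show 0 < 1 - x by linarith)).ne'
  have p4 := (Real.Gamma_pos_of_pos (show 0 < 1 + x by linarith)).ne'
  rw [cos_eq_Gamma_div hx, Real.log_div (mul_ne_zero p1 p2) (mul_ne_zero p3 p4),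
    Real.log_mul p1 p2, Real.log_mul p3 p4, neg_div, sub_neg_eq_add, sub_neg_eq_add]
  ring

lemma zetaR_two : zetaR 2 = Real.pi ^ 2 / 6 := by
  have h : riemannZeta ((2 : ℕ) : ℂ) = ((Real.pi ^ 2 / 6 : ℝ) : ℂ) := by
    push_cast; exact riemannZeta_two
  rw [zetaR, h, Complex.ofReal_re]

lemma zetaR_four : zetaR 4 = Real.pi ^ 4 / 90 := by
  have h : riemannZeta ((4 : ℕ) : ℂ) = ((Real.pi ^ 4 / 90 : ℝ) : ℂ) := by
    push_cast; exact riemannZeta_four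
  rw [zetaR, h, Complex.ofReal_re]

lemma bernoulli'_five : bernoulli' 5 = 0 := by
  rw [bernoulli'_def]
  norm_num [Finset.sum_range_succ, Nat.choose]

lemma bernoulli'_six : bernoulli' 6 = 1 / 42 := by
  rw [bernoulli'_def]
  norm_num [Finset.sum_range_succ, Nat.choose, bernoulli'_five]

lemma bernoulli'_seven : bernoulli' 7 = 0 := by
  rw [bernoulli'_def]
  norm_num [Finset.sum_range_succ, Nat.choose, bernoulli'_five, bernoulli'_six]

lemma bernoulli'_eight : bernoulli' 8 = -1 / 30 := by
  rw [bernoulli'_def]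
  norm_num [Finset.sum_range_succ, Nat.choose, bernoulli'_five, bernoulli'_six, bernoulli'_seven]

lemma zetaR_six : zetaR 6 = Real.pi ^ 6 / 945 := by
  have h : riemannZeta ((6 : ℕ) : ℂ) = ((Real.pi ^ 6 / 945 : ℝ) : ℂ) := by
    have h := riemannZeta_two_mul_nat (k := 3) (by norm_num)
    rw [bernoulli_eq_bernoulli'_of_ne_one (by norm_num), bernoulli'_six] at h
    push_cast at h ⊢
    norm_num [Nat.factorial] at h
    rw [h]
    ring
  rw [zetaR, h, Complex.ofReal_re]

lemma zetaR_eight : zetaR 8 = Real.pi ^ 8 / 9450 := by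
  have h : riemannZeta ((8 : ℕ) : ℂ) = ((Real.pi ^ 8 / 9450 : ℝ) : ℂ) := by
    have h := riemannZeta_two_mul_nat (k := 4) (by norm_num)
    rw [bernoulli_eq_bernoulli'_of_ne_one (by norm_num), bernoulli'_eight] at h
    push_cast at h ⊢
    norm_num [Nat.factorial] at h
    rw [h]
    ring
  rw [zetaR, h, Complex.ofReal_re]

/-- The cumulant generating function of `log |X| - τ` for a strictly stable law. -/
noncomputable def logCgf (ν θ s : ℝ) : ℝ :=
  Real.eulerMascheroniConstant * (1 - √ν) * s
    + (Real.log (Real.Gamma (1 - s * √ν)) - Real.log (Real.Gamma (1 - s)))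
    + (Real.log (Real.cos (Real.pi * (θ * s) / 2)) - Real.log (Real.cos (Real.pi * s / 2)))

/-- The `j`-th Taylor coefficient of `logCgf`. -/
noncomputable def logCgfCoeff (ν θ : ℝ) (j : ℕ) : ℝ :=
  if j < 2 then 0 else
    zetaR j / j * (√ν ^ j - 1 + (θ ^ j - 1) * ((1 / 2) ^ j + (-1 / 2) ^ j - 1 - (-1) ^ j))

/-- The term with Euler's constant in `logCgf` cancels the linear terms of the Gamma expansions;
this is why `log |X|` has mean exactly `τ`. -/
lemma hasSum_logCgf {ν θ : ℝ} (hθ : |θ| ≤ 1) {s : ℝ} (h1 : |s| < 1) (h2 : |s * √ν| < 1) :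
    HasSum (fun j : ℕ => logCgfCoeff ν θ j * s ^ j) (logCgf ν θ s) := by
  have hθs : |θ * s| < 1 := by
    rw [abs_mul]
    exact (mul_le_of_le_one_left (abs_nonneg s) hθ).trans_lt h1
  have hl : ∀ x : ℝ, |x| < 1 → |x / 2| < 1 ∧ |-x / 2| < 1 ∧ |-x| < 1 := by
    intro x hx
    rw [neg_div, abs_neg, abs_neg, abs_div, abs_two]
    have := abs_nonneg x
    exact ⟨by linarith, by linarith, hx⟩
  obtain ⟨a1, a2, a3⟩ := hl s h1
  obtain ⟨b1, b2, b3⟩ := hl _ hθs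
  have H := ((hasSum_log_Gamma_one_sub h2).sub (hasSum_log_Gamma_one_sub h1)).add
    ((((hasSum_log_Gamma_one_sub b1).add (hasSum_log_Gamma_one_sub b2)).sub
      ((hasSum_log_Gamma_one_sub hθs).add (hasSum_log_Gamma_one_sub b3))).sub
      (((hasSum_log_Gamma_one_sub a1).add (hasSum_log_Gamma_one_sub a2)).sub
      ((hasSum_log_Gamma_one_sub h1).add (hasSum_log_Gamma_one_sub a3))))
  rw [← hasSum_nat_add_iff' 2]
  have e0 : logCgfCoeff ν θ 0 = 0 := by simp [logCgfCoeff]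
  have e1 : logCgfCoeff ν θ 1 = 0 := by simp [logCgfCoeff]
  convert H using 1
  · funext k
    rw [logCgfCoeff, if_neg (by omega)]
    push_cast
    simp only [neg_div, neg_pow (_ / 2 : ℝ), neg_pow (θ * s), neg_pow s, div_pow, mul_pow, one_pow]
    ring
  · simp only [Finset.sum_range_succ, Finset.sum_range_zero, e0, e1]
    rw [logCgf, log_cos_eq hθs, log_cos_eq h1]
    ring

lemma analyticAt_and_iteratedDeriv_of_hasSum {a : ℕ → ℝ} {F : ℝ → ℝ} {r : ℝ} (hr : 0 < r)
    (h : ∀ s, |s| < r → HasSum (fun j => a j * s ^ j) (F s)) :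
    AnalyticAt ℝ F 0 ∧ ∀ j, iteratedDeriv j F 0 = j.factorial * a j := by
  -- Half the radius, so that absolute summability is available at the radius itself.
  have hp : HasFPowerSeriesOnBall F (FormalMultilinearSeries.ofScalars ℝ a) 0
      (ENNReal.ofReal (r / 2)) := by
    refine ⟨?_, by simpa using hr, ?_⟩
    · have : (ENNReal.ofReal (r / 2)) = ((r / 2).toNNReal : ENNReal) := rfl
      rw [this]
      refine FormalMultilinearSeries.le_radius_of_summable _ ?_
      have hs := (h (r / 2) (by rw [abs_of_pos (by positivity)]; linarith)).summable.norm
      refine hs.congr fun j => ?_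
      rw [Real.coe_toNNReal _ (by positivity), FormalMultilinearSeries.ofScalars_norm, norm_mul,
        norm_pow, Real.norm_of_nonneg (by positivity : 0 ≤ r / 2)]
    · intro y hy
      have hy' : |y| < r := by
        rw [Metric.mem_eball, edist_dist, ENNReal.ofReal_lt_ofReal_iff (by positivity),
          dist_zero_right, Real.norm_eq_abs] at hy
        linarith
      simpa [FormalMultilinearSeries.ofScalars_apply_eq, mul_comm] using h y hy'
  refine ⟨⟨_, _, hp⟩, fun j => ?_⟩
  have := hp.factorial_smul (1 : ℝ) j
  rw [iteratedDeriv_eq_iteratedFDeriv, ← this]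
  simp

end StableEst

/-! ### From the generating function on the right of 0 to moments of `log |X|` and of the sign. -/

namespace StableEst

open Set Filter Topology

/-- The recursion expressing moments through cumulants, for the Taylor coefficients of `exp ∘ K`. -/
lemma iteratedDeriv_exp_comp_succ {K : ℝ → ℝ} (hK : AnalyticAt ℝ K 0) (k : ℕ) :
    iteratedDeriv (k + 1) (fun s => Real.exp (K s)) 0 = ∑ i ∈ Finset.range (k + 1),
      (k.choose i : ℝ) * iteratedDeriv (i + 1) K 0
        * iteratedDeriv (k - i) (fun s => Real.exp (K s)) 0 := by
  have hG : AnalyticAt ℝ (fun s => Real.exp (K s)) 0 := hK.rexp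
  have hd : deriv (fun s => Real.exp (K s)) =ᶠ[𝓝 0] deriv K * fun s => Real.exp (K s) := by
    filter_upwards [hK.eventually_analyticAt] with s hs
    rw [(hs.differentiableAt.hasDerivAt.exp).deriv, Pi.mul_apply, mul_comm]
  rw [iteratedDeriv_succ', hd.iteratedDeriv_eq k,
    iteratedDeriv_mul hK.deriv.contDiffAt hG.contDiffAt]
  simp_rw [iteratedDeriv_succ']

/-- The seventh moment is omitted: up to degree eight it could occur only beside the first moment,
which vanishes. -/
lemma moments_of_cumulants {m κ : ℕ → ℝ} (h0 : m 0 = 1) (h1 : κ 1 = 0)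
    (hrec : ∀ k, m (k + 1) = ∑ i ∈ Finset.range (k + 1), (k.choose i : ℝ) * κ (i + 1) * m (k - i)) :
    m 1 = 0 ∧ m 2 = κ 2 ∧ m 3 = κ 3 ∧ m 4 = κ 4 + 3 * κ 2 ^ 2 ∧ m 5 = κ 5 + 10 * κ 3 * κ 2 ∧
      m 6 = κ 6 + 15 * κ 4 * κ 2 + 10 * κ 3 ^ 2 + 15 * κ 2 ^ 3 ∧
      m 8 = κ 8 + 28 * κ 6 * κ 2 + 56 * κ 5 * κ 3 + 35 * κ 4 ^ 2 + 210 * κ 4 * κ 2 ^ 2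
        + 280 * κ 3 ^ 2 * κ 2 + 105 * κ 2 ^ 4 := by
  have e1 := hrec 0
  have e2 := hrec 1
  have e3 := hrec 2
  have e4 := hrec 3
  have e5 := hrec 4
  have e6 := hrec 5
  have e7 := hrec 6
  have e8 := hrec 7
  simp [h0, h1] at e1
  simp [Finset.sum_range_succ, h0, h1, e1] at e2
  simp [Finset.sum_range_succ, h0, h1, e1, e2] at e3
  simp [Finset.sum_range_succ, h0, h1, e1, e2, e3] at e4
  simp [Finset.sum_range_succ, h0, h1, e1, e2, e3, e4] at e5
  simp [Finset.sum_range_succ, h0, h1, e1, e2, e3, e4, e5] at e6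
  simp [Finset.sum_range_succ, h0, h1, e1, e2, e3, e4, e5, e6] at e7
  simp [Finset.sum_range_succ, h0, h1, e1, e2, e3, e4, e5, e6, e7] at e8
  norm_num [Nat.choose] at e2 e3 e4 e5 e6 e7 e8
  refine ⟨e1, e2, e3, ?_, ?_, ?_, ?_⟩
  · linarith
  · linarith
  · linarith
  · rw [e8]; ring

/-- If the moment generating function of `Y` extends analytically from the right to `0`, then `Y`
has all moments and they are the derivatives at `0` of the extension. -/
lemma integrable_pow_and_integral_of_mgf_right {P : Measure ℝ}
    [IsProbabilityMeasure P] {Y : ℝ → ℝ} (hY : Measurable Y) {G : ℝ → ℝ} (hG : AnalyticAt ℝ G 0)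
    {δ : ℝ} (hδ : 0 < δ) (hint : ∀ s ∈ Ioo 0 δ, Integrable (fun ω => Real.exp (s * Y ω)) P)
    (hmgf : ∀ s ∈ Ioo 0 δ, mgf Y P s = G s) (k : ℕ) :
    Integrable (fun ω => Y ω ^ k) P ∧ ∫ ω, Y ω ^ k ∂P = iteratedDeriv k G 0 := by
  -- The generating function is controlled only for `s > 0`, so 0 need not be an interior point.
  -- Moments are differentiated at `s > 0` and then followed to 0.
  have hmem : ∀ s ∈ Ioo 0 δ, s ∈ interior (integrableExpSet Y P) := fun s hs =>
    interior_mono (fun t ht => hint t ht) (by rwa [isOpen_Ioo.interior_eq])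
  have hIoo : ∀ᶠ s in 𝓝[>] (0 : ℝ), s ∈ Ioo 0 δ := Ioo_mem_nhdsGT hδ
  have htend : ∀ j, Tendsto (fun s => ∫ ω, Y ω ^ j * Real.exp (s * Y ω) ∂P) (𝓝[>] 0)
      (𝓝 (iteratedDeriv j G 0)) := by
    intro j
    have hc : Tendsto (iteratedDeriv j G) (𝓝[>] 0) (𝓝 (iteratedDeriv j G 0)) := by
      have : AnalyticAt ℝ (iteratedDeriv j G) 0 := by
        rw [iteratedDeriv_eq_iterate]
        exact hG.iterated_deriv j
      exact this.continuousAt.tendsto.mono_left nhdsWithin_le_nhds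
    refine hc.congr' ?_
    filter_upwards [hIoo] with s hs
    rw [← iteratedDeriv_mgf (hmem s hs)]
    refine Filter.EventuallyEq.iteratedDeriv_eq j ?_
    filter_upwards [isOpen_Ioo.mem_nhds hs] with t ht
    exact (hmgf t ht).symm
  have hint' : ∀ j, ∀ s ∈ Ioo 0 δ, Integrable (fun ω => Y ω ^ j * Real.exp (s * Y ω)) P :=
    fun j s hs => integrable_pow_mul_exp_of_mem_interior_integrableExpSet (hmem s hs) j
  -- Even powers are nonnegative, so Fatou's lemma turns the bounded limit of the tilted moments
  -- into integrability; other powers are dominated by even ones.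
  have heven : ∀ j, Even j → Integrable (fun ω => Y ω ^ j) P := by
    intro j hj
    have hseq : Tendsto (fun n : ℕ => 1 / ((n : ℝ) + 1)) atTop (𝓝[>] 0) :=
      tendsto_nhdsWithin_iff.mpr ⟨tendsto_one_div_add_atTop_nhds_zero_nat,
        Eventually.of_forall fun n => mem_Ioi.mpr (by positivity)⟩
    refine integrable_of_tendsto
      (G := fun n ω => Y ω ^ j * Real.exp (1 / ((n : ℝ) + 1) * Y ω)) ?_ ?_ ?_
    · refine ae_of_all _ fun ω => ?_
      have hc : Continuous (fun s : ℝ => Y ω ^ j * Real.exp (s * Y ω)) := by fun_prop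
      have := hc.tendsto 0
      simp only [zero_mul, Real.exp_zero, mul_one] at this
      exact (this.mono_left nhdsWithin_le_nhds).comp hseq
    · exact fun s => Measurable.aestronglyMeasurable (by fun_prop)
    · have h1 : Tendsto (fun s => ENNReal.ofReal (∫ ω, Y ω ^ j * Real.exp (s * Y ω) ∂P)) (𝓝[>] 0)
          (𝓝 (ENNReal.ofReal (iteratedDeriv j G 0))) :=
        (ENNReal.continuous_ofReal.tendsto _).comp (htend j)
      have h2 : (fun s => ∫⁻ ω, ‖Y ω ^ j * Real.exp (s * Y ω)‖ₑ ∂P) =ᶠ[𝓝[>] 0]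
          fun s => ENNReal.ofReal (∫ ω, Y ω ^ j * Real.exp (s * Y ω) ∂P) := by
        filter_upwards [hIoo] with s hs
        have hnn : ∀ ω, 0 ≤ Y ω ^ j * Real.exp (s * Y ω) := fun ω =>
          mul_nonneg (hj.pow_nonneg _) (Real.exp_pos _).le
        rw [ofReal_integral_eq_lintegral_ofReal (hint' j s hs) (ae_of_all _ hnn)]
        exact lintegral_congr fun ω => (Real.enorm_of_nonneg (hnn ω))
      have h3 := (h1.congr' h2.symm).comp hseq
      exact ne_of_eq_of_ne h3.liminf_eq ENNReal.ofReal_ne_top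
  have hall : Integrable (fun ω => |Y ω| ^ k) P := by
    have h2k := heven (2 * k) (even_two_mul k)
    refine ((integrable_const (1 : ℝ)).add h2k).mono'
      (Measurable.aestronglyMeasurable (by fun_prop)) (ae_of_all _ fun ω => ?_)
    simp only [Pi.add_apply, norm_pow, Real.norm_eq_abs, abs_abs]
    rw [pow_mul', ← sq_abs (Y ω ^ k), abs_pow]
    nlinarith [sq_nonneg (|Y ω| ^ k - 1)]
  have hk : Integrable (fun ω => Y ω ^ k) P :=
    hall.mono' (Measurable.aestronglyMeasurable (by fun_prop))
      (ae_of_all _ fun ω => by rw [norm_pow, Real.norm_eq_abs])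
  refine ⟨hk, tendsto_nhds_unique ?_ (htend k)⟩
  have hδ2 : δ / 2 ∈ Ioo 0 δ := ⟨by positivity, by linarith⟩
  refine tendsto_integral_filter_of_dominated_convergence
    (fun ω => |Y ω| ^ k + |Y ω ^ k * Real.exp (δ / 2 * Y ω)|)
    (Eventually.of_forall fun s => Measurable.aestronglyMeasurable (by fun_prop)) ?_
    (hall.add (hint' k _ hδ2).abs) (ae_of_all _ fun ω => ?_)
  · have : ∀ᶠ s in 𝓝[>] (0 : ℝ), s ∈ Ioo 0 (δ / 2) := Ioo_mem_nhdsGT (by positivity)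
    filter_upwards [this] with s hs
    refine ae_of_all _ fun ω => ?_
    rw [norm_mul, norm_pow, Real.norm_eq_abs, Real.norm_of_nonneg (Real.exp_pos _).le, abs_mul,
      abs_pow, abs_of_pos (Real.exp_pos _)]
    have hp : 0 ≤ |Y ω| ^ k := by positivity
    -- The constant 1 serves negative values of `Y`, the exponential positive ones.
    have he : Real.exp (s * Y ω) ≤ 1 + Real.exp (δ / 2 * Y ω) := by
      rcases le_total 0 (Y ω) with h | h
      · have : Real.exp (s * Y ω) ≤ Real.exp (δ / 2 * Y ω) :=
          Real.exp_le_exp.mpr (mul_le_mul_of_nonneg_right hs.2.le h)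
        linarith
      · have : Real.exp (s * Y ω) ≤ 1 :=
          Real.exp_le_one_iff.mpr (mul_nonpos_of_nonneg_of_nonpos hs.1.le h)
        linarith [Real.exp_pos (δ / 2 * Y ω)]
    nlinarith
  · have hc : Continuous (fun s : ℝ => Y ω ^ k * Real.exp (s * Y ω)) := by fun_prop
    have := hc.tendsto 0
    simp only [zero_mul, Real.exp_zero, mul_one] at this
    exact this.mono_left nhdsWithin_le_nhds

lemma measurable_sign : Measurable Real.sign :=
  Measurable.ite measurableSet_Iio measurable_const
    (Measurable.ite measurableSet_Ioi measurable_const measurable_const)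

lemma tendsto_sin_mul_div (a : ℝ) :
    Tendsto (fun s : ℝ => Real.sin (a * s) / s) (𝓝[>] 0) (𝓝 a) := by
  have h : HasDerivAt (fun s : ℝ => Real.sin (a * s)) a 0 := by
    have := ((hasDerivAt_id (0 : ℝ)).const_mul a).sin
    simpa using this
  have h2 := h.tendsto_slope_zero_right
  simpa [div_eq_inv_mul] using h2

section Law

variable {μ : Measure ℝ} [IsProbabilityMeasure μ] {ν θ τ : ℝ}

lemma Admissible.abs_le_one (hadm : Admissible ν θ) : |θ| ≤ 1 := hadm.2.trans (min_le_left _ _)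

lemma Admissible.sqrt_pos (hadm : Admissible ν θ) : 0 < √ν :=
  Real.sqrt_pos.mpr (by linarith [hadm.1])

lemma IsStrictlyStableLaw.integral_abs_rpow (hadm : Admissible ν θ)
    (hμ : IsStrictlyStableLaw μ ν θ τ) {s : ℝ} (h0 : 0 < s) (h1 : s < 1) (hs : s * √ν < 1) :
    ∫ x, |x| ^ s ∂μ = Real.exp (s * τ) * Real.exp (logCgf ν θ s) := by
  have h := (hμ.moments hadm h0 h1 hs).2.1
  have hcos : ∀ y : ℝ, |y| < 1 → 0 < Real.cos (Real.pi * y / 2) := by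
    intro y hy
    obtain ⟨h3, h4⟩ := abs_lt.mp hy
    apply Real.cos_pos_of_mem_Ioo
    constructor <;> nlinarith [Real.pi_pos]
  have hc1 := hcos s (by rwa [abs_of_pos h0])
  have hc2 := hcos (θ * s) (by
    rw [abs_mul, abs_of_pos h0]
    nlinarith [hadm.abs_le_one])
  have hg1 := Real.Gamma_pos_of_pos (show 0 < 1 - s * √ν by linarith)
  have hg2 := Real.Gamma_pos_of_pos (show 0 < 1 - s by linarith)
  rw [← eq_div_iff hc1.ne'] at h
  rw [h, logCgf, Real.exp_add, Real.exp_add, Real.exp_sub, Real.exp_sub, Real.exp_log hg1,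
    Real.exp_log hg2, Real.exp_log hc1, Real.exp_log hc2, mul_add, Real.exp_add]
  ring_nf

lemma analyticAt_logCgf (hadm : Admissible ν θ) :
    AnalyticAt ℝ (logCgf ν θ) 0 ∧
      ∀ j, iteratedDeriv j (logCgf ν θ) 0 = j.factorial * logCgfCoeff ν θ j := by
  refine analyticAt_and_iteratedDeriv_of_hasSum (r := min 1 (√ν)⁻¹)
    (lt_min one_pos (inv_pos.mpr hadm.sqrt_pos)) fun s hs => ?_
  obtain ⟨h1, h2⟩ := lt_min_iff.mp hs
  refine hasSum_logCgf hadm.abs_le_one h1 ?_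
  rw [abs_mul, abs_of_pos hadm.sqrt_pos]
  rwa [← one_div, lt_div_iff₀ hadm.sqrt_pos] at h2

/-- Limits of fractional moments at exponent zero. -/
lemma tendsto_integral_mul_abs_rpow {f : ℝ → ℝ} (hf : Measurable f) (hf1 : ∀ x, |f x| ≤ 1)
    {δ : ℝ} (hδ : 0 < δ) (hint : Integrable (fun x : ℝ => |x| ^ δ) μ) :
    Tendsto (fun s : ℝ => ∫ x, f x * |x| ^ s ∂μ) (𝓝[>] 0)
      (𝓝 (∫ x, f x * (if x = 0 then 0 else 1) ∂μ)) := by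
  have hIoo : ∀ᶠ s in 𝓝[>] (0 : ℝ), s ∈ Ioo 0 δ := Ioo_mem_nhdsGT hδ
  refine tendsto_integral_filter_of_dominated_convergence (fun x => 1 + |x| ^ δ) ?_ ?_
    ((integrable_const 1).add hint) (ae_of_all _ fun x => ?_)
  · exact Eventually.of_forall fun s => Measurable.aestronglyMeasurable (by fun_prop)
  · filter_upwards [hIoo] with s hs
    refine ae_of_all _ fun x => ?_
    have hp : 0 ≤ |x| ^ s := by positivity
    rw [norm_mul, Real.norm_eq_abs, Real.norm_of_nonneg hp]
    refine (mul_le_of_le_one_left hp (hf1 x)).trans ?_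
    rcases le_total |x| 1 with h | h
    · have h1 := Real.rpow_le_one (abs_nonneg x) h hs.1.le
      have h2 : 0 ≤ |x| ^ δ := by positivity
      linarith
    · have := Real.rpow_le_rpow_of_exponent_le h hs.2.le
      linarith
  · refine Tendsto.const_mul _ ?_
    split_ifs with hx
    · refine tendsto_const_nhds.congr' ?_
      filter_upwards [hIoo] with s hs
      rw [hx, abs_zero, Real.zero_rpow hs.1.ne']
    · have h := (Real.continuousAt_const_rpow (a := |x|) (b := 0) (abs_ne_zero.mpr hx)).tendsto
      rw [Real.rpow_zero] at h
      exact h.mono_left nhdsWithin_le_nhds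

lemma Admissible.exists_pos_lt (hadm : Admissible ν θ) :
    ∃ δ : ℝ, 0 < δ ∧ ∀ s ∈ Ioc 0 δ, s < 1 ∧ s * √ν < 1 := by
  have hβ := hadm.sqrt_pos
  refine ⟨1 / (2 * (1 + √ν)), by positivity, fun s hs => ?_⟩
  have h := hs.2
  rw [le_div_iff₀ (by positivity)] at h
  constructor <;> nlinarith [hs.1, mul_pos hs.1 hβ]

/-- As `0^s = 0` for `s > 0`, the limit of `E|X|^s` at `0+` is `P(X ≠ 0)`; the explicit formula
tends to 1. -/
lemma IsStrictlyStableLaw.measure_zero (hadm : Admissible ν θ)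
    (hμ : IsStrictlyStableLaw μ ν θ τ) : ∀ᵐ x ∂μ, x ≠ 0 := by
  obtain ⟨δ, hδ, hlt⟩ := hadm.exists_pos_lt
  have hIoo : ∀ᶠ s in 𝓝[>] (0 : ℝ), s ∈ Ioo 0 δ := Ioo_mem_nhdsGT hδ
  obtain ⟨h1, h2⟩ := hlt δ ⟨hδ, le_rfl⟩
  have hL := tendsto_integral_mul_abs_rpow (μ := μ) (f := fun _ => 1) measurable_const (by simp) hδ
    (hμ.moments hadm hδ h1 h2).1
  simp only [one_mul] at hL
  have hR : Tendsto (fun s => Real.exp (s * τ) * Real.exp (logCgf ν θ s)) (𝓝[>] 0) (𝓝 1) := by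
    have hc : ContinuousAt (fun s => Real.exp (s * τ) * Real.exp (logCgf ν θ s)) 0 := by
      have := (analyticAt_logCgf hadm).1.continuousAt
      fun_prop
    have h0 : logCgf ν θ 0 = 0 := by simp [logCgf]
    have := hc.tendsto
    simp only [zero_mul, h0, Real.exp_zero, mul_one] at this
    exact this.mono_left nhdsWithin_le_nhds
  have heq : ∫ x, (if x = 0 then 0 else 1 : ℝ) ∂μ = 1 := by
    refine tendsto_nhds_unique hL (hR.congr' ?_)
    filter_upwards [hIoo] with s hs
    obtain ⟨h3, h4⟩ := hlt s ⟨hs.1, hs.2.le⟩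
    rw [hμ.integral_abs_rpow hadm hs.1 h3 h4]
  have h5 : (fun x : ℝ => (if x = 0 then 0 else 1 : ℝ)) = ({0}ᶜ : Set ℝ).indicator 1 := by
    funext x
    by_cases hx : x = 0 <;> simp [hx]
  rw [h5, integral_indicator_one (measurableSet_singleton 0).compl,
    probReal_compl_eq_one_sub (measurableSet_singleton 0)] at heq
  have h6 : μ {0} = 0 := by
    rw [← measureReal_eq_zero_iff]
    linarith
  exact measure_eq_zero_iff_ae_notMem.mp h6

/-- Let `s` tend to `0+` in the signed moment: the Gamma quotient tends to 1 and `sin(πθs/2) /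
sin(πs/2)` to `θ`. -/
lemma IsStrictlyStableLaw.integral_sign (hadm : Admissible ν θ)
    (hμ : IsStrictlyStableLaw μ ν θ τ) : ∫ x, Real.sign x ∂μ = θ := by
  obtain ⟨δ, hδ, hlt⟩ := hadm.exists_pos_lt
  have hIoo : ∀ᶠ s in 𝓝[>] (0 : ℝ), s ∈ Ioo 0 δ := Ioo_mem_nhdsGT hδ
  obtain ⟨h1, h2⟩ := hlt δ ⟨hδ, le_rfl⟩
  have hL := tendsto_integral_mul_abs_rpow (μ := μ) measurable_sign
    (fun x => by rcases Real.sign_apply_eq x with h | h | h <;> simp [h]) hδ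
    (hμ.moments hadm hδ h1 h2).1
  have hs0 : ∀ x : ℝ, Real.sign x * (if x = 0 then 0 else 1) = Real.sign x := by
    intro x
    by_cases hx : x = 0 <;> simp [hx]
  simp_rw [hs0] at hL
  refine tendsto_nhds_unique hL ?_
  have hA : Tendsto (fun s => Real.exp (s * (τ + Real.eulerMascheroniConstant * (1 - √ν)))
      * (Real.Gamma (1 - s * √ν) / Real.Gamma (1 - s))) (𝓝[>] 0) (𝓝 1) := by
    have hc : ContinuousAt (fun s => Real.exp (s * (τ + Real.eulerMascheroniConstant * (1 - √ν)))
      * (Real.Gamma (1 - s * √ν) / Real.Gamma (1 - s))) 0 := by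
      have hg : ContinuousAt Real.Gamma 1 := (Real.differentiableAt_Gamma (by
        intro m h
        have : (0 : ℝ) ≤ m := m.cast_nonneg
        linarith)).continuousAt
      refine ContinuousAt.mul (by fun_prop) (ContinuousAt.div ?_ ?_ (by simp))
      · exact ContinuousAt.comp (x := (0 : ℝ)) (g := Real.Gamma) (f := fun s : ℝ => 1 - s * √ν) (by simpa using hg) (by fun_prop)
      · exact ContinuousAt.comp (x := (0 : ℝ)) (g := Real.Gamma) (f := fun s : ℝ => 1 - s) (by simpa using hg) (by fun_prop)
    have := hc.tendsto
    simp only [zero_mul, Real.exp_zero, sub_zero, Real.Gamma_one, div_one, mul_one] at this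
    exact this.mono_left nhdsWithin_le_nhds
  have hpi := Real.pi_ne_zero
  have hB := (tendsto_sin_mul_div (Real.pi * θ / 2)).div (tendsto_sin_mul_div (Real.pi / 2))
    (by positivity)
  have hAB := hA.mul hB
  rw [one_mul, show Real.pi * θ / 2 / (Real.pi / 2) = θ by field_simp] at hAB
  refine hAB.congr' ?_
  filter_upwards [hIoo] with s hs
  obtain ⟨h3, h4⟩ := hlt s ⟨hs.1, hs.2.le⟩
  have hm := (hμ.moments hadm hs.1 h3 h4).2.2
  have hsin : Real.sin (Real.pi * s / 2) ≠ 0 := by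
    refine (Real.sin_pos_of_pos_of_lt_pi ?_ ?_).ne' <;> nlinarith [hs.1, Real.pi_pos]
  rw [← eq_div_iff hsin] at hm
  rw [hm, Pi.div_apply, show Real.pi * θ / 2 * s = Real.pi * (θ * s) / 2 by ring,
    show Real.pi / 2 * s = Real.pi * s / 2 by ring, div_div_div_cancel_right₀ hs.1.ne']
  ring

lemma logCgfCoeff_two (hν : 0 ≤ ν) : (Nat.factorial 2 : ℝ) * logCgfCoeff ν θ 2 = DV ν θ := by
  rw [logCgfCoeff, if_neg (by norm_num), zetaR_two, Real.sq_sqrt hν, DV]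
  norm_num [Nat.factorial]
  ring

lemma sqrt_pow_even (hν : 0 ≤ ν) (k : ℕ) : √ν ^ (2 * k) = ν ^ k := by
  rw [pow_mul, Real.sq_sqrt hν]

lemma sqrt_pow_eq_rpow (hν : 0 ≤ ν) (k : ℕ) : √ν ^ k = ν ^ ((k : ℝ) / 2) := by
  rw [Real.sqrt_eq_rpow, ← Real.rpow_natCast, ← Real.rpow_mul hν]
  ring_nf

/-- For odd index the factor `(1/2)^j + (-1/2)^j - 1 - (-1)^j` vanishes, so odd cumulants do not
involve `θ`. -/
lemma logCgfCoeff_three (hν : 0 ≤ ν) :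
    (Nat.factorial 3 : ℝ) * logCgfCoeff ν θ 3 = 2 * z3 ν := by
  rw [logCgfCoeff, if_neg (by norm_num), z3, sqrt_pow_eq_rpow hν]
  norm_num [Nat.factorial]
  ring

lemma logCgfCoeff_four (hν : 0 ≤ ν) :
    (Nat.factorial 4 : ℝ) * logCgfCoeff ν θ 4 = Real.pi ^ 4 * q4 ν θ := by
  rw [logCgfCoeff, if_neg (by norm_num), zetaR_four, sqrt_pow_even hν 2, q4]
  norm_num [Nat.factorial]
  ring

lemma logCgfCoeff_five (hν : 0 ≤ ν) :
    (Nat.factorial 5 : ℝ) * logCgfCoeff ν θ 5 = 24 * z5 ν := by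
  rw [logCgfCoeff, if_neg (by norm_num), z5, sqrt_pow_eq_rpow hν]
  norm_num [Nat.factorial]
  ring

lemma logCgfCoeff_six (hν : 0 ≤ ν) :
    (Nat.factorial 6 : ℝ) * logCgfCoeff ν θ 6 = 8 * Real.pi ^ 6 * q6 ν θ := by
  rw [logCgfCoeff, if_neg (by norm_num), zetaR_six, sqrt_pow_even hν 3, q6]
  norm_num [Nat.factorial]
  ring

lemma logCgfCoeff_eight (hν : 0 ≤ ν) :
    (Nat.factorial 8 : ℝ) * logCgfCoeff ν θ 8 = 8 * Real.pi ^ 8 * q8 ν θ := by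
  rw [logCgfCoeff, if_neg (by norm_num), zetaR_eight, sqrt_pow_even hν 4, q8]
  norm_num [Nat.factorial]
  ring

/-- The logarithmic moments of a strictly stable law. -/
theorem IsStrictlyStableLaw.log_moments (hadm : Admissible ν θ)
    (hμ : IsStrictlyStableLaw μ ν θ τ) :
    ∃ m : ℕ → ℝ, (∀ k, Integrable (fun x => (Real.log |x| - τ) ^ k) μ ∧
        ∫ x, (Real.log |x| - τ) ^ k ∂μ = m k) ∧
      m 1 = 0 ∧ m 2 = DV ν θ ∧ m 3 = 2 * z3 ν ∧
      m 4 = Real.pi ^ 4 * q4 ν θ + 3 * DV ν θ ^ 2 ∧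
      m 5 = 24 * z5 ν + 10 * (2 * z3 ν) * DV ν θ ∧
      m 6 = 8 * Real.pi ^ 6 * q6 ν θ + 15 * (Real.pi ^ 4 * q4 ν θ) * DV ν θ
        + 10 * (2 * z3 ν) ^ 2 + 15 * DV ν θ ^ 3 ∧
      m 8 = 8 * Real.pi ^ 8 * q8 ν θ + 28 * (8 * Real.pi ^ 6 * q6 ν θ) * DV ν θ
        + 56 * (24 * z5 ν) * (2 * z3 ν) + 35 * (Real.pi ^ 4 * q4 ν θ) ^ 2
        + 210 * (Real.pi ^ 4 * q4 ν θ) * DV ν θ ^ 2 + 280 * (2 * z3 ν) ^ 2 * DV ν θ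
        + 105 * DV ν θ ^ 4 := by
  have hν : 0 ≤ ν := by linarith [hadm.1]
  obtain ⟨δ, hδ, hlt⟩ := hadm.exists_pos_lt
  obtain ⟨hK, hKd⟩ := analyticAt_logCgf hadm
  have hae := hμ.measure_zero hadm
  -- This can fail at `x = 0`, where the logarithm takes the default value 0; that point has measure
  -- zero.
  have hexp : ∀ s : ℝ, (fun x : ℝ => |x| ^ s * Real.exp (-(s * τ)))
      =ᵐ[μ] fun x => Real.exp (s * (Real.log |x| - τ)) := by
    intro s
    filter_upwards [hae] with x hx
    rw [Real.rpow_def_of_pos (abs_pos.mpr hx), ← Real.exp_add]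
    ring_nf
  have hY : Measurable (fun x : ℝ => Real.log |x| - τ) := by fun_prop
  have hmom := integrable_pow_and_integral_of_mgf_right (P := μ) hY
    (G := fun s => Real.exp (logCgf ν θ s)) hK.rexp hδ
    (fun s hs => by
      obtain ⟨h3, h4⟩ := hlt s ⟨hs.1, hs.2.le⟩
      exact ((hμ.moments hadm hs.1 h3 h4).1.mul_const _).congr (hexp s))
    (fun s hs => by
      obtain ⟨h3, h4⟩ := hlt s ⟨hs.1, hs.2.le⟩
      rw [mgf, ← integral_congr_ae (hexp s), integral_mul_const,
        hμ.integral_abs_rpow hadm hs.1 h3 h4, mul_right_comm, ← Real.exp_add, add_neg_cancel,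
        Real.exp_zero, one_mul])
  refine ⟨fun k => iteratedDeriv k (fun s => Real.exp (logCgf ν θ s)) 0, hmom, ?_⟩
  have h0 : iteratedDeriv 0 (fun s => Real.exp (logCgf ν θ s)) 0 = 1 := by
    simp [iteratedDeriv_zero, logCgf]
  have hκ1 : iteratedDeriv 1 (logCgf ν θ) 0 = 0 := by rw [hKd]; simp [logCgfCoeff]
  have := moments_of_cumulants
    (m := fun k => iteratedDeriv k (fun s => Real.exp (logCgf ν θ s)) 0)
    (κ := fun k => iteratedDeriv k (logCgf ν θ) 0) h0 hκ1
    (fun k => iteratedDeriv_exp_comp_succ hK k)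
  simp only [hKd] at this
  rwa [logCgfCoeff_two hν, logCgfCoeff_three hν, logCgfCoeff_four hν, logCgfCoeff_five hν,
    logCgfCoeff_six hν, logCgfCoeff_eight hν] at this

end Law

end StableEst

/-! ### Polynomial inequalities for the sign corrections, and inequalities between fourth powers. -/

namespace StableEst

/-- The correction term in the fourth central moment of the sample variance of signs with mean `θ`,
where `t = θ ^ 2` and `w = 1 / (n - 1)`. -/
def quarticSign (w t : ℝ) : ℝ :=
  240 * t - 1136 * t ^ 2 + 1616 * t ^ 3 - 720 * t ^ 4
    + w * (60 - 1152 * t + 3864 * t ^ 2 - 4512 * t ^ 3 + 1740 * t ^ 4)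
    + w ^ 2 * (-132 + 1744 * t - 4952 * t ^ 2 + 5200 * t ^ 3 - 1860 * t ^ 4)
    + w ^ 3 * (80 - 832 * t + 2144 * t ^ 2 - 2112 * t ^ 3 + 720 * t ^ 4)

/-- The quantity `P1` as a polynomial in `w = 1 / (n - 1)` and `t = θ ^ 2`. -/
def quarticP1 (w t : ℝ) : ℝ :=
  16 * (15 * t - 71 * t ^ 2 + 26 * t ^ 3 - 45 * t ^ 4)
    + 12 * w * (5 - 96 * t + 302 * t ^ 2 - 356 * t ^ 3 + 155 * t ^ 4)
    + 4 * w ^ 2 * (-33 + 436 * t - 1238 * t ^ 2 + 1300 * t ^ 3 - 465 * t ^ 4)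
    + 16 * w ^ 3 * (5 - 52 * t + 134 * t ^ 2 - 132 * t ^ 3 + 45 * t ^ 4)

lemma P1_eq_quarticP1 (n : ℕ) (θ : ℝ) : P1 n θ = quarticP1 (1 / ((n : ℝ) - 1)) (θ ^ 2) := by
  simp only [P1, quarticP1, div_eq_mul_inv, one_mul, ← inv_pow]
  generalize ((n : ℝ) - 1)⁻¹ = w
  ring

/-- The certificate `key` is the difference of the two sides in Bernstein form, of degree 4 in `t`
on `[9/25, 1]` and degree 3 in `w` on `[0, 1]`; all coefficients are positive. The factor 8 is the
one lost in `rpow_quarter_add_le`. The next lemmas use certificates of the same kind. -/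
lemma eight_mul_quarticSign_add_le {t w : ℝ} (h1 : 9 / 25 ≤ t) (h2 : t ≤ 1) (hw0 : 0 ≤ w) (hw1 : w ≤ 1) :
    8 * (quarticSign w t + (1 - t) * (w * (1 + w) ^ 2)) ≤ -quarticP1 w t := by
  obtain ⟨a, ha⟩ : ∃ a, a = t - 9 / 25 := ⟨_, rfl⟩
  obtain ⟨b, hb⟩ : ∃ b, b = 1 - t := ⟨_, rfl⟩
  obtain ⟨v, hv⟩ : ∃ v, v = 1 - w := ⟨_, rfl⟩
  obtain ⟨c, hc⟩ : ∃ c, c = w := ⟨_, rfl⟩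
  have hc0 : 0 ≤ c := by linarith
  have ha0 : 0 ≤ a := by linarith
  have hb0 : 0 ≤ b := by linarith
  have hv0 : 0 ≤ v := by linarith
  have key : 0 ≤ (822555 / 4096) * b ^ 4 * v ^ 3 + (21041795 / 8192) * b ^ 4 * c * v ^ 2
       + (1973585 / 2048) * b ^ 4 * c ^ 2 * v + (597095 / 8192) * b ^ 4 * c ^ 3
       + (5597775 / 1024) * a * b ^ 3 * v ^ 3 + (36101175 / 2048) * a * b ^ 3 * c * v ^ 2
       + (4952175 / 512) * a * b ^ 3 * c ^ 2 * v + (5313975 / 2048) * a * b ^ 3 * c ^ 3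
       + (35375625 / 2048) * a ^ 2 * b ^ 2 * v ^ 3
       + (146930625 / 4096) * a ^ 2 * b ^ 2 * c * v ^ 2
       + (31734375 / 1024) * a ^ 2 * b ^ 2 * c ^ 2 * v
       + (38863125 / 4096) * a ^ 2 * b ^ 2 * c ^ 3 + (12984375 / 1024) * a ^ 3 * b * v ^ 3
       + (77609375 / 2048) * a ^ 3 * b * c * v ^ 2 + (19296875 / 512) * a ^ 3 * b * c ^ 2 * v
       + (25484375 / 2048) * a ^ 3 * b * c ^ 3 + (29296875 / 4096) * a ^ 4 * v ^ 3
       + (169921875 / 8192) * a ^ 4 * c * v ^ 2 + (41015625 / 2048) * a ^ 4 * c ^ 2 * v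
       + (52734375 / 8192) * a ^ 4 * c ^ 3 := by
    positivity
  subst ha hb hv hc
  simp only [quarticSign, quarticP1]
  linarith

/-- Needed where `quarticSign` is negative and is replaced by 0 before a fourth root is taken. -/
lemma eight_mul_le_neg_quarticP1 {t w : ℝ} (h1 : 9 / 25 ≤ t) (h2 : t ≤ 1) (hw0 : 0 ≤ w) (hw1 : w ≤ 1) :
    8 * ((1 - t) * (w * (1 + w) ^ 2)) ≤ -quarticP1 w t := by
  obtain ⟨a, ha⟩ : ∃ a, a = t - 9 / 25 := ⟨_, rfl⟩
  obtain ⟨b, hb⟩ : ∃ b, b = 1 - t := ⟨_, rfl⟩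
  obtain ⟨v, hv⟩ : ∃ v, v = 1 - w := ⟨_, rfl⟩
  obtain ⟨c, hc⟩ : ∃ c, c = w := ⟨_, rfl⟩
  have hc0 : 0 ≤ c := by linarith
  have ha0 : 0 ≤ a := by linarith
  have hb0 : 0 ≤ b := by linarith
  have hv0 : 0 ≤ v := by linarith
  have key : 0 ≤ (1306395 / 4096) * b ^ 4 * v ^ 3 + (10182275 / 8192) * b ^ 4 * c * v ^ 2
       + (2207825 / 2048) * b ^ 4 * c ^ 2 * v + (2383975 / 8192) * b ^ 4 * c ^ 3
       + (3456975 / 1024) * a * b ^ 3 * v ^ 3 + (22027575 / 2048) * a * b ^ 3 * c * v ^ 2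
       + (5222575 / 512) * a * b ^ 3 * c ^ 2 * v + (6766775 / 2048) * a * b ^ 3 * c ^ 3
       + (23055625 / 2048) * a ^ 2 * b ^ 2 * v ^ 3
       + (134450625 / 4096) * a ^ 2 * b ^ 2 * c * v ^ 2
       + (33734375 / 1024) * a ^ 2 * b ^ 2 * c ^ 2 * v
       + (44943125 / 4096) * a ^ 2 * b ^ 2 * c ^ 3 + (14984375 / 1024) * a ^ 3 * b * v ^ 3
       + (89609375 / 2048) * a ^ 3 * b * c * v ^ 2 + (22296875 / 512) * a ^ 3 * b * c ^ 2 * v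
       + (29484375 / 2048) * a ^ 3 * b * c ^ 3 + (29296875 / 4096) * a ^ 4 * v ^ 3
       + (169921875 / 8192) * a ^ 4 * c * v ^ 2 + (41015625 / 2048) * a ^ 4 * c ^ 2 * v
       + (52734375 / 8192) * a ^ 4 * c ^ 3 := by
    positivity
  subst ha hb hv hc
  simp only [quarticP1]
  linarith

lemma quarticSign_le {t w : ℝ} (h1 : 0 ≤ t) (h2 : t ≤ 9 / 25) (hw0 : 0 ≤ w) (hw1 : w ≤ 1) :
    quarticSign w t ≤ 24 := by
  obtain ⟨a, ha⟩ : ∃ a, a = t := ⟨_, rfl⟩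
  obtain ⟨b, hb⟩ : ∃ b, b = 9 / 25 - t := ⟨_, rfl⟩
  obtain ⟨v, hv⟩ : ∃ v, v = 1 - w := ⟨_, rfl⟩
  obtain ⟨c, hc⟩ : ∃ c, c = w := ⟨_, rfl⟩
  have hc0 : 0 ≤ c := by linarith
  have ha0 : 0 ≤ a := by linarith
  have hb0 : 0 ≤ b := by linarith
  have hv0 : 0 ≤ v := by linarith
  have key : 0 ≤ (3125000 / 2187) * b ^ 4 * v ^ 3 + (1562500 / 2187) * b ^ 4 * c * v ^ 2
       + (10937500 / 2187) * b ^ 4 * c ^ 2 * v + (6250000 / 6561) * b ^ 4 * c ^ 3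
       + (1250000 / 2187) * a * b ^ 3 * v ^ 3 + (26500000 / 2187) * a * b ^ 3 * c * v ^ 2
       + (36250000 / 2187) * a * b ^ 3 * c ^ 2 * v + (25000000 / 6561) * a * b ^ 3 * c ^ 3
       + (1390000 / 729) * a ^ 2 * b ^ 2 * v ^ 3 + (20810000 / 729) * a ^ 2 * b ^ 2 * c * v ^ 2
       + (17930000 / 729) * a ^ 2 * b ^ 2 * c ^ 2 * v + (13850000 / 2187) * a ^ 2 * b ^ 2 * c ^ 3
       + (7272800 / 2187) * a ^ 3 * b * v ^ 3 + (49568800 / 2187) * a ^ 3 * b * c * v ^ 2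
       + (36359200 / 2187) * a ^ 3 * b * c ^ 2 * v + (29600800 / 6561) * a ^ 3 * b * c ^ 3
       + (2802440 / 2187) * a ^ 4 * v ^ 3 + (12994840 / 2187) * a ^ 4 * c * v ^ 2
       + (9062680 / 2187) * a ^ 4 * c ^ 2 * v + (7588120 / 6561) * a ^ 4 * c ^ 3 := by
    positivity
  subst ha hb hv hc
  simp only [quarticSign]
  linarith

lemma mul_quarticSign_le_of_le_half {t w : ℝ} (h1 : 0 ≤ t) (h2 : t ≤ 9 / 25) (hw0 : 0 ≤ w) (hw1 : w ≤ 1 / 2) :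
    w * quarticSign w t ≤ 83 / 20 * (1 + w) := by
  obtain ⟨a, ha⟩ : ∃ a, a = t := ⟨_, rfl⟩
  obtain ⟨b, hb⟩ : ∃ b, b = 9 / 25 - t := ⟨_, rfl⟩
  obtain ⟨v, hv⟩ : ∃ v, v = 1 / 2 - w := ⟨_, rfl⟩
  obtain ⟨c, hc⟩ : ∃ c, c = w := ⟨_, rfl⟩
  have hc0 : 0 ≤ c := by linarith
  have ha0 : 0 ≤ a := by linarith
  have hb0 : 0 ≤ b := by linarith
  have hv0 : 0 ≤ v := by linarith
  have key : 0 ≤ (25937500 / 6561) * b ^ 4 * v ^ 4 + (12968750 / 729) * b ^ 4 * c * v ^ 3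
       + (33593750 / 2187) * b ^ 4 * c ^ 2 * v ^ 2 + (58281250 / 6561) * b ^ 4 * c ^ 3 * v
       + (17031250 / 6561) * b ^ 4 * c ^ 4 + (103750000 / 6561) * a * b ^ 3 * v ^ 4
       + (21875000 / 729) * a * b ^ 3 * c * v ^ 3 + (80375000 / 2187) * a * b ^ 3 * c ^ 2 * v ^ 2
       + (228625000 / 6561) * a * b ^ 3 * c ^ 3 * v + (72625000 / 6561) * a * b ^ 3 * c ^ 4
       + (51875000 / 2187) * a ^ 2 * b ^ 2 * v ^ 4 + (12977500 / 243) * a ^ 2 * b ^ 2 * c * v ^ 3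
       + (79607500 / 729) * a ^ 2 * b ^ 2 * c ^ 2 * v ^ 2
       + (217632500 / 2187) * a ^ 2 * b ^ 2 * c ^ 3 * v
       + (62052500 / 2187) * a ^ 2 * b ^ 2 * c ^ 4 + (103750000 / 6561) * a ^ 3 * b * v ^ 4
       + (37935800 / 729) * a ^ 3 * b * c * v ^ 3
       + (244923800 / 2187) * a ^ 3 * b * c ^ 2 * v ^ 2
       + (614516200 / 6561) * a ^ 3 * b * c ^ 3 * v + (164828200 / 6561) * a ^ 3 * b * c ^ 4
       + (25937500 / 6561) * a ^ 4 * v ^ 4 + (12108590 / 729) * a ^ 4 * c * v ^ 3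
       + (75452390 / 2187) * a ^ 4 * c ^ 2 * v ^ 2 + (178414330 / 6561) * a ^ 4 * c ^ 3 * v
       + (46074250 / 6561) * a ^ 4 * c ^ 4 := by
    positivity
  subst ha hb hv hc
  simp only [quarticSign]
  linarith

lemma mul_quarticSign_le_of_half_le {t w : ℝ} (h1 : 0 ≤ t) (h2 : t ≤ 9 / 25) (hw0 : 1 / 2 ≤ w) (hw1 : w ≤ 1) :
    w * quarticSign w t ≤ 83 / 20 * (1 + w) := by
  obtain ⟨a, ha⟩ : ∃ a, a = t := ⟨_, rfl⟩
  obtain ⟨b, hb⟩ : ∃ b, b = 9 / 25 - t := ⟨_, rfl⟩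
  obtain ⟨v, hv⟩ : ∃ v, v = 1 - w := ⟨_, rfl⟩
  obtain ⟨c, hc⟩ : ∃ c, c = w - 1 / 2 := ⟨_, rfl⟩
  have hc0 : 0 ≤ c := by linarith
  have ha0 : 0 ≤ a := by linarith
  have hb0 : 0 ≤ b := by linarith
  have hv0 : 0 ≤ v := by linarith
  have key : 0 ≤ (17031250 / 6561) * b ^ 4 * v ^ 4 + (77968750 / 6561) * b ^ 4 * c * v ^ 3
       + (53281250 / 2187) * b ^ 4 * c ^ 2 * v ^ 2 + (132031250 / 6561) * b ^ 4 * c ^ 3 * v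
       + (625000 / 2187) * b ^ 4 * c ^ 4 + (72625000 / 6561) * a * b ^ 3 * v ^ 4
       + (352375000 / 6561) * a * b ^ 3 * c * v ^ 3
       + (204125000 / 2187) * a * b ^ 3 * c ^ 2 * v ^ 2
       + (348125000 / 6561) * a * b ^ 3 * c ^ 3 * v + (2500000 / 2187) * a * b ^ 3 * c ^ 4
       + (62052500 / 2187) * a ^ 2 * b ^ 2 * v ^ 4
       + (278787500 / 2187) * a ^ 2 * b ^ 2 * c * v ^ 3
       + (140762500 / 729) * a ^ 2 * b ^ 2 * c ^ 2 * v ^ 2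
       + (212582500 / 2187) * a ^ 2 * b ^ 2 * c ^ 3 * v + (8450000 / 729) * a ^ 2 * b ^ 2 * c ^ 4
       + (164828200 / 6561) * a ^ 3 * b * v ^ 4 + (704109400 / 6561) * a ^ 3 * b * c * v ^ 3
       + (334517000 / 2187) * a ^ 3 * b * c ^ 2 * v ^ 2
       + (497971400 / 6561) * a ^ 3 * b * c ^ 3 * v + (27037600 / 2187) * a ^ 3 * b * c ^ 4
       + (46074250 / 6561) * a ^ 4 * v ^ 4 + (190179670 / 6561) * a ^ 4 * c * v ^ 3
       + (87217730 / 2187) * a ^ 4 * c ^ 2 * v ^ 2 + (129855410 / 6561) * a ^ 4 * c ^ 3 * v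
       + (7761640 / 2187) * a ^ 4 * c ^ 4 := by
    positivity
  subst ha hb hv hc
  simp only [quarticSign]
  linarith

/-- With `w = 1/(n-1)` one has `1 + w = w n`, so this says `quarticSign / n ≤ 83/20`. Each half of
the range of `w` has its own certificate. -/
lemma mul_quarticSign_le {t w : ℝ} (h1 : 0 ≤ t) (h2 : t ≤ 9 / 25) (hw0 : 0 ≤ w) (hw1 : w ≤ 1) :
    w * quarticSign w t ≤ 83 / 20 * (1 + w) := by
  rcases le_total w (1 / 2) with h | h
  · exact mul_quarticSign_le_of_le_half h1 h2 hw0 h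
  · exact mul_quarticSign_le_of_half_le h1 h2 h hw1

lemma rpow_quarter_pow {x : ℝ} (hx : 0 ≤ x) : (x ^ (1 / 4 : ℝ)) ^ 4 = x := by
  rw [← Real.rpow_natCast, ← Real.rpow_mul hx]
  norm_num

/-- Power means: `(a + b)⁴ ≤ 8(a⁴ + b⁴)`. -/
lemma rpow_quarter_add_le {x y z : ℝ} (hx : 0 ≤ x) (hy : 0 ≤ y) (h : 8 * (x + y) ≤ z) :
    x ^ (1 / 4 : ℝ) + y ^ (1 / 4 : ℝ) ≤ z ^ (1 / 4 : ℝ) := by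
  have hz : 0 ≤ z := by linarith
  refine le_of_pow_le_pow_left₀ (n := 4) (by norm_num) (by positivity) ?_
  rw [rpow_quarter_pow hz]
  refine le_trans ?_ h
  have := add_pow_le (a := x ^ (1 / 4 : ℝ)) (b := y ^ (1 / 4 : ℝ)) (by positivity)
    (by positivity) 4
  rw [rpow_quarter_pow hx, rpow_quarter_pow hy] at this
  norm_num at this ⊢
  linarith

/-- The cross terms of `(X + Y)⁴` leave room to subtract `Z`. After the shift all coefficients of
the difference are nonnegative; the one of `Z⁴` is `1.6⁴ - 1.1⁴ - 1.5⁴`, barely positive. -/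
lemma pow_four_add_pow_four_le {X Y Z : ℝ} (hZ : 0 ≤ Z) (hX : 11 / 10 * Z ≤ X)
    (hY : 3 / 2 * Z ≤ Y) : X ^ 4 + Y ^ 4 ≤ (X + Y - Z) ^ 4 := by
  obtain ⟨x, hx, rfl⟩ : ∃ x, 0 ≤ x ∧ X = 11 / 10 * Z + x := ⟨X - 11 / 10 * Z, by linarith, by ring⟩
  obtain ⟨y, hy, rfl⟩ : ∃ y, 0 ≤ y ∧ Y = 3 / 2 * Z + y := ⟨Y - 3 / 2 * Z, by linarith, by ring⟩
  nlinarith [mul_nonneg (pow_nonneg hZ 3) hx, mul_nonneg (pow_nonneg hZ 3) hy,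
    mul_nonneg (pow_nonneg hZ 2) (pow_nonneg hx 2), mul_nonneg (pow_nonneg hZ 2) (mul_nonneg hx hy),
    mul_nonneg (pow_nonneg hZ 2) (pow_nonneg hy 2), mul_nonneg hZ (pow_nonneg hx 3),
    mul_nonneg hZ (mul_nonneg (pow_nonneg hx 2) hy), mul_nonneg hZ (mul_nonneg hx (pow_nonneg hy 2)),
    mul_nonneg hZ (pow_nonneg hy 3), mul_nonneg (pow_nonneg hx 3) hy,
    mul_nonneg (pow_nonneg hx 2) (pow_nonneg hy 2), mul_nonneg hx (pow_nonneg hy 3),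
    pow_nonneg hZ 4]

/-! ### Lower bounds for the variance and cumulant parameters on the admissible set. -/

section Parameters

variable {ν θ : ℝ}

/-- An admissible pair is bounded below by a boundary pair, `ν ≥ s ^ 2` with `|θ| = 2 s - 1`. -/
lemma Admissible.exists_boundary (hadm : Admissible ν θ) :
    ∃ s : ℝ, 1 / 2 ≤ s ∧ s ≤ 1 ∧ s ^ 2 ≤ ν ∧ |θ| = 2 * s - 1 := by
  have h1 := hadm.abs_le_one
  have h2 := hadm.2.trans (min_le_right _ _)
  have h3 := abs_nonneg θ
  have hν : 0 ≤ ν := by linarith [hadm.1]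
  refine ⟨(1 + |θ|) / 2, by linarith, by linarith, ?_, by ring⟩
  calc ((1 + |θ|) / 2) ^ 2 ≤ √ν ^ 2 := pow_le_pow_left₀ (by positivity) (by linarith) 2
    _ = ν := Real.sq_sqrt hν

/-- `DV` in units of `π ^ 2`. -/
noncomputable def dv (ν θ : ℝ) : ℝ := (1 - θ ^ 2) / 4 + (ν - 1) / 6

lemma DV_eq (ν θ : ℝ) : DV ν θ = Real.pi ^ 2 * dv ν θ := by
  rw [DV, dv]
  ring

/-- All four quantities increase with `ν`, so their least values are on the boundary `ν = s²`, `|θ|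
= 2s - 1`, where they are polynomials in `s`. -/
lemma Admissible.lower_bounds (hadm : Admissible ν θ) :
    ∃ s : ℝ, 1 / 2 ≤ s ∧ s ≤ 1 ∧ |θ| = 2 * s - 1 ∧
      (1 - s) * (5 * s - 1) / 6 ≤ dv ν θ ∧
      (1 - (2 * s - 1) ^ 4) / 8 + (s ^ 4 - 1) / 15 ≤ q4 ν θ ∧
      (1 - (2 * s - 1) ^ 6) / 32 + (s ^ 6 - 1) / 63 ≤ q6 ν θ ∧
      17 * (1 - (2 * s - 1) ^ 8) / 128 + (s ^ 8 - 1) / 15 ≤ q8 ν θ := by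
  obtain ⟨s, h1, h2, h3, h4⟩ := hadm.exists_boundary
  have hp : ∀ k : ℕ, s ^ (2 * k) ≤ ν ^ k := fun k => by
    rw [pow_mul]
    exact pow_le_pow_left₀ (by positivity) h3 k
  have hθ : ∀ k : ℕ, θ ^ (2 * k) = (2 * s - 1) ^ (2 * k) := fun k => by
    rw [← h4, pow_mul |θ|, sq_abs, ← pow_mul]
  have t1 := hθ 1
  have t2 := hθ 2
  have t3 := hθ 3
  have t4 := hθ 4
  have p2 := hp 2
  have p3 := hp 3
  have p4 := hp 4
  norm_num at t1 t2 t3 t4 p2 p3 p4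
  refine ⟨s, h1, h2, h4, ?_, ?_, ?_, ?_⟩
  · rw [dv, t1]; nlinarith
  · rw [q4, t2]; linarith
  · rw [q6, t3]; linarith
  · rw [q8, t4]; linarith

lemma Admissible.dv_nonneg (hadm : Admissible ν θ) : 0 ≤ dv ν θ := by
  obtain ⟨s, h1, h2, -, h, -⟩ := hadm.lower_bounds
  refine le_trans ?_ h
  have : 0 ≤ (1 - s) * (5 * s - 1) := mul_nonneg (by linarith) (by linarith)
  positivity

lemma Admissible.q4_nonneg (hadm : Admissible ν θ) : 0 ≤ q4 ν θ := by
  obtain ⟨s, h1, h2, -, -, h, -⟩ := hadm.lower_bounds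
  refine le_trans ?_ h
  obtain ⟨u, hu, rfl⟩ : ∃ u, 0 ≤ u ∧ s = 1 / 2 + u := ⟨s - 1 / 2, by linarith, by ring⟩
  obtain ⟨v, hv, hv'⟩ : ∃ v, 0 ≤ v ∧ v = 1 / 2 - u := ⟨1 / 2 - u, by linarith, by ring⟩
  have hu2 : u ≤ 1 / 2 := by linarith
  nlinarith [mul_nonneg hu hv, pow_le_pow_left₀ hu hu2 4, pow_le_pow_left₀ hu hu2 3,
    pow_le_pow_left₀ hu hu2 2, pow_nonneg hu 3, pow_nonneg hu 2, mul_nonneg (pow_nonneg hu 3) hv]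

/-- On the boundary curve `|θ| ≤ 3/5` means `1/2 ≤ s ≤ 4/5`. Keeping `s` away from 1 is what makes
the bounds strictly positive. -/
lemma Admissible.bounds_of_sq_le (hadm : Admissible ν θ) (hθ : θ ^ 2 ≤ 9 / 25) :
    1 / 10 ≤ dv ν θ ∧ 89 / 1000 ≤ q4 ν θ + 2 * dv ν θ ^ 2 ∧ 0 ≤ q6 ν θ ∧ 3 / 50 ≤ q8 ν θ := by
  obtain ⟨s, h1, -, h3, hd, h4, h6, h8⟩ := hadm.lower_bounds
  have hs : s ≤ 4 / 5 := by
    have : |θ| ≤ 3 / 5 := abs_le_of_sq_le_sq (by linarith) (by norm_num)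
    linarith
  have hd' : 1 / 10 ≤ (1 - s) * (5 * s - 1) / 6 := by nlinarith
  have hx : 89 / 1000 ≤ (1 - (2 * s - 1) ^ 4) / 8 + (s ^ 4 - 1) / 15
      + 2 * ((1 - s) * (5 * s - 1) / 6) ^ 2 := by
    obtain ⟨u, hu⟩ : ∃ u, u = s - 1 / 2 := ⟨_, rfl⟩
    obtain ⟨v, hv⟩ : ∃ v, v = 4 / 5 - s := ⟨_, rfl⟩
    have hu0 : 0 ≤ u := by linarith
    have hv0 : 0 ≤ v := by linarith
    have key : 0 ≤ (95 / 162) * v ^ 4 + (20 / 3) * u * v ^ 3 + (1100 / 81) * u ^ 2 * v ^ 2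
        + (656 / 81) * u ^ 3 * v + (22 / 405) * u ^ 4 := by positivity
    subst hu hv
    linarith
  have hs0 : 0 ≤ 2 * s - 1 := by linarith
  have e6 : (2 * s - 1) ^ 6 ≤ (3 / 5) ^ 6 := pow_le_pow_left₀ hs0 (by linarith) 6
  have e8 : (2 * s - 1) ^ 8 ≤ (3 / 5) ^ 8 := pow_le_pow_left₀ hs0 (by linarith) 8
  have f6 : (1 / 2 : ℝ) ^ 6 ≤ s ^ 6 := pow_le_pow_left₀ (by norm_num) h1 6
  have f8 : (1 / 2 : ℝ) ^ 8 ≤ s ^ 8 := pow_le_pow_left₀ (by norm_num) h1 8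
  norm_num at e6 e8 f6 f8
  have hsq := pow_le_pow_left₀ (by linarith) hd 2
  exact ⟨hd'.trans hd, by linarith, by linarith, by linarith⟩

/-- Both factors have the sign of `ν - 1`. -/
lemma z3_mul_z5_nonneg (hν : 0 ≤ ν) : 0 ≤ z3 ν * z5 ν := by
  have h3 := zetaR_pos (k := 3) (by norm_num)
  have h5 := zetaR_pos (k := 5) (by norm_num)
  rw [z3, z5]
  rcases le_total 1 ν with h | h
  · have e3 := Real.one_le_rpow h (z := 3 / 2) (by norm_num)
    have e5 := Real.one_le_rpow h (z := 5 / 2) (by norm_num)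
    exact mul_nonneg (mul_nonneg h3.le (by linarith)) (mul_nonneg h5.le (by linarith))
  · have e3 := Real.rpow_le_one hν h (z := 3 / 2) (by norm_num)
    have e5 := Real.rpow_le_one hν h (z := 5 / 2) (by norm_num)
    exact mul_nonneg_of_nonpos_of_nonpos
      (mul_nonpos_of_nonneg_of_nonpos h3.le (by linarith))
      (mul_nonpos_of_nonneg_of_nonpos h5.le (by linarith))

/-- The negative terms in `P2` combine with positive ones into `z3² D (1 + w - w² - w³)` and `z3 z5
(1 - w²)`, nonnegative for `w = 1/(n-1) ≤ 1`. Everything except the `q8` term is dropped. -/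
lemma le_P2 (hadm : Admissible ν θ) (hθ : θ ^ 2 ≤ 9 / 25) {n : ℕ} (hn : 2 ≤ n) :
    8 * Real.pi ^ 8 * q8 ν θ ≤ P2 n ν θ := by
  have hn' : (2 : ℝ) ≤ n := by exact_mod_cast hn
  have hν : 0 ≤ ν := by linarith [hadm.1]
  obtain ⟨-, -, h6, -⟩ := hadm.bounds_of_sq_le hθ
  have h4 := hadm.q4_nonneg
  have hD : 0 ≤ DV ν θ := by
    rw [DV_eq]
    exact mul_nonneg (by positivity) hadm.dv_nonneg
  have hz := z3_mul_z5_nonneg hν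
  have hw0 : 0 ≤ ((n : ℝ) - 1)⁻¹ := inv_nonneg.mpr (by linarith)
  have hw1 : ((n : ℝ) - 1)⁻¹ ≤ 1 := inv_le_one_of_one_le₀ (by linarith)
  rw [P2]
  simp only [div_eq_mul_inv, ← inv_pow]
  generalize ((n : ℝ) - 1)⁻¹ = w at hw0 hw1
  generalize DV ν θ = D at hD
  generalize q4 ν θ = x at h4
  generalize q6 ν θ = y at h6
  have hpi := Real.pi_pos
  generalize Real.pi = p at hpi
  have e1 : 0 ≤ 1 + w - w ^ 2 - w ^ 3 := by nlinarith [mul_nonneg hw0 (sub_nonneg.mpr hw1)]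
  have e2 : 0 ≤ 1 - w ^ 2 := by nlinarith
  have g1 := mul_nonneg (mul_nonneg (sq_nonneg (z3 ν)) hD) e1
  have g2 := mul_nonneg hz e2
  have r1 : 0 ≤ D ^ 4 * (72 + 180 * w + 156 * w ^ 2 + 48 * w ^ 3) := by positivity
  have r2 : 0 ≤ D ^ 2 * p ^ 4 * x * (156 + 300 * w + 144 * w ^ 2) := by positivity
  have r3 : 0 ≤ p ^ 8 * x ^ 2 * (32 + 24 * w + 8 * w ^ 3) := by positivity
  have r4 : 0 ≤ p ^ 6 * y * D * (192 + 192 * w) := by positivity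
  linarith

/-! ### Comparison of fourth roots for `θ² ≥ 9/25`. -/

section Final

variable {n : ℕ}

/-- The fourth root of `n ^ 2` times the claimed bound. -/
noncomputable def rootBound (n : ℕ) (ν θ : ℝ) : ℝ :=
  P3 ν θ + 3 / 2 * (|P1 n θ| / n) ^ (1 / 4 : ℝ) + 6 / Real.pi ^ 2 * (|P2 n ν θ| / n) ^ (1 / 4 : ℝ)

/-- Here `p`, `q`, `h` bound the `L⁴` norms, times `√n`, of the logarithm part, the sign part and
the truncation excess. Each root of a sum is split by `x⁴ + y⁴ ≤ (x + y)⁴`, and the `P1` term of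
`rootBound` pays for both the sign correction and `h`. -/
lemma exists_roots_of_le_sq (hn : 2 ≤ n) (hadm : Admissible ν θ) (hθ : 9 / 25 ≤ θ ^ 2) :
    ∃ p q h : ℝ, 0 ≤ p ∧ 0 ≤ q ∧ 0 ≤ h ∧
      (6 / Real.pi ^ 2) ^ 4 * (3 * (Real.pi ^ 4 * q4 ν θ + 2 * DV ν θ ^ 2) ^ 2 + P2 n ν θ / n)
        ≤ p ^ 4 ∧
      (3 / 2) ^ 4 * (48 * (θ ^ 2) ^ 2 * (1 - θ ^ 2) ^ 2
        + quarticSign (1 / ((n : ℝ) - 1)) (θ ^ 2) / n) ≤ q ^ 4 ∧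
      (3 / 2) ^ 4 * (n * (1 - θ ^ 2) / ((n : ℝ) - 1) ^ 3) ≤ h ^ 4 ∧
      p + q + h ≤ rootBound n ν θ := by
  have hn' : (2 : ℝ) ≤ n := by exact_mod_cast hn
  have hn0 : (0 : ℝ) < n := by linarith
  have hm0 : (0 : ℝ) < (n : ℝ) - 1 := by linarith
  have ht1 : θ ^ 2 ≤ 1 := (sq_le_one_iff_abs_le_one _).mpr hadm.abs_le_one
  have hq4 := hadm.q4_nonneg
  set t := θ ^ 2 with ht
  set w : ℝ := 1 / ((n : ℝ) - 1) with hw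
  have hw0 : 0 ≤ w := by positivity
  have hw1 : w ≤ 1 := (div_le_one hm0).mpr (by linarith)
  set H : ℝ := (1 - t) * (w * (1 + w) ^ 2) with hH
  have hH0 : 0 ≤ H := mul_nonneg (by linarith) (by positivity)
  -- The correction may be negative, so its positive part is used under the root.
  set Q := max (quarticSign w t) 0 with hQ
  have hQ0 : 0 ≤ Q := le_max_right _ _
  have hkey : 8 * (Q + H) ≤ |P1 n θ| := by
    rw [P1_eq_quarticP1]
    refine le_trans ?_ (neg_le_abs _)
    rcases max_choice (quarticSign w t) 0 with h | h
    · rw [hQ, h]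
      exact eight_mul_quarticSign_add_le hθ ht1 hw0 hw1
    · rw [hQ, h, zero_add]
      exact eight_mul_le_neg_quarticP1 hθ ht1 hw0 hw1
  have hroot : (Q / n) ^ (1 / 4 : ℝ) + (H / n) ^ (1 / 4 : ℝ) ≤ (|P1 n θ| / n) ^ (1 / 4 : ℝ) := by
    refine rpow_quarter_add_le (by positivity) (by positivity) ?_
    rw [← add_div, ← mul_div_assoc]
    gcongr
  set c : ℝ := (3 : ℝ) ^ (1 / 4 : ℝ) with hc
  have hc4 : c ^ 4 = 3 := rpow_quarter_pow (by norm_num)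
  have hc0 : 0 ≤ c := by positivity
  have hsq : ∀ x : ℝ, 0 ≤ x → √x ^ 4 = x ^ 2 := fun x hx => by
    rw [show 4 = 2 * 2 by norm_num, pow_mul, Real.sq_sqrt hx]
  have hpow : ∀ x y : ℝ, 0 ≤ x → 0 ≤ y → x ^ 4 + y ^ 4 ≤ (x + y) ^ 4 := fun x y hx hy =>
    pow_add_pow_le hx hy (by norm_num)
  refine ⟨6 / Real.pi ^ 2 * (c * √(Real.pi ^ 4 * q4 ν θ + 3 * DV ν θ ^ 2))
      + 6 / Real.pi ^ 2 * (|P2 n ν θ| / n) ^ (1 / 4 : ℝ),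
    3 * (c * √(t * (1 - t))) + 3 / 2 * (Q / n) ^ (1 / 4 : ℝ), 3 / 2 * (H / n) ^ (1 / 4 : ℝ),
    by positivity, by positivity, by positivity, ?_, ?_, ?_, ?_⟩
  · refine le_trans ?_ (hpow _ _ (by positivity) (by positivity))
    rw [mul_pow _ (c * _), mul_pow c, mul_pow _ ((|P2 n ν θ| / n) ^ (1 / 4 : ℝ)), hc4,
      hsq _ (by positivity), rpow_quarter_pow (by positivity), ← mul_add]
    have h1 : P2 n ν θ / n ≤ |P2 n ν θ| / n := by gcongr; exact le_abs_self _
    have h2 : (Real.pi ^ 4 * q4 ν θ + 2 * DV ν θ ^ 2) ^ 2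
        ≤ (Real.pi ^ 4 * q4 ν θ + 3 * DV ν θ ^ 2) ^ 2 := by
      gcongr
      norm_num
    gcongr
  · refine le_trans ?_ (hpow _ _ (by positivity) (by positivity))
    rw [mul_pow _ (c * _), mul_pow c, mul_pow _ ((Q / n) ^ (1 / 4 : ℝ)), hc4,
      hsq _ (mul_nonneg (by linarith) (by linarith)), rpow_quarter_pow (by positivity)]
    have h1 : quarticSign w t / n ≤ Q / n := by gcongr; exact le_max_left _ _
    nlinarith
  · rw [mul_pow, rpow_quarter_pow (by positivity)]
    refine le_of_eq ?_
    rw [hH, hw]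
    field_simp
    ring
  · rw [rootBound, P3]
    have h1 : √(θ ^ 2 * (1 - θ ^ 2)) = √(t * (1 - t)) := rfl
    have h2 : 6 * c / Real.pi ^ 2 * √(Real.pi ^ 4 * q4 ν θ + 3 * DV ν θ ^ 2)
        = 6 / Real.pi ^ 2 * (c * √(Real.pi ^ 4 * q4 ν θ + 3 * DV ν θ ^ 2)) := by ring
    rw [h1, ← hc, h2]
    linarith

end Final

end Parameters

end StableEst

/-! ### Comparison of fourth roots for `θ² ≤ 9/25`. -/

namespace StableEst

section Final

variable {ν θ : ℝ} {n : ℕ}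

lemma pow_four_add_le {x y d : ℝ} (hx : 0 ≤ x) (hxy : x ≤ y) (hd : 0 ≤ d) :
    y ^ 4 + 4 * x ^ 3 * d ≤ (y + d) ^ 4 := by
  have hy := hx.trans hxy
  have h1 : x ^ 3 ≤ y ^ 3 := pow_le_pow_left₀ hx hxy 3
  calc y ^ 4 + 4 * x ^ 3 * d ≤ y ^ 4 + 4 * y ^ 3 * d := by gcongr
    _ ≤ y ^ 4 + 4 * y ^ 3 * d + (6 * y ^ 2 * d ^ 2 + 4 * y * d ^ 3 + d ^ 4) :=
      le_add_of_nonneg_right (by positivity)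
    _ = _ := by ring

/-- Bounds `n²` times the truncation cost: the bracket is at most 3, and `3 · 0.9⁴ < 2`. -/
lemma abs_weight_mul_le {r t x : ℝ} (hr : 2 ≤ r) (ht0 : 0 ≤ t) (ht1 : t ≤ 1) (hx0 : 0 ≤ x)
    (hx : x ≤ 3 / 5) :
    ((3 + x) / 4) ^ 4 * (3 * (1 - t) ^ 2 * (r - 1) / r + (1 - t) * (1 + 3 * t) / r) ≤ 2 := by
  have hr0 : 0 < r := by linarith
  have hr1 : 0 ≤ r - 1 := by linarith
  have ht : 0 ≤ 1 - t := by linarith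
  have h1 : ((3 + x) / 4) ^ 4 ≤ (9 / 10) ^ 4 := pow_le_pow_left₀ (by positivity) (by linarith) 4
  have h2 : 3 * (1 - t) ^ 2 * (r - 1) / r + (1 - t) * (1 + 3 * t) / r ≤ 3 := by
    rw [← add_div, div_le_iff₀ hr0]
    have h4 : (1 - t) ^ 2 ≤ 1 := pow_le_one₀ ht (by linarith)
    have h5 : (1 - t) ^ 2 * (r - 1) ≤ 1 * (r - 1) := by gcongr
    nlinarith
  calc _ ≤ (9 / 10 : ℝ) ^ 4 * 3 := by gcongr
    _ ≤ 2 := by norm_num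

/-- Applied to the roots with `2D²` and `3D²`: the gain `12 x³ (y - x)` from the surplus `D²`
exceeds the truncation cost 2. -/
lemma two_le_of_sq_sub_sq {x y : ℝ} (hxy : x ≤ y) (hyx : y ≤ 5 / 4 * x)
    (h3 : 3 ≤ x ^ 2) (hsub : 9 / 25 ≤ y ^ 2 - x ^ 2) : 2 ≤ 12 * x ^ 3 * (y - x) := by
  have h1 : (y - x) * (y + x) ≤ (y - x) * (9 / 4 * x) := by gcongr; linarith
  have h2 : 4 / 25 ≤ (y - x) * x := by linarith
  have h4 : (3 : ℝ) * (4 / 25) ≤ x ^ 2 * ((y - x) * x) := by gcongr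
  linarith

-- The `P1` term is discarded here. The root `Z` of the sign correction is taken out of the
-- logarithm terms `X + Y`, and the increase from `A₂` to `A₃` covers the truncation.
set_option maxHeartbeats 400000 in
lemma exists_roots_of_sq_le (hn : 2 ≤ n) (hadm : Admissible ν θ) (hθ : θ ^ 2 ≤ 9 / 25) :
    ∃ p q : ℝ, 0 ≤ p ∧ 0 ≤ q ∧
      (6 / Real.pi ^ 2) ^ 4 * (3 * (Real.pi ^ 4 * q4 ν θ + 2 * DV ν θ ^ 2) ^ 2 + P2 n ν θ / n)
        ≤ p ^ 4 ∧
      (3 / 2) ^ 4 * (48 * (θ ^ 2) ^ 2 * (1 - θ ^ 2) ^ 2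
        + quarticSign (1 / ((n : ℝ) - 1)) (θ ^ 2) / n) ≤ q ^ 4 ∧
      (p + q) ^ 4 + ((3 + |θ|) / 4) ^ 4 * (3 * (1 - θ ^ 2) ^ 2 * ((n : ℝ) - 1) / n
        + (1 - θ ^ 2) * (1 + 3 * θ ^ 2) / n) ≤ rootBound n ν θ ^ 4 := by
  have hn' : (2 : ℝ) ≤ n := by exact_mod_cast hn
  have hn0 : (0 : ℝ) < n := by linarith
  have hm0 : (0 : ℝ) < (n : ℝ) - 1 := by linarith
  have hq4 := hadm.q4_nonneg
  obtain ⟨hd, hx, -, hq8⟩ := hadm.bounds_of_sq_le hθ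
  have hP2 := le_P2 hadm hθ hn
  have habs : |θ| ≤ 3 / 5 := abs_le_of_sq_le_sq (by linarith) (by norm_num)
  have ht0 : 0 ≤ θ ^ 2 := sq_nonneg θ
  set t := θ ^ 2 with ht
  set w : ℝ := 1 / ((n : ℝ) - 1) with hw
  have hw0 : 0 ≤ w := by positivity
  have hw1 : w ≤ 1 := (div_le_one hm0).mpr (by linarith)
  set Q := max (quarticSign w t) 0 with hQ
  have hQ0 : 0 ≤ Q := le_max_right _ _
  have hQle : quarticSign w t ≤ Q := le_max_left _ _
  have hQ24 : Q ≤ 24 := max_le (quarticSign_le ht0 hθ hw0 hw1) (by norm_num)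
  have hQn : Q / n ≤ 83 / 20 := by
    rw [div_le_iff₀ hn0]
    refine max_le ?_ (by positivity)
    have h := mul_quarticSign_le ht0 hθ hw0 hw1
    have h1 : w * ((n : ℝ) - 1) = 1 := by rw [hw]; field_simp
    have h2 : 1 + w = w * n := by linarith
    have hwpos : 0 < w := by positivity
    rw [h2] at h
    refine le_of_mul_le_mul_left (h.trans_eq (by ring)) hwpos
  set c : ℝ := (3 : ℝ) ^ (1 / 4 : ℝ) with hc
  have hc4 : c ^ 4 = 3 := rpow_quarter_pow (by norm_num)
  have hc0 : 0 ≤ c := by positivity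
  have hpi := Real.pi_pos
  have hAsq : ∀ k : ℝ, 0 ≤ k → (6 / Real.pi ^ 2 * √(Real.pi ^ 4 * q4 ν θ + k * DV ν θ ^ 2)) ^ 2
      = 36 * (q4 ν θ + k * dv ν θ ^ 2) := by
    intro k hk
    rw [mul_pow, Real.sq_sqrt (by positivity), DV_eq]
    field_simp
    ring
  set A₂ := 6 / Real.pi ^ 2 * √(Real.pi ^ 4 * q4 ν θ + 2 * DV ν θ ^ 2) with hA₂
  set A₃ := 6 / Real.pi ^ 2 * √(Real.pi ^ 4 * q4 ν θ + 3 * DV ν θ ^ 2) with hA₃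
  have hA₂0 : 0 ≤ A₂ := by positivity
  have hA₃0 : 0 ≤ A₃ := by positivity
  have hA₂sq := hAsq 2 (by norm_num)
  have hA₃sq := hAsq 3 (by norm_num)
  rw [← hA₂] at hA₂sq
  rw [← hA₃] at hA₃sq
  have hd2 : 1 / 100 ≤ dv ν θ ^ 2 := by nlinarith
  have hA₂big : 3 ≤ A₂ ^ 2 := by linarith
  have hA₂pos : 0 < A₂ := by
    by_contra h
    have : A₂ = 0 := le_antisymm (not_lt.mp h) hA₂0
    rw [this] at hA₂big
    norm_num at hA₂big
  have hle : A₂ ≤ A₃ := abs_le_of_sq_le_sq' (by linarith) hA₃0 |>.2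
  have hle' : A₃ ≤ 5 / 4 * A₂ := abs_le_of_sq_le_sq' (by nlinarith) (by positivity) |>.2
  clear_value A₂ A₃ Q w
  set X := c * A₂ with hX
  set Y := 6 / Real.pi ^ 2 * (|P2 n ν θ| / n) ^ (1 / 4 : ℝ) with hY
  set Z := 3 / 2 * (Q / n) ^ (1 / 4 : ℝ) with hZ
  set B := 3 * (c * √(t * (1 - t))) with hB
  have hZ0 : 0 ≤ Z := by positivity
  have hY0 : 0 ≤ Y := by positivity
  have hX0 : 0 ≤ X := by positivity
  have hB0 : 0 ≤ B := by positivity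
  have hX4 : X ^ 4 = 3 * (A₂ ^ 2) ^ 2 := by rw [hX, mul_pow, hc4]; ring
  have hY4 : Y ^ 4 = (6 / Real.pi ^ 2) ^ 4 * (|P2 n ν θ| / n) := by
    rw [hY, mul_pow, rpow_quarter_pow (by positivity)]
  have hZ4 : Z ^ 4 = (3 / 2) ^ 4 * (Q / n) := by
    rw [hZ, mul_pow, rpow_quarter_pow (by positivity)]
  clear_value X Y Z B
  -- From `P2 ≥ 8π⁸ q8` and `q8 ≥ 3/50`: `6⁴ · 8 · 3/50 = 622.08`.
  have hY4' : 622 / n ≤ Y ^ 4 := by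
    rw [hY4]
    have h1 : 8 * Real.pi ^ 8 * (3 / 50) ≤ |P2 n ν θ| :=
      le_trans (by gcongr) (hP2.trans (le_abs_self _))
    calc 622 / (n : ℝ) ≤ (6 / Real.pi ^ 2) ^ 4 * (8 * Real.pi ^ 8 * (3 / 50) / n) := by
          have : (6 / Real.pi ^ 2) ^ 4 * (8 * Real.pi ^ 8 * (3 / 50) / n) = 62208 / 100 / n := by
            field_simp
            norm_num
          rw [this]
          gcongr
          norm_num
      _ ≤ _ := by gcongr
  -- Numerically `1.1⁴ · 1.5⁴ · 4.15 ≈ 30.76` against `3 (36 · 0.089)² ≈ 30.80`.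
  have hXZ : 11 / 10 * Z ≤ X := by
    refine le_of_pow_le_pow_left₀ (n := 4) (by norm_num) hX0 ?_
    rw [mul_pow, hX4, hZ4, hA₂sq]
    have h1 : (36 * (89 / 1000) : ℝ) ^ 2 ≤ (36 * (q4 ν θ + 2 * dv ν θ ^ 2)) ^ 2 :=
      pow_le_pow_left₀ (by norm_num) (by linarith) 2
    calc _ ≤ (11 / 10 : ℝ) ^ 4 * ((3 / 2) ^ 4 * (83 / 20)) := by gcongr
      _ ≤ 3 * (36 * (89 / 1000)) ^ 2 := by norm_num
      _ ≤ _ := by gcongr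
  -- Numerically `1.5⁸ · 24 ≈ 615.1 < 622`.
  have hYZ : 3 / 2 * Z ≤ Y := by
    refine le_of_pow_le_pow_left₀ (n := 4) (by norm_num) hY0 ?_
    refine le_trans ?_ hY4'
    rw [mul_pow, hZ4]
    have : Q / n ≤ 24 / n := by gcongr
    have h2 : (3 / 2 : ℝ) ^ 4 * ((3 / 2) ^ 4 * (24 / n)) ≤ 622 / n := by
      rw [← mul_div_assoc, ← mul_div_assoc]
      gcongr
      norm_num
    refine le_trans ?_ h2
    gcongr
  -- The root `Z` cancels in the sum `p + q = X + Y + B`.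
  refine ⟨X + Y - Z, B + Z, by linarith, by positivity, ?_, ?_, ?_⟩
  · have h1 : √(Real.pi ^ 4 * q4 ν θ + 2 * DV ν θ ^ 2) ^ 4
        = (Real.pi ^ 4 * q4 ν θ + 2 * DV ν θ ^ 2) ^ 2 := by
      rw [show 4 = 2 * 2 by norm_num, pow_mul, Real.sq_sqrt (by positivity)]
    have h2 : (6 / Real.pi ^ 2) ^ 4 * (3 * (Real.pi ^ 4 * q4 ν θ + 2 * DV ν θ ^ 2) ^ 2
        + P2 n ν θ / n) = X ^ 4 + (6 / Real.pi ^ 2) ^ 4 * (P2 n ν θ / n) := by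
      rw [hX, mul_pow, hc4, hA₂, mul_pow, h1]
      ring
    rw [h2]
    refine le_trans ?_ (pow_four_add_pow_four_le hZ0 hXZ hYZ)
    rw [hY4]
    gcongr
    exact le_abs_self _
  · refine le_trans ?_ (pow_add_pow_le hB0 hZ0 (by norm_num))
    have h1 : quarticSign w t / n ≤ Q / n := by gcongr
    have h2 : √(t * (1 - t)) ^ 4 = (t * (1 - t)) ^ 2 := by
      rw [show 4 = 2 * 2 by norm_num, pow_mul, Real.sq_sqrt (mul_nonneg ht0 (by linarith))]
    rw [hB, mul_pow _ (c * _), mul_pow c, hc4, h2, hZ4]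
    calc _ = 3 ^ 4 * (3 * (t * (1 - t)) ^ 2) + (3 / 2) ^ 4 * (quarticSign w t / n) := by ring
      _ ≤ _ := by gcongr
  · set W := X + Y + B with hW
    have hR : W + c * (A₃ - A₂) ≤ rootBound n ν θ := by
      rw [rootBound, P3]
      have h1 : √(θ ^ 2 * (1 - θ ^ 2)) = √(t * (1 - t)) := rfl
      have h2 : 0 ≤ 3 / 2 * (|P1 n θ| / n) ^ (1 / 4 : ℝ) := by positivity
      have h3 : 6 * c / Real.pi ^ 2 * √(Real.pi ^ 4 * q4 ν θ + 3 * DV ν θ ^ 2) = c * A₃ := by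
        rw [hA₃]; ring
      rw [h1, ← hc, h3]
      linarith
    have hΔ : 0 ≤ c * (A₃ - A₂) := mul_nonneg hc0 (by linarith)
    have hXW : X ≤ W := by linarith
    have hmain : W ^ 4 + 4 * X ^ 3 * (c * (A₃ - A₂)) ≤ rootBound n ν θ ^ 4 :=
      (pow_four_add_le hX0 hXW hΔ).trans
        (pow_le_pow_left₀ (add_nonneg (hX0.trans hXW) hΔ) hR 4)
    have hgain : 4 * X ^ 3 * (c * (A₃ - A₂)) = 12 * A₂ ^ 3 * (A₃ - A₂) := by
      rw [hX]
      linear_combination (4 * A₂ ^ 3 * (A₃ - A₂)) * hc4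
    have hgain2 : 2 ≤ 12 * A₂ ^ 3 * (A₃ - A₂) :=
      two_le_of_sq_sub_sq hle hle' hA₂big (by linarith)
    have hL := abs_weight_mul_le hn' ht0 (by linarith : t ≤ 1) (abs_nonneg θ) habs
    have hsum : X + Y - Z + (B + Z) = W := by rw [hW]; ring
    rw [hsum]
    linarith

end Final

end StableEst

/-! ### Minkowski's inequality for fourth powers. -/

namespace StableEst

open Set Filter Topology

section PowFour

/-- Convexity of `x⁴` with weights `p/(p+q)` and `q/(p+q)`. These weights are optimal when `p` and
`q` are the two `L⁴` norms, so integration gives Minkowski. -/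
lemma add_pow_four_le_weighted {p q : ℝ} (hp : 0 < p) (hq : 0 < q) (x y : ℝ) :
    (x + y) ^ 4 ≤ (p + q) ^ 3 / p ^ 3 * x ^ 4 + (p + q) ^ 3 / q ^ 3 * y ^ 4 := by
  have hpq : 0 < p + q := by positivity
  have h := (Even.convexOn_pow (𝕜 := ℝ) (n := 4) (by decide)).2 (mem_univ (x / p))
    (mem_univ (y / q)) (show 0 ≤ p / (p + q) by positivity)
    (show 0 ≤ q / (p + q) by positivity) (by field_simp)
  simp only [smul_eq_mul] at h
  have h1 : p / (p + q) * (x / p) + q / (p + q) * (y / q) = (x + y) / (p + q) := by field_simp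
  rw [h1, div_pow, div_le_iff₀ (by positivity)] at h
  refine h.trans_eq ?_
  field_simp

variable {Ω : Type*} [MeasurableSpace Ω] {P : Measure Ω}

/-- Minkowski's inequality in `L⁴`, with bounds for the integrals of fourth powers. -/
lemma integral_add_pow_four_le {f g : Ω → ℝ} (hf : AEStronglyMeasurable f P)
    (hg : AEStronglyMeasurable g P) (hfi : Integrable (fun ω => f ω ^ 4) P)
    (hgi : Integrable (fun ω => g ω ^ 4) P) {p q : ℝ} (hp : 0 ≤ p) (hq : 0 ≤ q)
    (hfp : ∫ ω, f ω ^ 4 ∂P ≤ p ^ 4) (hgq : ∫ ω, g ω ^ 4 ∂P ≤ q ^ 4) :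
    Integrable (fun ω => (f ω + g ω) ^ 4) P ∧ ∫ ω, (f ω + g ω) ^ 4 ∂P ≤ (p + q) ^ 4 := by
  have hdom : ∀ a b : ℝ, Integrable (fun ω => a * f ω ^ 4 + b * g ω ^ 4) P := fun a b =>
    (hfi.const_mul a).add (hgi.const_mul b)
  have hint : Integrable (fun ω => (f ω + g ω) ^ 4) P := by
    refine (hdom ((1 + 1) ^ 3 / 1 ^ 3) ((1 + 1) ^ 3 / 1 ^ 3)).mono' ((hf.add hg).pow 4)
      (Eventually.of_forall fun ω => ?_)
    rw [Real.norm_of_nonneg (by positivity)]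
    exact add_pow_four_le_weighted one_pos one_pos _ _
  refine ⟨hint, ?_⟩
  -- The weights require positive `p` and `q`; the vanishing cases are reached by letting `ε` tend
  -- to 0.
  have hε : ∀ ε > 0, ∫ ω, (f ω + g ω) ^ 4 ∂P ≤ (p + ε + (q + ε)) ^ 4 := by
    intro ε hε
    have hp' : 0 < p + ε := by linarith
    have hq' : 0 < q + ε := by linarith
    calc ∫ ω, (f ω + g ω) ^ 4 ∂P
        ≤ ∫ ω, ((p + ε + (q + ε)) ^ 3 / (p + ε) ^ 3 * f ω ^ 4
          + (p + ε + (q + ε)) ^ 3 / (q + ε) ^ 3 * g ω ^ 4) ∂P :=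
        integral_mono hint (hdom _ _) fun ω => add_pow_four_le_weighted hp' hq' _ _
      _ = (p + ε + (q + ε)) ^ 3 / (p + ε) ^ 3 * ∫ ω, f ω ^ 4 ∂P
          + (p + ε + (q + ε)) ^ 3 / (q + ε) ^ 3 * ∫ ω, g ω ^ 4 ∂P := by
        rw [integral_add (hfi.const_mul _) (hgi.const_mul _), integral_const_mul,
          integral_const_mul]
      _ ≤ (p + ε + (q + ε)) ^ 3 / (p + ε) ^ 3 * (p + ε) ^ 4
          + (p + ε + (q + ε)) ^ 3 / (q + ε) ^ 3 * (q + ε) ^ 4 := by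
        have h1 : p ^ 4 ≤ (p + ε) ^ 4 := pow_le_pow_left₀ hp (by linarith) 4
        have h2 : q ^ 4 ≤ (q + ε) ^ 4 := pow_le_pow_left₀ hq (by linarith) 4
        gcongr
        · exact hfp.trans h1
        · exact hgq.trans h2
      _ = (p + ε + (q + ε)) ^ 4 := by
        field_simp
  have hlim : Tendsto (fun ε : ℝ => (p + ε + (q + ε)) ^ 4) (𝓝[>] 0) (𝓝 ((p + q) ^ 4)) := by
    have h : Continuous fun ε : ℝ => (p + ε + (q + ε)) ^ 4 := by fun_prop
    have := (h.tendsto 0).mono_left (nhdsWithin_le_nhds (s := Ioi 0))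
    simpa using this
  exact ge_of_tendsto hlim (eventually_nhdsWithin_of_forall hε)

end PowFour

/-! ### Moments of the sample variances and of `θ̃`. -/

section Moments

variable {Ω : Type*} [MeasurableSpace Ω] {P : Measure Ω} [IsProbabilityMeasure P] {n : ℕ}
  {ν θ τ : ℝ} {X : Fin n → Ω → ℝ}

lemma IsStrictlyStableLaw.eq {μ μ' : Measure ℝ} [IsProbabilityMeasure μ] [IsProbabilityMeasure μ']
    (h : IsStrictlyStableLaw μ ν θ τ) (h' : IsStrictlyStableLaw μ' ν θ τ) : μ = μ' :=
  Measure.ext_of_charFun (funext fun k => (h k).trans (h' k).symm)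

lemma measurable_sampleMean : Measurable fun x : Fin n → ℝ => sampleMean x := by
  unfold sampleMean
  fun_prop

lemma measurable_sampleVar : Measurable fun x : Fin n → ℝ => sampleVar x := by
  unfold sampleVar sampleMean
  fun_prop

lemma measurable_logs : Measurable fun x : Fin n → ℝ => logs x :=
  measurable_pi_lambda _ fun j =>
    Real.measurable_log.comp (measurable_norm.comp (measurable_pi_apply j))

lemma measurable_signs : Measurable fun x : Fin n → ℝ => signs x :=
  measurable_pi_lambda _ fun j => measurable_sign.comp (measurable_pi_apply j)

lemma integral_sampleVar_logs (hn : 2 ≤ n) (hadm : Admissible ν θ)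
    (hmeas : ∀ i, Measurable (X i)) (hindep : iIndepFun X P)
    (hlaw : ∀ i, IsStrictlyStableLaw (P.map (X i)) ν θ τ) :
    Integrable (fun ω => (sampleVar (logs fun i => X i ω) - DV ν θ) ^ 4) P ∧
      ∫ ω, (sampleVar (logs fun i => X i ω) - DV ν θ) ^ 4 ∂P =
        (3 * (Real.pi ^ 4 * q4 ν θ + 2 * DV ν θ ^ 2) ^ 2 + P2 n ν θ / n) / (n : ℝ) ^ 2 := by
  have hlog : Measurable fun x : ℝ => Real.log |x| := Real.measurable_log.comp measurable_norm
  have hprob : ∀ i, IsProbabilityMeasure (P.map (X i)) := fun i =>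
    Measure.isProbabilityMeasure_map (hmeas i).aemeasurable
  have heq : ∀ i, P.map (X i) = P.map (X ⟨0, by omega⟩) := fun i => (hlaw i).eq (hlaw _)
  obtain ⟨m, hm, h1, h2, h3, h4, h5, h6, h8⟩ := (hlaw ⟨0, by omega⟩).log_moments hadm
  have hpow : ∀ k, Measurable fun x : ℝ => (Real.log |x| - τ) ^ k := fun k =>
    (hlog.sub_const τ).pow_const k
  have hn0 : (n : ℝ) ≠ 0 := by positivity
  have hn1 : (n : ℝ) - 1 ≠ 0 := by
    have : (2 : ℝ) ≤ n := by exact_mod_cast hn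
    linarith
  obtain ⟨hi, hv⟩ := integral_sampleVar_sub_pow_four hn (Y := fun i ω => Real.log |X i ω|)
    (fun i => hlog.comp (hmeas i)) (hindep.comp (fun _ x => Real.log |x|) fun _ => hlog) τ m
    (fun i k _ => by
      have h := (hm k).1
      rw [← heq i] at h
      exact h.comp_measurable (hmeas i))
    (fun i k _ => by
      rw [← (hm k).2, ← heq i, integral_map (hmeas i).aemeasurable
        (hpow k).aestronglyMeasurable])
    h1 h2 h3 h4 h5 h6 h8
  refine ⟨hi, hv.trans ?_⟩
  rw [P2]
  field_simp
  ring

/-- The central moments of a sign with mean `θ`. -/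
noncomputable def signMoment (θ : ℝ) (k : ℕ) : ℝ :=
  (1 + θ) / 2 * (1 - θ) ^ k + (1 - θ) / 2 * (-1 - θ) ^ k

lemma IsStrictlyStableLaw.integral_comp_sign {μ : Measure ℝ} [IsProbabilityMeasure μ]
    (hadm : Admissible ν θ) (hμ : IsStrictlyStableLaw μ ν θ τ) (k : ℕ) :
    Integrable (fun x => (Real.sign x - θ) ^ k) μ ∧
      ∫ x, (Real.sign x - θ) ^ k ∂μ = signMoment θ k := by
  -- Every function on `{1, -1}` is affine, so `E sign X = θ` determines all the moments.
  have hae : (fun x : ℝ => (Real.sign x - θ) ^ k) =ᵐ[μ] fun x =>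
      ((1 - θ) ^ k + (-1 - θ) ^ k) / 2 + ((1 - θ) ^ k - (-1 - θ) ^ k) / 2 * Real.sign x := by
    filter_upwards [hμ.measure_zero hadm] with x hx
    rcases Real.sign_apply_eq_of_ne_zero x hx with h | h <;> rw [h] <;> ring
  have hs : Integrable Real.sign μ := by
    refine (integrable_const (1 : ℝ)).mono' measurable_sign.aestronglyMeasurable
      (Eventually.of_forall fun x => ?_)
    rcases Real.sign_apply_eq x with h | h | h <;> simp [h]
  refine ⟨((integrable_const _).add (hs.const_mul _)).congr hae.symm, ?_⟩
  rw [integral_congr_ae hae, integral_add (integrable_const _) (hs.const_mul _),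
    integral_const_mul, hμ.integral_sign hadm, signMoment]
  simp
  ring

lemma integral_sign_sub_pow (hadm : Admissible ν θ) (hmeas : ∀ i, Measurable (X i))
    (hlaw : ∀ i, IsStrictlyStableLaw (P.map (X i)) ν θ τ) (i : Fin n) (k : ℕ) :
    Integrable (fun ω => (Real.sign (X i ω) - θ) ^ k) P ∧
      ∫ ω, (Real.sign (X i ω) - θ) ^ k ∂P = signMoment θ k := by
  have := Measure.isProbabilityMeasure_map (μ := P) (hmeas i).aemeasurable
  obtain ⟨h1, h2⟩ := (hlaw i).integral_comp_sign hadm k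
  refine ⟨h1.comp_measurable (hmeas i), ?_⟩
  rw [← h2, integral_map (hmeas i).aemeasurable
    ((measurable_sign.sub_const θ).pow_const k).aestronglyMeasurable]

lemma integral_sampleVar_signs (hn : 2 ≤ n) (hadm : Admissible ν θ)
    (hmeas : ∀ i, Measurable (X i)) (hindep : iIndepFun X P)
    (hlaw : ∀ i, IsStrictlyStableLaw (P.map (X i)) ν θ τ) :
    Integrable (fun ω => (sampleVar (signs fun i => X i ω) - (1 - θ ^ 2)) ^ 4) P ∧
      ∫ ω, (sampleVar (signs fun i => X i ω) - (1 - θ ^ 2)) ^ 4 ∂P =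
        (48 * (θ ^ 2) ^ 2 * (1 - θ ^ 2) ^ 2 + quarticSign (1 / ((n : ℝ) - 1)) (θ ^ 2) / n)
          / (n : ℝ) ^ 2 := by
  have hn0 : (n : ℝ) ≠ 0 := by positivity
  have hn1 : (n : ℝ) - 1 ≠ 0 := by
    have : (2 : ℝ) ≤ n := by exact_mod_cast hn
    linarith
  have hs := integral_sign_sub_pow (P := P) hadm hmeas hlaw
  obtain ⟨hi, hv⟩ := integral_sampleVar_sub_pow_four hn (Y := fun i ω => Real.sign (X i ω))
    (fun i => measurable_sign.comp (hmeas i))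
    (hindep.comp (fun _ => Real.sign) fun _ => measurable_sign) θ (signMoment θ)
    (fun i k _ => (hs i k).1) (fun i k _ => (hs i k).2)
    -- Cumulants of a sign with mean `θ`: the derivative of `log(cosh s + θ sinh s)` satisfies `T' =
    -- 1 - T²` with `T(0) = θ`.
    (D := 1 - θ ^ 2) (κ₃ := -2 * θ * (1 - θ ^ 2)) (κ₄ := (1 - θ ^ 2) * (6 * θ ^ 2 - 2))
    (κ₅ := (1 - θ ^ 2) * (16 * θ - 24 * θ ^ 3))
    (κ₆ := (1 - θ ^ 2) * (16 - 120 * θ ^ 2 + 120 * θ ^ 4))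
    (κ₈ := (1 - θ ^ 2) * (-272 + 3696 * θ ^ 2 - 8400 * θ ^ 4 + 5040 * θ ^ 6))
    (by rw [signMoment]; ring) (by rw [signMoment]; ring) (by rw [signMoment]; ring)
    (by rw [signMoment]; ring) (by rw [signMoment]; ring) (by rw [signMoment]; ring)
    (by rw [signMoment]; ring)
  refine ⟨hi, hv.trans ?_⟩
  rw [quarticSign]
  generalize (n : ℝ) = x at *
  field_simp
  ring

lemma thetaTilde_sub (hn : 2 ≤ n) (x : Fin n → ℝ) (θ : ℝ) :
    thetaTilde x - θ = (1 / (n : ℝ)) * ∑ i, (Real.sign (x i) - θ) := by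
  have hn0 : (n : ℝ) ≠ 0 := by positivity
  rw [thetaTilde, sampleMean, Finset.sum_sub_distrib]
  simp only [signs, Finset.sum_const, Finset.card_univ, Fintype.card_fin, nsmul_eq_mul]
  field_simp

lemma integral_thetaTilde_sub_pow (hn : 2 ≤ n) (hadm : Admissible ν θ)
    (hmeas : ∀ i, Measurable (X i)) (hindep : iIndepFun X P)
    (hlaw : ∀ i, IsStrictlyStableLaw (P.map (X i)) ν θ τ) {b : ℕ} (hb : b ≤ 8) :
    Integrable (fun ω => (thetaTilde (fun i => X i ω) - θ) ^ b) P ∧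
      ∫ ω, (thetaTilde (fun i => X i ω) - θ) ^ b ∂P
        = (1 / (n : ℝ)) ^ b * powerSumMoment (signMoment θ) n 0 b := by
  have hs := integral_sign_sub_pow (P := P) hadm hmeas hlaw
  obtain ⟨hi, hv⟩ := integrable_powerSum_and_integral (Y := fun i ω => Real.sign (X i ω) - θ)
    (fun i => (measurable_sign.comp (hmeas i)).sub_const θ)
    (hindep.comp (fun _ x => Real.sign x - θ) fun _ => measurable_sign.sub_const θ) (signMoment θ)
    (fun i k _ => (hs i k).1) (fun i k _ => (hs i k).2) Finset.univ 0 b (by omega)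
  simp only [pow_zero, one_mul, Finset.card_univ, Fintype.card_fin] at hi hv
  simp only [thetaTilde_sub hn, mul_pow]
  exact ⟨hi.const_mul _, by rw [integral_const_mul, hv]⟩

lemma signMoment_zero : signMoment θ 0 = 1 := by rw [signMoment]; ring

lemma signMoment_one : signMoment θ 1 = 0 := by rw [signMoment]; ring

lemma integral_thetaTilde_sub_pow_four (hn : 2 ≤ n) (hadm : Admissible ν θ)
    (hmeas : ∀ i, Measurable (X i)) (hindep : iIndepFun X P)
    (hlaw : ∀ i, IsStrictlyStableLaw (P.map (X i)) ν θ τ) :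
    Integrable (fun ω => (thetaTilde (fun i => X i ω) - θ) ^ 4) P ∧
      ∫ ω, (thetaTilde (fun i => X i ω) - θ) ^ 4 ∂P
        = (3 * (1 - θ ^ 2) ^ 2 * ((n : ℝ) - 1) / n + (1 - θ ^ 2) * (1 + 3 * θ ^ 2) / n)
          / (n : ℝ) ^ 2 := by
  have hn0 : (n : ℝ) ≠ 0 := by positivity
  obtain ⟨hi, hv⟩ := integral_thetaTilde_sub_pow hn hadm hmeas hindep hlaw (b := 4) (by norm_num)
  refine ⟨hi, hv.trans ?_⟩
  rw [powerSumMoment_0_4 _ signMoment_zero signMoment_one, signMoment, signMoment]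
  field_simp
  ring

lemma integral_one_sub_thetaTilde_sq (hn : 2 ≤ n) (hadm : Admissible ν θ)
    (hmeas : ∀ i, Measurable (X i)) (hindep : iIndepFun X P)
    (hlaw : ∀ i, IsStrictlyStableLaw (P.map (X i)) ν θ τ) :
    Integrable (fun ω => 1 - thetaTilde (fun i => X i ω) ^ 2) P ∧
      ∫ ω, (1 - thetaTilde (fun i => X i ω) ^ 2) ∂P = (1 - θ ^ 2) * ((n : ℝ) - 1) / n := by
  have hn0 : (n : ℝ) ≠ 0 := by positivity
  obtain ⟨h1, h1'⟩ := integral_thetaTilde_sub_pow hn hadm hmeas hindep hlaw (b := 1) (by norm_num)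
  obtain ⟨h2, h2'⟩ := integral_thetaTilde_sub_pow hn hadm hmeas hindep hlaw (b := 2) (by norm_num)
  rw [powerSumMoment_0_1 _ signMoment_zero signMoment_one] at h1'
  rw [powerSumMoment_0_2 _ signMoment_zero signMoment_one, signMoment] at h2'
  have hfun : (fun ω => 1 - thetaTilde (fun i => X i ω) ^ 2) = fun ω =>
      (1 - θ ^ 2) - (2 * θ * (thetaTilde (fun i => X i ω) - θ) ^ 1
        + (thetaTilde (fun i => X i ω) - θ) ^ 2) := by
    funext ω
    ring
  have h3 : Integrable (fun ω => 2 * θ * (thetaTilde (fun i => X i ω) - θ) ^ 1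
      + (thetaTilde (fun i => X i ω) - θ) ^ 2) P := (h1.const_mul (2 * θ)).add h2
  rw [hfun]
  refine ⟨(integrable_const _).sub h3, ?_⟩
  rw [integral_sub (integrable_const _) h3, integral_add (h1.const_mul _) h2, integral_const_mul,
    h1', h2']
  simp
  field_simp
  ring

/-- All signs have square 1, so their sample variance is a function of their mean alone. A zero
observation would break this. -/
lemma sampleVar_signs (hn : 2 ≤ n) {x : Fin n → ℝ} (hx : ∀ i, x i ≠ 0) :
    sampleVar (signs x) = n / ((n : ℝ) - 1) * (1 - thetaTilde x ^ 2) := by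
  have hn0 : (n : ℝ) ≠ 0 := by positivity
  have hn1 : (n : ℝ) - 1 ≠ 0 := by
    have : (2 : ℝ) ≤ n := by exact_mod_cast hn
    linarith
  have h : ∀ j, (signs x j - 0) ^ 2 = 1 := fun j => by
    rcases Real.sign_apply_eq_of_ne_zero (x j) (hx j) with h | h <;> simp [signs, h]
  rw [sampleVar_eq_powerSums hn _ 0, thetaTilde, sampleMean]
  simp only [h]
  simp
  field_simp

lemma abs_thetaTilde_le_one (hn : 2 ≤ n) (x : Fin n → ℝ) : |thetaTilde x| ≤ 1 := by
  have hn0 : (0 : ℝ) < n := by positivity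
  rw [thetaTilde, sampleMean, abs_mul, abs_of_pos (by positivity : 0 < 1 / (n : ℝ)),
    one_div_mul_eq_div, div_le_one hn0]
  refine (Finset.abs_sum_le_sum_abs _ _).trans ?_
  refine (Finset.sum_le_sum (g := fun _ => (1 : ℝ)) fun j _ => ?_).trans (by simp)
  rcases Real.sign_apply_eq (x j) with h | h | h <;> simp [signs, h]

end Moments

/-! ### Pointwise control of the truncation. -/

section Pointwise

variable {n : ℕ} {ν θ : ℝ}

lemma nuHat_sub (x : Fin n → ℝ) (ν θ : ℝ) :
    nuHat x - ν = 6 / Real.pi ^ 2 * (sampleVar (logs x) - DV ν θ)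
      - 3 / 2 * (sampleVar (signs x) - (1 - θ ^ 2)) := by
  have := Real.pi_pos
  rw [nuHat, DV]
  field_simp
  ring

lemma abs_nuHat_sub_le (x : Fin n → ℝ) (ν θ : ℝ) :
    |nuHat x - ν| ≤ |6 / Real.pi ^ 2 * (sampleVar (logs x) - DV ν θ)|
      + |3 / 2 * (sampleVar (signs x) - (1 - θ ^ 2))| := by
  rw [nuHat_sub x ν θ]
  exact abs_sub _ _

/-- Admissibility is `(1 + |θ|)² ≤ 4ν`; the rest is a difference of squares. -/
lemma Admissible.thetaBound_sub_le (hadm : Admissible ν θ) (u : ℝ) :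
    (1 + |u|) ^ 2 / 4 - ν ≤ (|u| - |θ|) * (2 + |u| + |θ|) / 4 := by
  have h1 : (1 + |θ|) ^ 2 ≤ 4 * ν := by
    have h2 : |θ| ≤ 2 * √ν - 1 := hadm.2.trans (min_le_right _ _)
    calc (1 + |θ|) ^ 2 ≤ (2 * √ν) ^ 2 := pow_le_pow_left₀ (by positivity) (by linarith) 2
      _ = 4 * ν := by
        rw [mul_pow, Real.sq_sqrt (by linarith [hadm.1])]
        norm_num
  linarith

/-- A maximum only raises `z`, so `l` needs control from above alone. -/
lemma abs_max_sub_le {z l c s : ℝ} (hz : |z - c| ≤ s) (hl : l - c ≤ s) : |max z l - c| ≤ s := by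
  rw [abs_le] at hz ⊢
  refine ⟨by linarith [le_max_left z l], ?_⟩
  rw [sub_le_iff_le_add]
  exact max_le (by linarith) (by linarith)

/-- An overshoot requires `|θ̃| > |θ|`. Then `(3/2)(θ̃² - θ²)` dominates it and, by
`sampleVar_signs`, is the negative of the sign error up to the last term. -/
lemma abs_nuTilde_sub_le_of_le_sq (hn : 2 ≤ n) (hadm : Admissible ν θ) (hθ : 9 / 25 ≤ θ ^ 2)
    {x : Fin n → ℝ} (hx : ∀ i, x i ≠ 0) :
    |nuTilde x - ν| ≤ |6 / Real.pi ^ 2 * (sampleVar (logs x) - DV ν θ)|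
      + |3 / 2 * (sampleVar (signs x) - (1 - θ ^ 2))|
      + 3 / 2 / ((n : ℝ) - 1) * (1 - thetaTilde x ^ 2) := by
  have hm0 : (0 : ℝ) < (n : ℝ) - 1 := by
    have : (2 : ℝ) ≤ n := by exact_mod_cast hn
    linarith
  have hu := abs_thetaTilde_le_one hn x
  have hu2 : 0 ≤ 1 - thetaTilde x ^ 2 := by
    rw [sub_nonneg]
    exact (sq_le_one_iff_abs_le_one _).mpr hu
  have hh : 0 ≤ 3 / 2 / ((n : ℝ) - 1) * (1 - thetaTilde x ^ 2) := by positivity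
  have hV := abs_nonneg (6 / Real.pi ^ 2 * (sampleVar (logs x) - DV ν θ))
  refine abs_max_sub_le ((abs_nuHat_sub_le x ν θ).trans (by linarith))
    ((hadm.thetaBound_sub_le _).trans ?_)
  set u := thetaTilde x with hu_def
  have hU : 3 / 2 * (sampleVar (signs x) - (1 - θ ^ 2))
      = 3 / 2 * (|θ| ^ 2 - |u| ^ 2) + 3 / 2 / ((n : ℝ) - 1) * (1 - u ^ 2) := by
    rw [sampleVar_signs hn hx, ← hu_def, sq_abs, sq_abs]
    field_simp
    ring
  have hU' := neg_abs_le (3 / 2 * (sampleVar (signs x) - (1 - θ ^ 2)))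
  have hθ' : 3 / 5 ≤ |θ| := abs_le_of_sq_le_sq (by rw [sq_abs]; linarith) (abs_nonneg _) |>.trans'
    (le_abs_self _)
  rcases le_total |u| |θ| with h | h
  · have h1 : (|u| - |θ|) * (2 + |u| + |θ|) / 4 ≤ 0 := by
      have : 0 ≤ (|θ| - |u|) * (2 + |u| + |θ|) := mul_nonneg (by linarith) (by positivity)
      linarith
    have := abs_nonneg (3 / 2 * (sampleVar (signs x) - (1 - θ ^ 2)))
    linarith
  · have h1 : 0 ≤ (|u| - |θ|) * (5 * (|u| + |θ|) - 2) := mul_nonneg (by linarith) (by linarith)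
    linarith

/-- For small `|θ|` the overshoot is bounded by `(3 + |θ|)/4 · |θ̃ - θ|`, and the fourth power of a
maximum is at most the sum of the fourth powers. -/
lemma nuTilde_sub_pow_four_le (hn : 2 ≤ n) (hadm : Admissible ν θ) (x : Fin n → ℝ) :
    (nuTilde x - ν) ^ 4 ≤ (|6 / Real.pi ^ 2 * (sampleVar (logs x) - DV ν θ)|
      + |3 / 2 * (sampleVar (signs x) - (1 - θ ^ 2))|) ^ 4
      + ((3 + |θ|) / 4) ^ 4 * (thetaTilde x - θ) ^ 4 := by
  have hu := abs_thetaTilde_le_one hn x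
  set s := |6 / Real.pi ^ 2 * (sampleVar (logs x) - DV ν θ)|
      + |3 / 2 * (sampleVar (signs x) - (1 - θ ^ 2))| with hs
  have hs0 : 0 ≤ s := by positivity
  set r := (3 + |θ|) / 4 * |thetaTilde x - θ| with hr
  have hr0 : 0 ≤ r := by positivity
  have hL : (1 + |thetaTilde x|) ^ 2 / 4 - ν ≤ r := by
    refine (hadm.thetaBound_sub_le _).trans ?_
    have h1 := abs_sub_abs_le_abs_sub (thetaTilde x) θ
    have h2 : (|thetaTilde x| - |θ|) * (2 + |thetaTilde x| + |θ|)
        ≤ |thetaTilde x - θ| * (2 + |thetaTilde x| + |θ|) := by gcongr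
    have h3 : |thetaTilde x - θ| * (2 + |thetaTilde x| + |θ|) ≤ |thetaTilde x - θ| * (3 + |θ|) := by
      gcongr
      linarith
    linarith
  have hmax : |nuTilde x - ν| ≤ max s r := abs_max_sub_le
    ((abs_nuHat_sub_le x ν θ).trans (le_max_left _ _)) (hL.trans (le_max_right _ _))
  have hr4 : r ^ 4 = ((3 + |θ|) / 4) ^ 4 * (thetaTilde x - θ) ^ 4 := by
    rw [hr, mul_pow, Even.pow_abs (by decide)]
  rw [← hr4, ← Even.pow_abs (by decide : Even 4)]
  refine (pow_le_pow_left₀ (abs_nonneg _) hmax 4).trans ?_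
  rcases max_choice s r with h | h <;> rw [h]
  · linarith [pow_nonneg hr0 4]
  · linarith [pow_nonneg hs0 4]

/-- The factor `n^{1/4}` in `P3'` turns `n^{9/4}` into `n²`, and the two terms with `P3⁴` cancel. -/
lemma bound_eq (hn : 2 ≤ n) : P3 ν θ ^ 4 / (n : ℝ) ^ 2 + P3' n ν θ / (n : ℝ) ^ (9 / 4 : ℝ)
    = rootBound n ν θ ^ 4 / (n : ℝ) ^ 2 := by
  have hn0 : (0 : ℝ) < n := by positivity
  have h : (n : ℝ) ^ (9 / 4 : ℝ) = (n : ℝ) ^ 2 * (n : ℝ) ^ (1 / 4 : ℝ) := by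
    rw [← Real.rpow_natCast, ← Real.rpow_add hn0]
    norm_num
  rw [h, P3', ← rootBound]
  have : 0 < (n : ℝ) ^ (1 / 4 : ℝ) := by positivity
  field_simp
  ring

end Pointwise

end StableEst

/-! ### Assembly of the moment bounds. -/

namespace StableEst

open Filter

variable {Ω : Type*} [MeasurableSpace Ω] {P : Measure Ω} {n : ℕ}
  {ν θ τ : ℝ} {X : Fin n → Ω → ℝ}

lemma div_sqrt_pow_four (p : ℝ) (n : ℕ) : (p / √(n : ℝ)) ^ 4 = p ^ 4 / (n : ℝ) ^ 2 := by
  rw [div_pow, show √(n : ℝ) ^ 4 = (√(n : ℝ) ^ 2) ^ 2 by ring, Real.sq_sqrt (Nat.cast_nonneg n)]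

lemma integral_abs_mul_pow_four_le {Z : Ω → ℝ} {c V p : ℝ}
    (hi : Integrable (fun ω => Z ω ^ 4) P) (hv : ∫ ω, Z ω ^ 4 ∂P = V / (n : ℝ) ^ 2)
    (hp : c ^ 4 * V ≤ p ^ 4) :
    Integrable (fun ω => |c * Z ω| ^ 4) P ∧ ∫ ω, |c * Z ω| ^ 4 ∂P ≤ (p / √(n : ℝ)) ^ 4 := by
  have h : (fun ω => |c * Z ω| ^ 4) = fun ω => c ^ 4 * Z ω ^ 4 := by
    funext ω
    rw [Even.pow_abs (by decide), mul_pow]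
  rw [h]
  refine ⟨hi.const_mul _, ?_⟩
  rw [integral_const_mul, hv, div_sqrt_pow_four, ← mul_div_assoc]
  gcongr

lemma integrable_and_integral_le_of_le {f g : Ω → ℝ} {b c : ℝ} (hf : Measurable f)
    (h0 : ∀ ω, 0 ≤ f ω) (hfg : ∀ᵐ ω ∂P, f ω ≤ g ω) (hg : Integrable g P) (hb : ∫ ω, g ω ∂P ≤ b)
    (hbc : b ≤ c) : Integrable f P ∧ ∫ ω, f ω ∂P ≤ c := by
  have hi : Integrable f P := by
    refine hg.mono' hf.aestronglyMeasurable ?_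
    filter_upwards [hfg] with ω hω
    rwa [Real.norm_of_nonneg (h0 ω)]
  exact ⟨hi, ((integral_mono_ae hi hg hfg).trans hb).trans hbc⟩

variable [IsProbabilityMeasure P]

lemma ae_forall_ne_zero (hadm : Admissible ν θ) (hmeas : ∀ i, Measurable (X i))
    (hlaw : ∀ i, IsStrictlyStableLaw (P.map (X i)) ν θ τ) : ∀ᵐ ω ∂P, ∀ i, X i ω ≠ 0 := by
  rw [ae_all_iff]
  intro i
  have := Measure.isProbabilityMeasure_map (μ := P) (hmeas i).aemeasurable
  exact ae_of_ae_map (hmeas i).aemeasurable ((hlaw i).measure_zero hadm)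

lemma integral_abs_add_abs_pow_four_le (hn : 2 ≤ n) (hadm : Admissible ν θ)
    (hmeas : ∀ i, Measurable (X i)) (hindep : iIndepFun X P)
    (hlaw : ∀ i, IsStrictlyStableLaw (P.map (X i)) ν θ τ) {p q : ℝ} (hp0 : 0 ≤ p) (hq0 : 0 ≤ q)
    (hp : (6 / Real.pi ^ 2) ^ 4 * (3 * (Real.pi ^ 4 * q4 ν θ + 2 * DV ν θ ^ 2) ^ 2
      + P2 n ν θ / n) ≤ p ^ 4)
    (hq : (3 / 2) ^ 4 * (48 * (θ ^ 2) ^ 2 * (1 - θ ^ 2) ^ 2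
      + quarticSign (1 / ((n : ℝ) - 1)) (θ ^ 2) / n) ≤ q ^ 4) :
    Integrable (fun ω => (|6 / Real.pi ^ 2 * (sampleVar (logs fun i => X i ω) - DV ν θ)|
        + |3 / 2 * (sampleVar (signs fun i => X i ω) - (1 - θ ^ 2))|) ^ 4) P ∧
      ∫ ω, (|6 / Real.pi ^ 2 * (sampleVar (logs fun i => X i ω) - DV ν θ)|
        + |3 / 2 * (sampleVar (signs fun i => X i ω) - (1 - θ ^ 2))|) ^ 4 ∂P
        ≤ (p / √(n : ℝ) + q / √(n : ℝ)) ^ 4 := by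
  have hX : Measurable fun ω i => X i ω := measurable_pi_lambda _ hmeas
  obtain ⟨h1, h2⟩ := integral_sampleVar_logs hn hadm hmeas hindep hlaw
  obtain ⟨h3, h4⟩ := integral_sampleVar_signs hn hadm hmeas hindep hlaw
  obtain ⟨h5, h6⟩ := integral_abs_mul_pow_four_le h1 h2 hp
  obtain ⟨h7, h8⟩ := integral_abs_mul_pow_four_le h3 h4 hq
  refine integral_add_pow_four_le ?_ ?_ h5 h7 (by positivity) (by positivity) h6 h8
  · exact (measurable_norm.comp (((measurable_sampleVar.comp
      (measurable_logs.comp hX)).sub_const _).const_mul _)).aestronglyMeasurable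
  · exact (measurable_norm.comp (((measurable_sampleVar.comp
      (measurable_signs.comp hX)).sub_const _).const_mul _)).aestronglyMeasurable

/-- Since `0 ≤ 1 - θ̃² ≤ 1`, the fourth power is at most the first, whose mean is explicit. -/
lemma integral_one_sub_thetaTilde_sq_pow_four_le (hn : 2 ≤ n) (hadm : Admissible ν θ)
    (hmeas : ∀ i, Measurable (X i)) (hindep : iIndepFun X P)
    (hlaw : ∀ i, IsStrictlyStableLaw (P.map (X i)) ν θ τ) {h : ℝ}
    (hh : (3 / 2) ^ 4 * (n * (1 - θ ^ 2) / ((n : ℝ) - 1) ^ 3) ≤ h ^ 4) :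
    Integrable (fun ω => (3 / 2 / ((n : ℝ) - 1) * (1 - thetaTilde (fun i => X i ω) ^ 2)) ^ 4) P ∧
      ∫ ω, (3 / 2 / ((n : ℝ) - 1) * (1 - thetaTilde (fun i => X i ω) ^ 2)) ^ 4 ∂P
        ≤ (h / √(n : ℝ)) ^ 4 := by
  have hn0 : (0 : ℝ) < n := by positivity
  have hm0 : (0 : ℝ) < (n : ℝ) - 1 := by
    have : (2 : ℝ) ≤ n := by exact_mod_cast hn
    linarith
  have hX : Measurable fun ω i => X i ω := measurable_pi_lambda _ hmeas
  have hmeas' : Measurable fun ω =>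
      (3 / 2 / ((n : ℝ) - 1) * (1 - thetaTilde (fun i => X i ω) ^ 2)) ^ 4 :=
    ((((measurable_sampleMean.comp (measurable_signs.comp hX)).pow_const 2).const_sub
      1).const_mul _).pow_const 4
  obtain ⟨h1, h2⟩ := integral_one_sub_thetaTilde_sq hn hadm hmeas hindep hlaw
  have hle : ∀ ω, (3 / 2 / ((n : ℝ) - 1) * (1 - thetaTilde (fun i => X i ω) ^ 2)) ^ 4
      ≤ (3 / 2 / ((n : ℝ) - 1)) ^ 4 * (1 - thetaTilde (fun i => X i ω) ^ 2) := by
    intro ω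
    have h3 := (sq_le_one_iff_abs_le_one _).mpr (abs_thetaTilde_le_one hn fun i => X i ω)
    rw [mul_pow]
    gcongr
    exact pow_le_of_le_one (by linarith) (by linarith [sq_nonneg (thetaTilde fun i => X i ω)])
      (by norm_num)
  have hint := h1.const_mul ((3 / 2 / ((n : ℝ) - 1)) ^ 4)
  have hi : Integrable (fun ω =>
      (3 / 2 / ((n : ℝ) - 1) * (1 - thetaTilde (fun i => X i ω) ^ 2)) ^ 4) P := by
    refine hint.mono' hmeas'.aestronglyMeasurable (Eventually.of_forall fun ω => ?_)
    rw [Real.norm_of_nonneg (Even.pow_nonneg (by decide) _)]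
    exact hle ω
  refine ⟨hi, (integral_mono hi hint hle).trans ?_⟩
  rw [integral_const_mul, h2, div_sqrt_pow_four]
  calc _ = (3 / 2) ^ 4 * (n * (1 - θ ^ 2) / ((n : ℝ) - 1) ^ 3) / (n : ℝ) ^ 2 := by field_simp
    _ ≤ _ := by gcongr

theorem integral_nuTilde_sub_pow_four_le (hn : 2 ≤ n) (hadm : Admissible ν θ)
    (hmeas : ∀ i, Measurable (X i)) (hindep : iIndepFun X P)
    (hlaw : ∀ i, IsStrictlyStableLaw (P.map (X i)) ν θ τ) :
    Integrable (fun ω => (nuTilde (fun i => X i ω) - ν) ^ 4) P ∧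
      ∫ ω, (nuTilde (fun i => X i ω) - ν) ^ 4 ∂P ≤ rootBound n ν θ ^ 4 / (n : ℝ) ^ 2 := by
  have hX : Measurable fun ω i => X i ω := measurable_pi_lambda _ hmeas
  have hθm : Measurable fun ω => thetaTilde (fun i => X i ω) :=
    measurable_sampleMean.comp (measurable_signs.comp hX)
  have hVm : Measurable fun ω => sampleVar (logs fun i => X i ω) :=
    measurable_sampleVar.comp (measurable_logs.comp hX)
  have hUm : Measurable fun ω => sampleVar (signs fun i => X i ω) :=
    measurable_sampleVar.comp (measurable_signs.comp hX)
  have hm : Measurable fun ω => (nuTilde (fun i => X i ω) - ν) ^ 4 := by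
    refine ((Measurable.max ?_ ?_).sub_const ν).pow_const 4
    · exact ((hVm.const_mul _).sub (hUm.const_mul _)).add_const 1
    · exact (((measurable_norm.comp hθm).const_add 1).pow_const 2).div_const 4
  have h0 : ∀ ω, 0 ≤ (nuTilde (fun i => X i ω) - ν) ^ 4 := fun ω => Even.pow_nonneg (by decide) _
  -- For larger `|θ|` the truncation excess is a third summand in Minkowski's inequality; for
  -- smaller `|θ|` its fourth power is added outside.
  rcases le_total (9 / 25) (θ ^ 2) with hθ | hθ
  · obtain ⟨p, q, h, hp0, hq0, hh0, hp, hq, hh, hle⟩ := exists_roots_of_le_sq hn hadm hθ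
    obtain ⟨h1, h2⟩ := integral_abs_add_abs_pow_four_le hn hadm hmeas hindep hlaw hp0 hq0 hp hq
    obtain ⟨h3, h4⟩ := integral_one_sub_thetaTilde_sq_pow_four_le hn hadm hmeas hindep hlaw hh
    obtain ⟨h5, h6⟩ := integral_add_pow_four_le
      ((measurable_norm.comp ((hVm.sub_const _).const_mul _)).add
        (measurable_norm.comp ((hUm.sub_const _).const_mul _))).aestronglyMeasurable
      (((hθm.pow_const 2).const_sub 1).const_mul _).aestronglyMeasurable h1 h3
      (by positivity) (by positivity) h2 h4
    refine integrable_and_integral_le_of_le hm h0 ?_ h5 h6 ?_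
    · filter_upwards [ae_forall_ne_zero hadm hmeas hlaw] with ω hω
      rw [← Even.pow_abs (by decide : Even 4)]
      exact pow_le_pow_left₀ (abs_nonneg _) (abs_nuTilde_sub_le_of_le_sq hn hadm hθ hω) 4
    · rw [← add_div, ← add_div, div_sqrt_pow_four]
      gcongr
  · obtain ⟨p, q, hp0, hq0, hp, hq, hle⟩ := exists_roots_of_sq_le hn hadm hθ
    obtain ⟨h1, h2⟩ := integral_abs_add_abs_pow_four_le hn hadm hmeas hindep hlaw hp0 hq0 hp hq
    obtain ⟨h3, h4⟩ := integral_thetaTilde_sub_pow_four hn hadm hmeas hindep hlaw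
    have h5 := h3.const_mul (((3 + |θ|) / 4) ^ 4)
    refine integrable_and_integral_le_of_le hm h0
      (Eventually.of_forall fun ω => nuTilde_sub_pow_four_le hn hadm _) (h1.add h5) le_rfl ?_
    rw [integral_add h1 h5, integral_const_mul, h4]
    refine (add_le_add_left h2 _).trans ?_
    rw [← add_div, div_sqrt_pow_four, ← mul_div_assoc, ← add_div]
    gcongr

end StableEst

theorem lemma3p4 {Ω : Type*} [MeasurableSpace Ω] (P : MeasureTheory.Measure Ω)
    [MeasureTheory.IsProbabilityMeasure P] (n : ℕ) (hn : 2 ≤ n) (ν θ τ : ℝ)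
    (hadm : StableEst.Admissible ν θ) (X : Fin n → Ω → ℝ) (hmeas : ∀ i, Measurable (X i))
    (hindep : ProbabilityTheory.iIndepFun X P)
    (hlaw : ∀ i, StableEst.IsStrictlyStableLaw (P.map (X i)) ν θ τ) :
    MeasureTheory.Integrable (fun ω => (StableEst.nuTilde (fun i => X i ω) - ν) ^ 4) P ∧
      ∫ ω, (StableEst.nuTilde (fun i => X i ω) - ν) ^ 4 ∂P ≤
        StableEst.P3 ν θ ^ 4 / (n : ℝ) ^ 2
          + StableEst.P3' n ν θ / (n : ℝ) ^ (9 / 4 : ℝ) := by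
  rw [StableEst.bound_eq hn]
  exact StableEst.integral_nuTilde_sub_pow_four_le hn hadm hmeas hindep hlaw
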